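/- Let $M$ be a smooth (Hausdorff, second countable, finite-dimensional) manifold and let $\pi:A\to M$ be a smooth affine bundle of rank $n>0$: a locally trivial smooth bundle whose fibres $A_x$ are affine spaces and whose local trivializations are affine on the fibres. An affine function on $A$ is a smooth function $a:A\to\mathbb R$ whose restriction to each fibre is affine. Let $A^+\to M$ be the vector bundle of rank $n+1$ with fibres $A^+_x=\mathrm{Aff}(A_x,\mathbb R)$; its sections $\tilde a\in\Gamma(A^+)$ are identified with the affine functions $a$ on $A$, and $\tilde 1\in\Gamma(A^+)$ is the section corresponding to the constant function $1$. A Jacobi structure on $A$ is a pair $(\Lambda,E)$ of a bivector field and a vector field on $A$ with $[\Lambda,\Lambda]_{SN}=-2E\wedge\Lambda$ and $[E,\Lambda]_{SN}=0$, where $[\cdot,\cdot]_{SN}$ is the Schouten bracket, with the sign convention for which $[X\wedge Y,X\wedge Y]_{SN}=2\,X\wedge Y\wedge[X,Y]$. Its Jacobi bracket is $\{f,g\}=\Lambda(df,dg)+fE(g)-gE(f)$ and the hamiltonian vector field of $f$ is $X_f=\#_\Lambda(df)+fE$, where $\beta(\#_\Lambda(\alpha))=\Lambda(\alpha,\beta)$.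 It is affine if $\{a,b\}$ is affine for all affine functions $a,b$, and strongly-affine if it is affine and $X_a(b)$ is an affine function for all affine functions $a,b$. A Lie algebroid structure on $A^+$ is a pair consisting of a real Lie algebra bracket $[\![\cdot,\cdot]\!]$ on $\Gamma(A^+)$ and a vector bundle morphism $\rho:A^+\to TM$ with $[\![X,fY]\!]=f[\![X,Y]\!]+\rho(X)(f)Y$ for all $X,Y\in\Gamma(A^+)$ and $f\in C^\infty(M)$. It is almost-special if the $C^\infty(M)$-submodule of $\Gamma(A^+)$ generated by $\tilde 1$ is an ideal of the Lie algebra $\Gamma(A^+)$. Then there is a one-to-one correspondence between the strongly-affine Jacobi structures on $A$ and the almost-special Lie algebroid structures on $A^+$: there is a bijection under which $(\Lambda,E)$ corresponds to $([\![\cdot,\cdot]\!],\rho)$ if and only if $$[\![\tilde a,\tilde b]\!]=\widetilde{\{a,b\}}\quad\text{for all affine functions } a,b \text{ on } A,$$ and in this case the anchor is given by $\rho(\tilde a)(f)\circ\pi=\{a,f\circ\pi\}-(f\circ\pi)\{a,1\}$ for all affine functions $a$ and all $f\in C^\infty(M)$. -/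

import Mathlib

open Bundle Set
open scoped Manifold ContDiff Topology

noncomputable section

/-! ## Jacobi structures on a manifold -/

section Jacobi

variable {E : Type*} [NormedAddCommGroup E] [NormedSpace ℝ E] [FiniteDimensional ℝ E]
  {H : Type*} [TopologicalSpace H] (I : ModelWithCorners ℝ E H)
  (N : Type*) [TopologicalSpace N] [ChartedSpace H N]

/-- A `2`-vector (bivector field) on a manifold: at each point `p` an alternating bilinear form
on the cotangent space `T_p^*N`, depending smoothly on `p`, i.e. `Λ(df, dg)` is a smooth function
for all smooth functions `f`, `g`. -/
structure BivectorField where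
  toFun : ∀ p : N, LinearMap.BilinForm ℝ (Module.Dual ℝ (TangentSpace I p))
  alternating : ∀ (p : N) (α : Module.Dual ℝ (TangentSpace I p)), toFun p α α = 0
  smooth : ∀ f g : N → ℝ, ContMDiff I 𝓘(ℝ, ℝ) ∞ f → ContMDiff I 𝓘(ℝ, ℝ) ∞ g →
    ContMDiff I 𝓘(ℝ, ℝ) ∞ (fun p => toFun p (mvfderiv I f p) (mvfderiv I g p))

variable {I N}

/-- The derivative `X(f)` of a function along a (not necessarily smooth) vector field. -/
def dirDeriv (X : ∀ p : N, TangentSpace I p) (f : N → ℝ) : N → ℝ :=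
  fun p => mvfderiv I f p (X p)

namespace BivectorField

/-- The function `Λ(df, dg)`. -/
def apply (Λ : BivectorField I N) (f g : N → ℝ) : N → ℝ :=
  fun p => Λ.toFun p (mvfderiv I f p) (mvfderiv I g p)

/-- The map `#_Λ : T_p^*N → T_pN`, characterized by `β(#_Λ(α)) = Λ(α, β)`. -/
def sharp (Λ : BivectorField I N) (p : N) (α : Module.Dual ℝ (TangentSpace I p)) :
    TangentSpace I p :=
  haveI : FiniteDimensional ℝ (TangentSpace I p) := inferInstanceAs (FiniteDimensional ℝ E)
  (Module.evalEquiv ℝ (TangentSpace I p)).symm (Λ.toFun p α)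

/-- The Schouten bracket `[Λ, Λ]_SN` of a `2`-vector with itself, as a `3`-vector evaluated on
`(df, dg, dh)`. The sign is that of the Schouten bracket which is a graded Lie bracket with
`[P, Q ∧ R] = [P, Q] ∧ R + (-1)^((p-1)q) Q ∧ [P, R]`, extending the Lie bracket of vector fields;
so `[X ∧ Y, X ∧ Y]_SN = 2 X ∧ Y ∧ [X, Y]`. -/
def schoutenSelf (Λ : BivectorField I N) (f g h : N → ℝ) : N → ℝ :=
  fun p => -2 * (Λ.apply (Λ.apply f g) h p + Λ.apply (Λ.apply g h) f p
    + Λ.apply (Λ.apply h f) g p)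

/-- The Schouten bracket `[E, Λ]_SN` of a vector field with a `2`-vector, i.e. the Lie derivative
of `Λ` along `E`, as a `2`-vector evaluated on `(df, dg)`. -/
def schoutenVector (X : ∀ p : N, TangentSpace I p) (Λ : BivectorField I N) (f g : N → ℝ) : N → ℝ :=
  fun p => dirDeriv X (Λ.apply f g) p - Λ.apply (dirDeriv X f) g p - Λ.apply f (dirDeriv X g) p

/-- The wedge product `E ∧ Λ` of a vector field with a `2`-vector, as a `3`-vector evaluated on
`(df, dg, dh)`. -/
def wedgeVector (X : ∀ p : N, TangentSpace I p) (Λ : BivectorField I N) (f g h : N → ℝ) : N → ℝ :=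
  fun p => dirDeriv X f p * Λ.apply g h p + dirDeriv X g p * Λ.apply h f p
    + dirDeriv X h p * Λ.apply f g p

end BivectorField

variable (I N) in
/-- A Jacobi structure `(Λ, E)` on a manifold: `[Λ, Λ]_SN = -2 E ∧ Λ` and `[E, Λ]_SN = 0`. -/
structure JacobiStructure [IsManifold I ∞ N] where
  bivector : BivectorField I N
  reeb : Cₛ^∞⟮I; E, (TangentSpace I : N → Type _)⟯
  schouten_self : ∀ f g h : N → ℝ, ContMDiff I 𝓘(ℝ, ℝ) ∞ f → ContMDiff I 𝓘(ℝ, ℝ) ∞ g →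
    ContMDiff I 𝓘(ℝ, ℝ) ∞ h → ∀ p,
      bivector.schoutenSelf f g h p = -2 * BivectorField.wedgeVector reeb bivector f g h p
  schouten_reeb : ∀ f g : N → ℝ, ContMDiff I 𝓘(ℝ, ℝ) ∞ f → ContMDiff I 𝓘(ℝ, ℝ) ∞ g → ∀ p,
    BivectorField.schoutenVector reeb bivector f g p = 0

namespace JacobiStructure

variable [IsManifold I ∞ N]

/-- The Jacobi bracket `{f, g} = Λ(df, dg) + f E(g) - g E(f)`. -/
def bracket (J : JacobiStructure I N) (f g : N → ℝ) : N → ℝ :=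
  fun p => J.bivector.apply f g p + f p * dirDeriv J.reeb g p - g p * dirDeriv J.reeb f p

/-- The hamiltonian vector field `X_f = #_Λ(df) + f E`. -/
def hamiltonian (J : JacobiStructure I N) (f : N → ℝ) (p : N) : TangentSpace I p :=
  J.bivector.sharp p (mvfderiv I f p) + f p • J.reeb p

end JacobiStructure

end Jacobi

/-! ## Lie algebroids -/

section Algebroid

variable {E : Type*} [NormedAddCommGroup E] [NormedSpace ℝ E]
  {H : Type*} [TopologicalSpace H] (I : ModelWithCorners ℝ E H)
  {M : Type*} [TopologicalSpace M] [ChartedSpace H M]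
  (F : Type*) [NormedAddCommGroup F] [NormedSpace ℝ F]
  (W : M → Type*) [∀ x, AddCommGroup (W x)] [∀ x, Module ℝ (W x)]
  [∀ x, TopologicalSpace (W x)] [TopologicalSpace (TotalSpace F W)] [FiberBundle F W]
  [VectorBundle ℝ F W]

variable {I F W} in
/-- The module structure over `C^∞(M)` on the space `Γ(W)` of smooth sections. -/
instance ContMDiffSection.instSMulSmoothMap :
    SMul C^∞⟮I, M; 𝓘(ℝ, ℝ), ℝ⟯ Cₛ^∞⟮I; F, W⟯ :=
  ⟨fun f s => ⟨fun x => f x • s x, f.contMDiff.smul_section s.contMDiff⟩⟩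

variable {I F W} in
instance ContMDiffSection.instModuleSmoothMap :
    Module C^∞⟮I, M; 𝓘(ℝ, ℝ), ℝ⟯ Cₛ^∞⟮I; F, W⟯ where
  one_smul s := ContMDiffSection.ext fun x => one_smul ℝ (s x)
  mul_smul f g s := ContMDiffSection.ext fun x => mul_smul (f x) (g x) (s x)
  smul_zero f := ContMDiffSection.ext fun x => smul_zero (f x)
  smul_add f s t := ContMDiffSection.ext fun x => smul_add (f x) (s x) (t x)
  add_smul f g s := ContMDiffSection.ext fun x => add_smul (f x) (g x) (s x)
  zero_smul s := ContMDiffSection.ext fun x => zero_smul ℝ (s x)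

/-- A Lie algebroid structure on a smooth vector bundle `W → M`: a real Lie algebra bracket on the
space of smooth sections and a smooth vector bundle morphism `ρ : W → TM`, the anchor, with
`⟦X, f Y⟧ = f ⟦X, Y⟧ + ρ(X)(f) Y`. -/
structure LieAlgebroid [IsManifold I ∞ M] [ContMDiffVectorBundle ∞ F W I] where
  bracket : Cₛ^∞⟮I; F, W⟯ →ₗ[ℝ] Cₛ^∞⟮I; F, W⟯ →ₗ[ℝ] Cₛ^∞⟮I; F, W⟯
  anchor : ∀ x : M, W x →ₗ[ℝ] TangentSpace I x
  bracket_self : ∀ X, bracket X X = 0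
  jacobi : ∀ X Y Z, bracket X (bracket Y Z) + bracket Y (bracket Z X)
    + bracket Z (bracket X Y) = 0
  anchor_smooth : ContMDiff (I.prod 𝓘(ℝ, F)) I.tangent ∞
    (fun w : TotalSpace F W => (⟨w.proj, anchor w.proj w.snd⟩ : TangentBundle I M))
  leibniz : ∀ (X Y : Cₛ^∞⟮I; F, W⟯) (f : C^∞⟮I, M; 𝓘(ℝ, ℝ), ℝ⟯) (x : M),
    bracket X (f • Y) x = f x • bracket X Y x + mvfderiv I f x (anchor x (X x)) • Y x

variable {I F W} in
/-- A Lie algebroid structure on a special vector bundle `(W, X)` is almost-special if the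
`C^∞(M)`-submodule of `Γ(W)` generated by `X` is an ideal of the Lie algebra `Γ(W)`. -/
def LieAlgebroid.IsAlmostSpecial [IsManifold I ∞ M] [ContMDiffVectorBundle ∞ F W I]
    (L : LieAlgebroid I F W) (X : Cₛ^∞⟮I; F, W⟯) : Prop :=
  ∀ Y : Cₛ^∞⟮I; F, W⟯, ∀ Z ∈ Submodule.span C^∞⟮I, M; 𝓘(ℝ, ℝ), ℝ⟯ {X},
    L.bracket Y Z ∈ Submodule.span C^∞⟮I, M; 𝓘(ℝ, ℝ), ℝ⟯ {X}

end Algebroid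

/-! ## Affine bundles -/

section AffineBundle

variable {E : Type*} [NormedAddCommGroup E] [NormedSpace ℝ E]
  {H : Type*} [TopologicalSpace H] (I : ModelWithCorners ℝ E H)
  {M : Type*} [TopologicalSpace M] [ChartedSpace H M]
  (F : Type*) [NormedAddCommGroup F] [NormedSpace ℝ F]
  {V : M → Type*} [∀ x, AddCommGroup (V x)] [∀ x, Module ℝ (V x)]
  (A : M → Type*) [∀ x, AddTorsor (V x) (A x)]
  [∀ x, TopologicalSpace (A x)] [TopologicalSpace (TotalSpace F A)] [FiberBundle F A]

/-- A bundle `A → M` with model fibre `F` is smooth if the transition maps between its local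
trivializations `A|_U ≃ U × F` are smooth. -/
class SmoothFiberBundle : Prop where
  contMDiffOn_symm_trans : ∀ (e e' : Trivialization F (π F A)) [MemTrivializationAtlas e]
    [MemTrivializationAtlas e'], ContMDiffOn (I.prod 𝓘(ℝ, F)) (I.prod 𝓘(ℝ, F)) ∞
      (e.toOpenPartialHomeomorph.symm ≫ₕ e'.toOpenPartialHomeomorph) (e.target ∩ e'.target)

/-- An affine bundle: a locally trivial bundle `A → M`, each fibre `A x` being an affine space
over the vector space `V x`, whose local trivializations `A|_U ≃ U × F` are affine on each fibre.
(The bundle structure of `A` determines that of the bundle of vector spaces `V x`.) -/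
class AffineBundle : Prop where
  exists_affineEquiv : ∀ (e : Trivialization F (π F A)) [MemTrivializationAtlas e] (x : M),
    x ∈ e.baseSet → ∃ φ : A x ≃ᵃ[ℝ] F, ∀ y : A x, (e ⟨x, y⟩).2 = φ y

namespace SmoothFiberBundle

/-- The total space of a smooth bundle is a smooth manifold. -/
instance isManifold_totalSpace [IsManifold I ∞ M] [SmoothFiberBundle I F A] :
    IsManifold (I.prod 𝓘(ℝ, F)) ∞ (TotalSpace F A) := by
  let PG : Pregroupoid (M × F) :=
    { property := fun f u => ContMDiffOn (I.prod 𝓘(ℝ, F)) (I.prod 𝓘(ℝ, F)) ∞ f u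
      comp := fun {f g u v} hf hg _ _ _ =>
        hg.comp (hf.mono inter_subset_left) inter_subset_right
      id_mem := contMDiffOn_id
      locality := fun {f u} _ h => contMDiffOn_of_locally_contMDiffOn h
      congr := fun {f g u} _ h hf => hf.congr h }
  have hG : HasGroupoid (TotalSpace F A) PG.groupoid := by
    refine ⟨?_⟩
    rintro _ _ ⟨e, he, rfl⟩ ⟨e', he', rfl⟩
    have : MemTrivializationAtlas e := ⟨he⟩
    have : MemTrivializationAtlas e' := ⟨he'⟩
    have key : ∀ (e e' : Trivialization F (π F A)) [MemTrivializationAtlas e]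
        [MemTrivializationAtlas e'], ContMDiffOn (I.prod 𝓘(ℝ, F)) (I.prod 𝓘(ℝ, F)) ∞
        (e.toOpenPartialHomeomorph.symm ≫ₕ e'.toOpenPartialHomeomorph)
        (e.toOpenPartialHomeomorph.symm ≫ₕ e'.toOpenPartialHomeomorph).source := by
      intro e e' _ _
      refine (contMDiffOn_symm_trans (I := I) e e').mono ?_
      rintro ⟨b, v⟩ hb
      have h : (b, v) ∈ (e.baseSet ∩ e'.baseSet) ×ˢ (Set.univ : Set F) :=
        (e.symm_trans_source_eq e').subset hb
      exact ⟨e.mem_target.2 h.1.1, e'.mem_target.2 h.1.2⟩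
    exact ⟨key e e', key e' e⟩
  refine { StructureGroupoid.HasGroupoid.comp PG.groupoid ?_ with }
  intro e he
  rw [isLocalStructomorphOn_contDiffGroupoid_iff]
  exact he

end SmoothFiberBundle

/-- A real function on the total space of an affine bundle is an affine function if it is smooth
and its restriction to each fibre is affine. -/
def IsAffineFunction (a : TotalSpace F A → ℝ) : Prop :=
  ContMDiff (I.prod 𝓘(ℝ, F)) 𝓘(ℝ, ℝ) ∞ a ∧
    ∀ x : M, ∃ φ : A x →ᵃ[ℝ] ℝ, ∀ y : A x, a ⟨x, y⟩ = φ y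

/-- A vector field on the total space of an affine bundle is affine if it maps affine functions to
affine functions. -/
def IsAffineVectorField (X : ∀ p : TotalSpace F A, TangentSpace (I.prod 𝓘(ℝ, F)) p) : Prop :=
  ∀ b : TotalSpace F A → ℝ, IsAffineFunction I F A b → IsAffineFunction I F A (dirDeriv X b)

variable {I F A} in
/-- A Jacobi structure on an affine bundle is affine if the Jacobi bracket of affine functions is
an affine function. -/
def JacobiStructure.IsAffine [FiniteDimensional ℝ E] [FiniteDimensional ℝ F] [IsManifold I ∞ M]
    [SmoothFiberBundle I F A]
    (J : JacobiStructure (I.prod 𝓘(ℝ, F)) (TotalSpace F A)) : Prop :=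
  ∀ a b : TotalSpace F A → ℝ, IsAffineFunction I F A a → IsAffineFunction I F A b →
    IsAffineFunction I F A (J.bracket a b)

variable {I F A} in
/-- An affine Jacobi structure is strongly-affine if the hamiltonian vector field of each affine
function is affine. -/
def JacobiStructure.IsStronglyAffine [FiniteDimensional ℝ E] [FiniteDimensional ℝ F]
    [IsManifold I ∞ M] [SmoothFiberBundle I F A]
    (J : JacobiStructure (I.prod 𝓘(ℝ, F)) (TotalSpace F A)) : Prop :=
  J.IsAffine ∧ ∀ a : TotalSpace F A → ℝ, IsAffineFunction I F A a →
    IsAffineVectorField I F A (J.hamiltonian a)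

/-! ### The vector dual `A⁺` of an affine bundle -/

variable {M : Type*} {V : M → Type*} [∀ x, AddCommGroup (V x)] [∀ x, Module ℝ (V x)]
  (A : M → Type*) [∀ x, AddTorsor (V x) (A x)] in
/-- The fibre `Aff(A_x, ℝ)` of the vector dual `A⁺` of an affine bundle `A`. -/
def AffDual (x : M) : Type _ := A x →ᵃ[ℝ] ℝ

namespace AffDual

section Fiber

variable {M : Type*} {V : M → Type*} [∀ x, AddCommGroup (V x)] [∀ x, Module ℝ (V x)]
  {A : M → Type*} [∀ x, AddTorsor (V x) (A x)] (x : M)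

instance : AddCommGroup (AffDual A x) := inferInstanceAs (AddCommGroup (A x →ᵃ[ℝ] ℝ))

instance : Module ℝ (AffDual A x) := inferInstanceAs (Module ℝ (A x →ᵃ[ℝ] ℝ))

variable {x} in
/-- The affine function on the fibre `A_x` given by an element of `A⁺_x`. -/
def toAffineMap (a : AffDual A x) : A x →ᵃ[ℝ] ℝ := a

variable (A) in
/-- The constant affine function `1` on `A_x`. -/
def one : AffDual A x := AffineMap.const ℝ (A x) (1 : ℝ)

/-- The topology of pointwise convergence on `Aff(A_x, ℝ)` (for a finite-dimensional fibre, the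
usual topology of a finite-dimensional vector space). -/
instance : TopologicalSpace (AffDual A x) :=
  TopologicalSpace.induced (fun (a : AffDual A x) (y : A x) => a.toAffineMap y) inferInstance

end Fiber

variable [FiniteDimensional ℝ F]

instance finiteDimensional_model : FiniteDimensional ℝ (F →ᴬ[ℝ] ℝ) :=
  (ContinuousAffineMap.decompLinearIsometryEquiv ℝ ℝ F ℝ).symm.toLinearEquiv.finiteDimensional

variable {F A}

/-- The linear isomorphism `Aff(A_x, ℝ) ≃ Aff(F, ℝ)` induced by an affine isomorphism
`A_x ≃ F`. -/
def fiberEquiv {x : M} (φ : A x ≃ᵃ[ℝ] F) : AffDual A x ≃ₗ[ℝ] (F →ᴬ[ℝ] ℝ) where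
  toFun a :=
    { a.toAffineMap.comp (φ.symm : F →ᵃ[ℝ] A x) with
      cont := AffineMap.continuous_of_finiteDimensional
        (a.toAffineMap.comp (φ.symm : F →ᵃ[ℝ] A x)) }
  invFun g := (g : F →ᵃ[ℝ] ℝ).comp (φ : A x →ᵃ[ℝ] F)
  map_add' _ _ := rfl
  map_smul' _ _ := rfl
  left_inv a := by
    refine AffineMap.ext fun y => ?_
    change a.toAffineMap (φ.symm (φ y)) = a.toAffineMap y
    rw [φ.symm_apply_apply]
  right_inv g := by
    refine ContinuousAffineMap.ext fun v => ?_
    change g (φ (φ.symm v)) = g v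
    rw [φ.apply_symm_apply]

theorem fiberEquiv_apply {x : M} (φ : A x ≃ᵃ[ℝ] F) (a : AffDual A x) (v : F) :
    fiberEquiv φ a v = a.toAffineMap (φ.symm v) := rfl

theorem fiberEquiv_symm_apply {x : M} (φ : A x ≃ᵃ[ℝ] F) (g : F →ᴬ[ℝ] ℝ) (y : A x) :
    ((fiberEquiv φ).symm g).toAffineMap y = g (φ y) := rfl

/-- Evaluations, as linear functionals on `Aff(F, ℝ)`. -/
def evalLinear (v : F) : (F →ᴬ[ℝ] ℝ) →ₗ[ℝ] ℝ where
  toFun g := g v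
  map_add' _ _ := rfl
  map_smul' _ _ := rfl

theorem isInducing_fiberEquiv {x : M} (φ : A x ≃ᵃ[ℝ] F) : Topology.IsInducing (fiberEquiv φ) := by
  let ev : (F →ᴬ[ℝ] ℝ) →ₗ[ℝ] (F → ℝ) := LinearMap.pi evalLinear
  have hev : Topology.IsInducing ev := by
    refine (LinearMap.isClosedEmbedding_of_injective (𝕜 := ℝ) (f := ev) ?_).isInducing
    refine LinearMap.ker_eq_bot.2 fun g g' h => ContinuousAffineMap.ext fun v => ?_
    exact congrFun h v
  have hφ : Topology.IsInducing (fun (u : A x → ℝ) (v : F) => u (φ.symm v)) :=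
    (Homeomorph.piCongrLeft (Y := fun _ => ℝ) φ.symm.toEquiv).symm.isInducing
  rw [← hev.of_comp_iff]
  exact hφ.comp ⟨rfl⟩

/-- A separating family of linear functionals on a finite-dimensional space spans its dual. -/
theorem span_of_separating {G ι : Type*} [NormedAddCommGroup G] [NormedSpace ℝ G]
    [FiniteDimensional ℝ G] (ℓ : ι → G →ₗ[ℝ] ℝ) (hℓ : ∀ g, (∀ i, ℓ i g = 0) → g = 0) :
    Submodule.span ℝ (range ℓ) = ⊤ := by
  rw [← Subspace.dualCoannihilator_dualAnnihilator_eq (W := Submodule.span ℝ (range ℓ))]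
  have : (Submodule.span ℝ (range ℓ)).dualCoannihilator = ⊥ := by
    rw [eq_bot_iff]
    intro g hg
    rw [Submodule.mem_dualCoannihilator] at hg
    exact hℓ g fun i => hg _ (Submodule.subset_span ⟨i, rfl⟩)
  rw [this, Submodule.dualAnnihilator_bot]

theorem continuousOn_of_separating {G ι : Type*} [NormedAddCommGroup G] [NormedSpace ℝ G]
    [FiniteDimensional ℝ G] (ℓ : ι → G →ₗ[ℝ] ℝ) (hℓ : ∀ g, (∀ i, ℓ i g = 0) → g = 0)
    {f : M → G} {s : Set M} (hf : ∀ i, ContinuousOn (fun x => ℓ i (f x)) s) :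
    ContinuousOn f s := by
  have hall : ∀ m : Module.Dual ℝ G, ContinuousOn (fun x => m (f x)) s := by
    intro m
    have hm : m ∈ Submodule.span ℝ (range ℓ) := span_of_separating ℓ hℓ ▸ Submodule.mem_top
    induction hm using Submodule.span_induction with
    | mem m hm => obtain ⟨i, rfl⟩ := hm; exact hf i
    | zero => exact continuousOn_const
    | add m m' _ _ h h' => exact h.add h'
    | smul c m _ h => exact continuousOn_const.mul h
  let b := Module.finBasis ℝ G
  have hcoord : ContinuousOn (fun x => b.equivFunL (f x)) s :=
    continuousOn_pi.2 fun i => hall (b.coord i)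
  refine (b.equivFunL.symm.continuous.comp_continuousOn hcoord).congr fun x _ => ?_
  simp

theorem contMDiffOn_of_separating {G ι : Type*} [NormedAddCommGroup G] [NormedSpace ℝ G]
    [FiniteDimensional ℝ G] (ℓ : ι → G →ₗ[ℝ] ℝ) (hℓ : ∀ g, (∀ i, ℓ i g = 0) → g = 0)
    {f : M → G} {s : Set M} (hf : ∀ i, ContMDiffOn I 𝓘(ℝ, ℝ) ∞ (fun x => ℓ i (f x)) s) :
    ContMDiffOn I 𝓘(ℝ, G) ∞ f s := by
  have hall : ∀ m : Module.Dual ℝ G, ContMDiffOn I 𝓘(ℝ, ℝ) ∞ (fun x => m (f x)) s := by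
    intro m
    have hm : m ∈ Submodule.span ℝ (range ℓ) := span_of_separating ℓ hℓ ▸ Submodule.mem_top
    induction hm using Submodule.span_induction with
    | mem m hm => obtain ⟨i, rfl⟩ := hm; exact hf i
    | zero => exact contMDiffOn_const
    | add m m' _ _ h h' => exact h.add h'
    | smul c m _ h => exact contMDiffOn_const.mul h
  let b := Module.finBasis ℝ G
  have hcoord : ContMDiffOn I 𝓘(ℝ, Fin (Module.finrank ℝ G) → ℝ) ∞
      (fun x => b.equivFunL (f x)) s :=
    contMDiffOn_pi_space.2 fun i => hall (b.coord i)
  refine (b.equivFunL.symm.contDiff.contMDiff.comp_contMDiffOn hcoord).congr fun x _ => ?_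
  simp

variable [AffineBundle F A]

variable (e e' : Trivialization F (π F A)) [MemTrivializationAtlas e] [MemTrivializationAtlas e']

/-- The affine isomorphism `A_x ≃ F` given by a local trivialization. -/
def trivEquiv (x : M) (hx : x ∈ e.baseSet) : A x ≃ᵃ[ℝ] F :=
  (AffineBundle.exists_affineEquiv e x hx).choose

theorem trivEquiv_apply (x : M) (hx : x ∈ e.baseSet) (y : A x) :
    trivEquiv e x hx y = (e ⟨x, y⟩).2 :=
  ((AffineBundle.exists_affineEquiv e x hx).choose_spec y).symm

theorem mk_trivEquiv_symm (x : M) (hx : x ∈ e.baseSet) (v : F) :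
    (⟨x, (trivEquiv e x hx).symm v⟩ : TotalSpace F A)
      = e.toOpenPartialHomeomorph.symm (x, v) := by
  have h1 : (⟨x, (trivEquiv e x hx).symm v⟩ : TotalSpace F A) ∈ e.source := e.mem_source.2 hx
  have h2 : e ⟨x, (trivEquiv e x hx).symm v⟩ = (x, v) := by
    refine Prod.ext (e.coe_fst h1) ?_
    rw [← trivEquiv_apply e x hx, AffineEquiv.apply_symm_apply]
  rw [← h2]
  exact (e.toOpenPartialHomeomorph.left_inv h1).symm

open Classical in
/-- The local trivialization `A⁺|_U ≃ U × Aff(F, ℝ)`, `a ↦ a ∘ φ_x⁻¹`, induced by a local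
trivialization `φ` of the affine bundle `A`. -/
def pretrivialization : Pretrivialization (F →ᴬ[ℝ] ℝ) (π (F →ᴬ[ℝ] ℝ) (AffDual A)) where
  toFun p := ⟨p.1, if hx : p.1 ∈ e.baseSet then fiberEquiv (trivEquiv e p.1 hx) p.2 else 0⟩
  invFun p := ⟨p.1, if hx : p.1 ∈ e.baseSet then
    (fiberEquiv (trivEquiv e p.1 hx)).symm p.2 else 0⟩
  source := Bundle.TotalSpace.proj ⁻¹' e.baseSet
  target := e.baseSet ×ˢ Set.univ
  map_source' := fun ⟨_, _⟩ h => ⟨h, Set.mem_univ _⟩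
  map_target' := fun ⟨_, _⟩ h => h.1
  left_inv' := fun ⟨x, a⟩ h => by
    have hx : x ∈ e.baseSet := h
    simp [hx]
  right_inv' := fun ⟨x, g⟩ h => by
    have hx : x ∈ e.baseSet := h.1
    simp [hx]
  open_target := e.open_baseSet.prod isOpen_univ
  baseSet := e.baseSet
  open_baseSet := e.open_baseSet
  source_eq := rfl
  target_eq := rfl
  proj_toFun _ _ := rfl

theorem pretrivialization_apply {x : M} (hx : x ∈ e.baseSet) (a : AffDual A x) :
    pretrivialization e ⟨x, a⟩ = (x, fiberEquiv (trivEquiv e x hx) a) := by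
  change (x, _) = _
  simp [hx]

open Classical in
theorem pretrivialization_symm_apply {x : M} (hx : x ∈ e.baseSet) (g : F →ᴬ[ℝ] ℝ) :
    (pretrivialization e).symm x g = (fiberEquiv (trivEquiv e x hx)).symm g := by
  rw [Pretrivialization.symm_apply _ (show x ∈ (pretrivialization e).baseSet from hx)]
  change (if h : x ∈ e.baseSet then (fiberEquiv (trivEquiv e x h)).symm g else 0) = _
  rw [dif_pos hx]

instance pretrivialization_isLinear : (pretrivialization e).IsLinear ℝ where
  linear x hx :=
    { map_add := fun a b => by
        change (pretrivialization e ⟨x, a + b⟩).2 =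
          (pretrivialization e ⟨x, a⟩).2 + (pretrivialization e ⟨x, b⟩).2
        simp only [pretrivialization_apply e hx, map_add]
      map_smul := fun c a => by
        change (pretrivialization e ⟨x, c • a⟩).2 = c • (pretrivialization e ⟨x, a⟩).2
        simp only [pretrivialization_apply e hx, map_smul] }

open Classical in
/-- Coordinate changes of `A⁺`: precomposition with the inverse of those of `A`. -/
def coordChange (x : M) : (F →ᴬ[ℝ] ℝ) →L[ℝ] (F →ᴬ[ℝ] ℝ) :=
  if hx : x ∈ e.baseSet ∩ e'.baseSet then
    LinearMap.toContinuousLinearMap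
      (((fiberEquiv (trivEquiv e x hx.1)).symm.trans
        (fiberEquiv (trivEquiv e' x hx.2))).toLinearMap)
  else 0

theorem coordChange_of_mem {x : M} (hx : x ∈ e.baseSet ∩ e'.baseSet) (g : F →ᴬ[ℝ] ℝ) :
    coordChange e e' x g = (pretrivialization e' ⟨x, (pretrivialization e).symm x g⟩).2 := by
  rw [pretrivialization_symm_apply e hx.1, pretrivialization_apply e' hx.2, coordChange,
    dif_pos hx]
  rfl

theorem coordChange_apply {x : M} (hx : x ∈ e.baseSet ∩ e'.baseSet) (g : F →ᴬ[ℝ] ℝ) (v : F) :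
    coordChange e e' x g v = g (e (e'.toOpenPartialHomeomorph.symm (x, v))).2 := by
  rw [coordChange, dif_pos hx, ← mk_trivEquiv_symm e' x hx.2, ← trivEquiv_apply e x hx.1]
  rfl

theorem continuousOn_coordChange :
    ContinuousOn (coordChange e e') (e.baseSet ∩ e'.baseSet) := by
  refine continuousOn_of_separating
    (G := (F →ᴬ[ℝ] ℝ) →L[ℝ] (F →ᴬ[ℝ] ℝ)) (ι := (F →ᴬ[ℝ] ℝ) × F)
    (fun i => (evalLinear i.2).comp
      ((ContinuousLinearMap.apply ℝ (F →ᴬ[ℝ] ℝ) i.1).toLinearMap)) ?_ ?_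
  · intro T hT
    ext g v
    exact hT (g, v)
  · rintro ⟨g, v⟩
    have h1 : ContinuousOn (fun x : M => e'.toOpenPartialHomeomorph.symm (x, v))
        (e.baseSet ∩ e'.baseSet) :=
      e'.toOpenPartialHomeomorph.continuousOn_symm.comp
        (continuous_id.prodMk continuous_const).continuousOn
        (fun x hx => e'.mem_target.2 hx.2)
    have h2 : ContinuousOn (fun x : M => e (e'.toOpenPartialHomeomorph.symm (x, v)))
        (e.baseSet ∩ e'.baseSet) := by
      refine e.continuousOn.comp h1 fun x hx => ?_
      rw [e.mem_source, e'.proj_symm_apply (e'.mem_target.2 hx.2)]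
      exact hx.1
    refine (g.continuous.comp_continuousOn (continuous_snd.comp_continuousOn h2)).congr
      fun x hx => ?_
    exact coordChange_apply e e' hx g v

theorem contMDiffOn_coordChange [SmoothFiberBundle I F A] :
    ContMDiffOn I 𝓘(ℝ, (F →ᴬ[ℝ] ℝ) →L[ℝ] (F →ᴬ[ℝ] ℝ)) ∞ (coordChange e e')
      (e.baseSet ∩ e'.baseSet) := by
  refine contMDiffOn_of_separating I
    (G := (F →ᴬ[ℝ] ℝ) →L[ℝ] (F →ᴬ[ℝ] ℝ)) (ι := (F →ᴬ[ℝ] ℝ) × F)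
    (fun i => (evalLinear i.2).comp
      ((ContinuousLinearMap.apply ℝ (F →ᴬ[ℝ] ℝ) i.1).toLinearMap)) ?_ ?_
  · intro T hT
    ext g v
    exact hT (g, v)
  · rintro ⟨g, v⟩
    have h1 := SmoothFiberBundle.contMDiffOn_symm_trans (I := I) e' e
    have h2 : ContMDiffOn I (I.prod 𝓘(ℝ, F)) ∞ (fun x : M => (x, v))
        (e.baseSet ∩ e'.baseSet) := contMDiffOn_id.prodMk contMDiffOn_const
    have h3 := h1.comp h2 (fun x hx => ⟨e'.mem_target.2 hx.2, e.mem_target.2 hx.1⟩)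
    have h4 : ContMDiffOn I 𝓘(ℝ, F) ∞
        (fun x => (e (e'.toOpenPartialHomeomorph.symm (x, v))).2) (e.baseSet ∩ e'.baseSet) :=
      contMDiff_snd.comp_contMDiffOn h3
    refine (g.contDiff.contMDiff.comp_contMDiffOn h4).congr fun x hx => ?_
    exact coordChange_apply e e' hx g v

variable (F A)

/-- The vector bundle structure of the vector dual `A⁺`, with the local trivializations induced
by those of `A`. -/
def vectorPrebundle : VectorPrebundle ℝ (F →ᴬ[ℝ] ℝ) (AffDual A) where
  pretrivializationAtlas := {f | ∃ (e : Trivialization F (π F A)) (_ : MemTrivializationAtlas e),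
    f = pretrivialization e}
  pretrivialization_linear' := by
    rintro _ ⟨e, he, rfl⟩
    infer_instance
  pretrivializationAt x := pretrivialization (trivializationAt F A x)
  mem_base_pretrivializationAt x := mem_baseSet_trivializationAt F A x
  pretrivialization_mem_atlas x := ⟨trivializationAt F A x, inferInstance, rfl⟩
  exists_coordChange := by
    rintro _ ⟨e, he, rfl⟩ _ ⟨e', he', rfl⟩
    refine ⟨coordChange e e', continuousOn_coordChange e e', ?_⟩
    intro x hx g
    exact coordChange_of_mem e e' hx g
  totalSpaceMk_isInducing x := by
    have hx := mem_baseSet_trivializationAt F A x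
    have h : Topology.IsInducing fun a : AffDual A x =>
        (x, fiberEquiv (trivEquiv (trivializationAt F A x) x hx) a) :=
      Topology.isInducing_const_prod.mpr (isInducing_fiberEquiv _)
    convert! h using 2 with a
    exact pretrivialization_apply _ hx a

instance topologicalSpace_totalSpace : TopologicalSpace (TotalSpace (F →ᴬ[ℝ] ℝ) (AffDual A)) :=
  (vectorPrebundle F A).totalSpaceTopology

instance fiberBundle : FiberBundle (F →ᴬ[ℝ] ℝ) (AffDual A) :=
  (vectorPrebundle F A).toFiberBundle

instance vectorBundle : VectorBundle ℝ (F →ᴬ[ℝ] ℝ) (AffDual A) :=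
  (vectorPrebundle F A).toVectorBundle

instance isContMDiff_vectorPrebundle [SmoothFiberBundle I F A] :
    (vectorPrebundle F A).IsContMDiff I ∞ where
  exists_contMDiffCoordChange := by
    rintro _ ⟨e, he, rfl⟩ _ ⟨e', he', rfl⟩
    exact ⟨coordChange e e', contMDiffOn_coordChange I e e',
      fun x hx g => coordChange_of_mem e e' hx g⟩

/-- The vector dual `A⁺` of a smooth affine bundle is a smooth vector bundle. -/
instance contMDiffVectorBundle [SmoothFiberBundle I F A] :
    ContMDiffVectorBundle ∞ (F →ᴬ[ℝ] ℝ) (AffDual A) I :=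
  (vectorPrebundle F A).contMDiffVectorBundle I

variable {A} in
theorem trivializationAt_apply (x₀ : M) {x : M} (hx : x ∈ (trivializationAt F A x₀).baseSet)
    (a : AffDual A x) :
    trivializationAt (F →ᴬ[ℝ] ℝ) (AffDual A) x₀ ⟨x, a⟩
      = (x, fiberEquiv (trivEquiv (trivializationAt F A x₀) x hx) a) :=
  pretrivialization_apply (trivializationAt F A x₀) hx a

/-- The distinguished section `1̃` of `A⁺`, whose value at `x` is the constant function `1` on
`A_x`. -/
def oneSection : Cₛ^∞⟮I; F →ᴬ[ℝ] ℝ, AffDual A⟯ where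
  toFun x := one A x
  contMDiff_toFun := by
    intro x₀
    rw [contMDiffAt_section]
    refine (contMDiffAt_const (c := ContinuousAffineMap.const ℝ F (1 : ℝ))).congr_of_eventuallyEq ?_
    filter_upwards [(trivializationAt F A x₀).open_baseSet.mem_nhds
      (mem_baseSet_trivializationAt F A x₀)] with x hx
    rw [trivializationAt_apply F x₀ hx]
    rfl

variable {I F A} in
/-- The affine function `a : A → ℝ` associated with a section `ã` of `A⁺`. -/
def toFunction (s : Cₛ^∞⟮I; F →ᴬ[ℝ] ℝ, AffDual A⟯) : TotalSpace F A → ℝ :=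
  fun p => (s p.proj).toAffineMap p.snd

end AffDual

end AffineBundle

end

noncomputable section

set_option linter.unusedSectionVars false

/-! ## Coordinate frames on a manifold -/

section CoordFrame

variable {G : Type*} [NormedAddCommGroup G] [NormedSpace ℝ G]
  {H : Type*} [TopologicalSpace H] {I : ModelWithCorners ℝ G H}
  {N : Type*} [TopologicalSpace N] [ChartedSpace H N]

theorem Filter.EventuallyEq.mvfderiv_eq {f g : N → ℝ} {p : N} (h : f =ᶠ[𝓝 p] g) :
    mvfderiv I f p = mvfderiv I g p := by
  ext v
  have := h.mfderiv_eq (I := I) (I' := 𝓘(ℝ, ℝ))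
  exact congrArg (fun L : G →L[ℝ] ℝ => L v) this

variable (I) in
/-- Globally defined smooth functions which coincide near `p₀` with the coordinates, relative to
the basis `b` of the model space, of the preferred chart at `p₀`. -/
structure IsCoordFrame {ι : Type*} (b : Module.Basis ι ℝ G) (h : ι → N → ℝ) (p₀ : N) : Prop where
  contMDiff : ∀ i, ContMDiff I 𝓘(ℝ, ℝ) ∞ (h i)
  eventuallyEq : ∀ i, h i =ᶠ[𝓝 p₀] fun p => b.coord i (extChartAt I p₀ p)

variable (I) in
/-- A basis of the model space, as a basis of a tangent space. -/
def tangentBasis {ι : Type*} (b : Module.Basis ι ℝ G) (p : N) :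
    Module.Basis ι ℝ (TangentSpace I p) :=
  b

variable (I) in
/-- The partial derivative of a function in the direction `w` in the preferred chart at `p₀`. -/
def chartPartial (p₀ : N) (f : N → ℝ) (w : G) (p : N) : ℝ :=
  fderiv ℝ (f ∘ (extChartAt I p₀).symm) (extChartAt I p₀ p) w

variable [I.Boundaryless] [IsManifold I ∞ N]

theorem ContMDiff.contDiffOn_comp_extChartAt_symm {f : N → ℝ} (hf : ContMDiff I 𝓘(ℝ, ℝ) ∞ f)
    (p₀ : N) : ContDiffOn ℝ ∞ (f ∘ (extChartAt I p₀).symm) (extChartAt I p₀).target :=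
  contMDiffOn_iff_contDiffOn.1 (hf.comp_contMDiffOn (contMDiffOn_extChartAt_symm p₀))

theorem ContMDiff.contDiffAt_comp_extChartAt_symm {f : N → ℝ} (hf : ContMDiff I 𝓘(ℝ, ℝ) ∞ f)
    {p₀ p : N} (hp : p ∈ (extChartAt I p₀).source) :
    ContDiffAt ℝ ∞ (f ∘ (extChartAt I p₀).symm) (extChartAt I p₀ p) :=
  (hf.contDiffOn_comp_extChartAt_symm p₀).contDiffAt
    ((isOpen_extChartAt_target p₀).mem_nhds ((extChartAt I p₀).map_source hp))

theorem mvfderiv_eq_fderiv_comp_mfderiv {f : N → ℝ} (hf : ContMDiff I 𝓘(ℝ, ℝ) ∞ f)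
    {p₀ p : N} (hp : p ∈ (extChartAt I p₀).source) (v : TangentSpace I p) :
    mvfderiv I f p v = fderiv ℝ (f ∘ (extChartAt I p₀).symm) (extChartAt I p₀ p)
      (mfderiv I 𝓘(ℝ, G) (extChartAt I p₀) p v) := by
  have h1 : f =ᶠ[𝓝 p] (f ∘ (extChartAt I p₀).symm) ∘ extChartAt I p₀ := by
    filter_upwards [(isOpen_extChartAt_source p₀).mem_nhds hp] with q hq
    exact congrArg f ((extChartAt I p₀).left_inv hq).symm
  have h2 : MDifferentiableAt 𝓘(ℝ, G) 𝓘(ℝ, ℝ) (f ∘ (extChartAt I p₀).symm)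
      (extChartAt I p₀ p) :=
    ((hf.contDiffAt_comp_extChartAt_symm hp).differentiableAt (by simp)).mdifferentiableAt
  have h3 : MDifferentiableAt I 𝓘(ℝ, G) (extChartAt I p₀) p :=
    mdifferentiableAt_extChartAt (by rwa [extChartAt_source] at hp)
  rw [h1.mvfderiv_eq, mvfderiv_comp_apply p h2 h3]
  change mfderiv 𝓘(ℝ, G) 𝓘(ℝ, ℝ) (f ∘ (extChartAt I p₀).symm) (extChartAt I p₀ p) _ = _
  rw [mfderiv_eq_fderiv]
  rfl

theorem contMDiffAt_chartPartial {f : N → ℝ} (hf : ContMDiff I 𝓘(ℝ, ℝ) ∞ f)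
    {p₀ p : N} (hp : p ∈ (extChartAt I p₀).source) (w : G) :
    ContMDiffAt I 𝓘(ℝ, ℝ) ∞ (chartPartial I p₀ f w) p := by
  have h1 : ContDiffAt ℝ ∞ (fun y => fderiv ℝ (f ∘ (extChartAt I p₀).symm) y w)
      (extChartAt I p₀ p) :=
    ((hf.contDiffAt_comp_extChartAt_symm hp).fderiv_right (m := ∞) (by simp)).clm_apply
      contDiffAt_const
  exact h1.contMDiffAt.comp p (contMDiffAt_extChartAt' (by rwa [extChartAt_source] at hp))

theorem mvfderiv_chartPartial_self {f : N → ℝ} (hf : ContMDiff I 𝓘(ℝ, ℝ) ∞ f) (p₀ : N)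
    (w : G) (v : TangentSpace I p₀) :
    mvfderiv I (chartPartial I p₀ f w) p₀ v
      = fderiv ℝ (fderiv ℝ (f ∘ (extChartAt I p₀).symm)) (extChartAt I p₀ p₀) v w := by
  have hp := mem_extChartAt_source (I := I) p₀
  have h0 := (hf.contDiffAt_comp_extChartAt_symm hp).fderiv_right (m := ∞) (by simp)
  have h1 : MDifferentiableAt 𝓘(ℝ, G) 𝓘(ℝ, ℝ)
      (fun y => fderiv ℝ (f ∘ (extChartAt I p₀).symm) y w) (extChartAt I p₀ p₀) :=
    ((h0.clm_apply contDiffAt_const).differentiableAt (by simp)).mdifferentiableAt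
  have h3 : MDifferentiableAt I 𝓘(ℝ, G) (extChartAt I p₀) p₀ :=
    mdifferentiableAt_extChartAt (by rwa [extChartAt_source] at hp)
  have h4 := mvfderiv_comp_apply p₀ h1 h3 v
  rw [mfderiv_extChartAt_self] at h4
  refine h4.trans ?_
  change mfderiv 𝓘(ℝ, G) 𝓘(ℝ, ℝ) (fun y => fderiv ℝ (f ∘ (extChartAt I p₀).symm) y w)
    (extChartAt I p₀ p₀) v = _
  rw [mfderiv_eq_fderiv, fderiv_clm_apply (h0.differentiableAt (by simp))
    (differentiableAt_const w)]
  simp only [fderiv_fun_const, Pi.zero_apply, ContinuousLinearMap.comp_zero, zero_add]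
  rfl

theorem chartPartial_symm {f : N → ℝ} (hf : ContMDiff I 𝓘(ℝ, ℝ) ∞ f) (p₀ : N) (v w : G) :
    fderiv ℝ (fderiv ℝ (f ∘ (extChartAt I p₀).symm)) (extChartAt I p₀ p₀) v w
      = fderiv ℝ (fderiv ℝ (f ∘ (extChartAt I p₀).symm)) (extChartAt I p₀ p₀) w v :=
  (hf.contDiffAt_comp_extChartAt_symm (mem_extChartAt_source p₀)).isSymmSndFDerivAt
    (by simpa using ENat.LEInfty.out) v w

namespace IsCoordFrame

variable {ι : Type*} [Fintype ι] {b : Module.Basis ι ℝ G} {h : ι → N → ℝ} {p₀ : N}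

theorem eventually_mvfderiv_eq [FiniteDimensional ℝ G] (hh : IsCoordFrame I b h p₀) :
    ∀ᶠ p in 𝓝 p₀, ∀ i, ∀ v : TangentSpace I p,
      mvfderiv I (h i) p v = b.coord i (mfderiv I 𝓘(ℝ, G) (extChartAt I p₀) p v) := by
  refine Filter.eventually_all.2 fun i => ?_
  filter_upwards [(hh.eventuallyEq i).eventually_nhds, extChartAt_source_mem_nhds (I := I) p₀]
    with p hp hps v
  let ℓ : G →L[ℝ] ℝ := (b.coord i).toContinuousLinearMap
  have hp' : h i =ᶠ[𝓝 p] ℓ ∘ extChartAt I p₀ := hp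
  rw [hp'.mvfderiv_eq, mvfderiv_comp_apply p ℓ.differentiableAt.mdifferentiableAt
    (mdifferentiableAt_extChartAt (by rwa [extChartAt_source] at hps))]
  change mfderiv 𝓘(ℝ, G) 𝓘(ℝ, ℝ) ℓ (extChartAt I p₀ p) _ = _
  rw [mfderiv_eq_fderiv, ℓ.fderiv]
  rfl

theorem mvfderiv_self [FiniteDimensional ℝ G] (hh : IsCoordFrame I b h p₀) (i : ι)
    (v : TangentSpace I p₀) : mvfderiv I (h i) p₀ v = (tangentBasis I b p₀).coord i v := by
  rw [hh.eventually_mvfderiv_eq.self_of_nhds i v, mfderiv_extChartAt_self]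
  rfl

theorem eq_sum_dual [FiniteDimensional ℝ G] (hh : IsCoordFrame I b h p₀)
    (α : Module.Dual ℝ (TangentSpace I p₀)) :
    α = ∑ i, α (tangentBasis I b p₀ i) •
      (mvfderiv I (h i) p₀ : Module.Dual ℝ (TangentSpace I p₀)) := by
  classical
  have hc : ∀ i, (mvfderiv I (h i) p₀ : Module.Dual ℝ (TangentSpace I p₀))
      = (tangentBasis I b p₀).coord i := fun i => LinearMap.ext fun v => hh.mvfderiv_self i v
  refine (tangentBasis I b p₀).ext fun j => ?_
  simp [hc]

theorem eventually_mvfderiv_eq_sum [FiniteDimensional ℝ G] (hh : IsCoordFrame I b h p₀) :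
    ∀ᶠ p in 𝓝 p₀, ∀ f : N → ℝ, ContMDiff I 𝓘(ℝ, ℝ) ∞ f →
      mvfderiv I f p = ∑ i, chartPartial I p₀ f (b i) p • mvfderiv I (h i) p := by
  filter_upwards [hh.eventually_mvfderiv_eq, extChartAt_source_mem_nhds (I := I) p₀]
    with p hp hps f hf
  ext v
  rw [mvfderiv_eq_fderiv_comp_mfderiv hf hps v]
  refine Eq.trans ?_ (sum_apply _ _ _).symm
  refine Eq.trans ?_ (Finset.sum_congr rfl fun i _ =>
    (congrArg (fun t => chartPartial I p₀ f (b i) p * t) (hp i v)).symm)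
  set w : G := mfderiv I 𝓘(ℝ, G) (extChartAt I p₀) p v
  conv_lhs => rw [← b.sum_repr w]
  simp only [map_sum, map_smul, smul_eq_mul, Module.Basis.coord_apply, chartPartial]
  exact Finset.sum_congr rfl fun i _ => mul_comm _ _

/-- The differential of a smooth function in terms of a coordinate frame, with the symmetry of the
second derivatives. -/
theorem exists_coeff [FiniteDimensional ℝ G] (hh : IsCoordFrame I b h p₀) {f : N → ℝ}
    (hf : ContMDiff I 𝓘(ℝ, ℝ) ∞ f) :
    ∃ c : ι → N → ℝ, (∀ i, ContMDiffAt I 𝓘(ℝ, ℝ) ∞ (c i) p₀) ∧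
      (∀ᶠ p in 𝓝 p₀, mvfderiv I f p = ∑ i, c i p • mvfderiv I (h i) p) ∧
      ∃ S : ι → ι → ℝ, (∀ i j, S i j = S j i) ∧
        ∀ i, mvfderiv I (c i) p₀ = ∑ j, S i j • mvfderiv I (h j) p₀ := by
  refine ⟨fun i => chartPartial I p₀ f (b i),
    fun i => contMDiffAt_chartPartial hf (mem_extChartAt_source p₀) _,
    hh.eventually_mvfderiv_eq_sum.mono fun p hp => hp f hf,
    fun i j => fderiv ℝ (fderiv ℝ (f ∘ (extChartAt I p₀).symm)) (extChartAt I p₀ p₀) (b i) (b j),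
    fun i j => chartPartial_symm hf p₀ _ _, fun i => ?_⟩
  ext v
  rw [mvfderiv_chartPartial_self hf]
  refine Eq.trans ?_ (sum_apply _ _ _).symm
  refine Eq.trans ?_ (Finset.sum_congr rfl fun j _ =>
    (congrArg (fun t => fderiv ℝ (fderiv ℝ (f ∘ (extChartAt I p₀).symm)) (extChartAt I p₀ p₀)
      (b i) (b j) * t) (hh.mvfderiv_self j v)).symm)
  refine (chartPartial_symm hf p₀ v (b i)).trans ?_
  let w : G := v
  have : ∀ T : G →L[ℝ] ℝ, T w = ∑ j, T (b j) * b.coord j w := fun T => by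
    conv_lhs => rw [← b.sum_repr w]
    simp only [map_sum, map_smul, smul_eq_mul, Module.Basis.coord_apply]
    exact Finset.sum_congr rfl fun i _ => mul_comm _ _
  exact this _

/-- Tangent vectors are separated by the functions of a coordinate frame. -/
theorem eq_of_mvfderiv_eq [FiniteDimensional ℝ G] (hh : IsCoordFrame I b h p₀)
    {v w : TangentSpace I p₀} (hvw : ∀ i, mvfderiv I (h i) p₀ v = mvfderiv I (h i) p₀ w) :
    v = w := by
  refine (tangentBasis I b p₀).ext_elem fun i => ?_
  have := hvw i
  rwa [hh.mvfderiv_self, hh.mvfderiv_self] at this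

/-- A vector field is smooth if its action on the functions of coordinate frames is. -/
theorem contMDiffAt_section [FiniteDimensional ℝ G] (hh : IsCoordFrame I b h p₀)
    {X : ∀ p : N, TangentSpace I p}
    (hX : ∀ i, ContMDiffAt I 𝓘(ℝ, ℝ) ∞ (fun p => mvfderiv I (h i) p (X p)) p₀) :
    ContMDiffAt I (I.prod 𝓘(ℝ, G)) ∞ (fun p => TotalSpace.mk' G p (X p)) p₀ := by
  rw [Bundle.contMDiffAt_section]
  have key : ContMDiffAt I 𝓘(ℝ, G) ∞
      (fun p => ∑ i, (mvfderiv I (h i) p (X p)) • b i) p₀ := by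
    refine ContMDiffAt.sum fun i _ => (hX i).smul contMDiffAt_const
  refine key.congr_of_eventuallyEq ?_
  filter_upwards [hh.eventually_mvfderiv_eq, extChartAt_source_mem_nhds (I := I) p₀]
    with p hp hps
  have hps' : p ∈ (chartAt H p₀).source := by rwa [extChartAt_source] at hps
  have h1 := TangentBundle.continuousLinearMapAt_trivializationAt (I := I) hps'
  have h2 : (trivializationAt G (TangentSpace I) p₀ ⟨p, X p⟩).2
      = mfderiv I 𝓘(ℝ, G) (extChartAt I p₀) p (X p) := by
    rw [← h1]
    refine Eq.trans ?_ (congrFun (Trivialization.continuousLinearMapAt_apply ℝ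
      (trivializationAt G (TangentSpace I) p₀) p) (X p)).symm
    refine (congrFun (Trivialization.coe_linearMapAt_of_mem (R := ℝ)
      (trivializationAt G (TangentSpace I) p₀) ?_) (X p)).symm
    exact hps'
  rw [h2]
  simp only [hp]
  exact (b.sum_repr _).symm

end IsCoordFrame

end CoordFrame

/-! ## Calculus of bivector fields -/

section Bivector

variable {G : Type*} [NormedAddCommGroup G] [NormedSpace ℝ G]
  {H : Type*} [TopologicalSpace H] {I : ModelWithCorners ℝ G H}
  {N : Type*} [TopologicalSpace N] [ChartedSpace H N]

variable (I) in
/-- The differential of a function, as an element of the algebraic dual of the tangent space. -/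
def covector (f : N → ℝ) (p : N) : Module.Dual ℝ (TangentSpace I p) := mvfderiv I f p

theorem covector_apply (f : N → ℝ) (p : N) (v : TangentSpace I p) :
    covector I f p v = mvfderiv I f p v := rfl

theorem Filter.EventuallyEq.covector_eq {f g : N → ℝ} {p : N} (h : f =ᶠ[𝓝 p] g) :
    covector I f p = covector I g p := by
  rw [covector, covector, h.mvfderiv_eq]

theorem covector_const (c : ℝ) (p : N) : covector I (fun _ => c) p = 0 := by
  ext v
  rw [covector_apply, mvfderiv_const]
  rfl

theorem covector_add {f g : N → ℝ} {p : N} (hf : MDifferentiableAt I 𝓘(ℝ, ℝ) f p)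
    (hg : MDifferentiableAt I 𝓘(ℝ, ℝ) g p) :
    covector I (fun q => f q + g q) p = covector I f p + covector I g p := by
  ext v
  have := congrArg (fun L => L v) (mvfderiv_add hf hg)
  exact this

theorem covector_sub {f g : N → ℝ} {p : N} (hf : MDifferentiableAt I 𝓘(ℝ, ℝ) f p)
    (hg : MDifferentiableAt I 𝓘(ℝ, ℝ) g p) :
    covector I (fun q => f q - g q) p = covector I f p - covector I g p := by
  ext v
  have := congrArg (fun L => L v) (mvfderiv_sub hf hg)
  exact this

theorem covector_neg {f : N → ℝ} {p : N} :
    covector I (fun q => - f q) p = - covector I f p := by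
  ext v
  have := congrArg (fun L => L v) (mvfderiv_neg (I := I) (g := f) (x := p))
  exact this

theorem covector_mul {f g : N → ℝ} {p : N} (hf : MDifferentiableAt I 𝓘(ℝ, ℝ) f p)
    (hg : MDifferentiableAt I 𝓘(ℝ, ℝ) g p) :
    covector I (fun q => f q * g q) p = f p • covector I g p + g p • covector I f p := by
  ext v
  have := congrArg (fun L => L v) (mvfderiv_mul hf hg)
  exact this

theorem mdifferentiableAt_fun_sum {ι : Type*} (s : Finset ι) {f : ι → N → ℝ} {p : N}
    (hf : ∀ i, MDifferentiableAt I 𝓘(ℝ, ℝ) (f i) p) :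
    MDifferentiableAt I 𝓘(ℝ, ℝ) (fun q => ∑ i ∈ s, f i q) p := by
  classical
  induction s using Finset.induction_on with
  | empty => simpa using mdifferentiableAt_const
  | insert i s hi ih =>
    simp only [Finset.sum_insert hi]
    exact (hf i).add ih

theorem covector_sum {ι : Type*} (s : Finset ι) {f : ι → N → ℝ} {p : N}
    (hf : ∀ i, MDifferentiableAt I 𝓘(ℝ, ℝ) (f i) p) :
    covector I (fun q => ∑ i ∈ s, f i q) p = ∑ i ∈ s, covector I (f i) p := by
  classical
  induction s using Finset.induction_on with
  | empty => simpa using covector_const 0 p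
  | insert i s hi ih =>
    simp only [Finset.sum_insert hi]
    rw [covector_add (hf i) (mdifferentiableAt_fun_sum s hf), ih]

theorem ContMDiffAt.mdifferentiableAt' {f : N → ℝ} {p : N}
    (hf : ContMDiffAt I 𝓘(ℝ, ℝ) ∞ f p) : MDifferentiableAt I 𝓘(ℝ, ℝ) f p :=
  hf.mdifferentiableAt (by simp)

theorem ContMDiff.mdifferentiableAt' {f : N → ℝ} (hf : ContMDiff I 𝓘(ℝ, ℝ) ∞ f) (p : N) :
    MDifferentiableAt I 𝓘(ℝ, ℝ) f p :=
  (hf p).mdifferentiableAt'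

theorem dirDeriv_eq_covector (X : ∀ p : N, TangentSpace I p) (f : N → ℝ) (p : N) :
    dirDeriv X f p = covector I f p (X p) := rfl

theorem dirDeriv_mul (X : ∀ p : N, TangentSpace I p) {f g : N → ℝ} {p : N}
    (hf : MDifferentiableAt I 𝓘(ℝ, ℝ) f p) (hg : MDifferentiableAt I 𝓘(ℝ, ℝ) g p) :
    dirDeriv X (fun q => f q * g q) p = f p * dirDeriv X g p + g p * dirDeriv X f p := by
  rw [dirDeriv_eq_covector, covector_mul hf hg]
  rfl

theorem dirDeriv_const (X : ∀ p : N, TangentSpace I p) (c : ℝ) (p : N) :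
    dirDeriv X (fun _ => c) p = 0 := by
  rw [dirDeriv_eq_covector, covector_const]
  rfl

variable [FiniteDimensional ℝ G]

namespace BivectorField

variable (Λ : BivectorField I N)

theorem apply_eq (f g : N → ℝ) (p : N) :
    Λ.apply f g p = Λ.toFun p (covector I f p) (covector I g p) := rfl

theorem toFun_swap (p : N) (α β : Module.Dual ℝ (TangentSpace I p)) :
    Λ.toFun p α β = - Λ.toFun p β α := by
  have h := Λ.alternating p (α + β)
  rw [map_add, map_add, LinearMap.add_apply, LinearMap.add_apply, Λ.alternating,
    Λ.alternating] at h
  linarith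

theorem apply_swap (f g : N → ℝ) (p : N) : Λ.apply f g p = - Λ.apply g f p :=
  Λ.toFun_swap p _ _

theorem apply_const_right (f : N → ℝ) (c : ℝ) (p : N) : Λ.apply f (fun _ => c) p = 0 := by
  rw [apply_eq, covector_const, map_zero]

/-- The bracket `Λ(df, dg) + f X(g) - g X(f)`. -/
def jacobiBracket (X : ∀ p : N, TangentSpace I p) (f g : N → ℝ) : N → ℝ :=
  fun p => Λ.apply f g p + f p * dirDeriv X g p - g p * dirDeriv X f p

theorem covector_jacobiBracket {X : ∀ p : N, TangentSpace I p} {f g : N → ℝ} {p : N}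
    (hf : ContMDiff I 𝓘(ℝ, ℝ) ∞ f) (hg : ContMDiff I 𝓘(ℝ, ℝ) ∞ g)
    (hXf : MDifferentiableAt I 𝓘(ℝ, ℝ) (dirDeriv X f) p)
    (hXg : MDifferentiableAt I 𝓘(ℝ, ℝ) (dirDeriv X g) p) :
    covector I (Λ.jacobiBracket X f g) p = covector I (Λ.apply f g) p
      + (f p • covector I (dirDeriv X g) p + dirDeriv X g p • covector I f p)
      - (g p • covector I (dirDeriv X f) p + dirDeriv X f p • covector I g p) := by
  have hΛ : MDifferentiableAt I 𝓘(ℝ, ℝ) (Λ.apply f g) p :=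
    (Λ.smooth f g hf hg).mdifferentiableAt' p
  have hf' := hf.mdifferentiableAt' p
  have hg' := hg.mdifferentiableAt' p
  have h1 : MDifferentiableAt I 𝓘(ℝ, ℝ) (fun q => f q * dirDeriv X g q) p := hf'.mul hXg
  have h2 : MDifferentiableAt I 𝓘(ℝ, ℝ) (fun q => g q * dirDeriv X f q) p := hg'.mul hXf
  have h3 : MDifferentiableAt I 𝓘(ℝ, ℝ) (fun q => Λ.apply f g q + f q * dirDeriv X g q) p :=
    hΛ.add h1
  rw [show Λ.jacobiBracket X f g = fun q => (Λ.apply f g q + f q * dirDeriv X g q)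
    - g q * dirDeriv X f q from rfl, covector_sub h3 h2, covector_add hΛ h1,
    covector_mul hf' hXg, covector_mul hg' hXf]

/-- The Jacobiator of the bracket `Λ(df, dg) + f X(g) - g X(f)` in terms of Schouten brackets. -/
theorem jacobiator_eq {X : ∀ p : N, TangentSpace I p} {f g h : N → ℝ} {p : N}
    (hf : ContMDiff I 𝓘(ℝ, ℝ) ∞ f) (hg : ContMDiff I 𝓘(ℝ, ℝ) ∞ g)
    (hh : ContMDiff I 𝓘(ℝ, ℝ) ∞ h)
    (hXf : MDifferentiableAt I 𝓘(ℝ, ℝ) (dirDeriv X f) p)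
    (hXg : MDifferentiableAt I 𝓘(ℝ, ℝ) (dirDeriv X g) p)
    (hXh : MDifferentiableAt I 𝓘(ℝ, ℝ) (dirDeriv X h) p) :
    Λ.jacobiBracket X f (Λ.jacobiBracket X g h) p + Λ.jacobiBracket X g (Λ.jacobiBracket X h f) p
      + Λ.jacobiBracket X h (Λ.jacobiBracket X f g) p
    = (Λ.schoutenSelf f g h p + 2 * wedgeVector X Λ f g h p) / 2
      + f p * schoutenVector X Λ g h p + g p * schoutenVector X Λ h f p
      + h p * schoutenVector X Λ f g p := by
  have key : ∀ {a b c : N → ℝ}, ContMDiff I 𝓘(ℝ, ℝ) ∞ a → ContMDiff I 𝓘(ℝ, ℝ) ∞ b →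
      ContMDiff I 𝓘(ℝ, ℝ) ∞ c → MDifferentiableAt I 𝓘(ℝ, ℝ) (dirDeriv X b) p →
      MDifferentiableAt I 𝓘(ℝ, ℝ) (dirDeriv X c) p →
      Λ.jacobiBracket X a (Λ.jacobiBracket X b c) p =
        - Λ.apply (Λ.apply b c) a p + b p * Λ.apply a (dirDeriv X c) p
        + dirDeriv X c p * Λ.apply a b p - c p * Λ.apply a (dirDeriv X b) p
        - dirDeriv X b p * Λ.apply a c p
        + a p * (dirDeriv X (Λ.apply b c) p + b p * dirDeriv X (dirDeriv X c) p
          - c p * dirDeriv X (dirDeriv X b) p)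
        - Λ.jacobiBracket X b c p * dirDeriv X a p := by
    intro a b c ha hb hc hXb hXc
    rw [← Λ.apply_swap a (Λ.apply b c)]
    have e := Λ.covector_jacobiBracket hb hc hXb hXc
    conv_lhs => rw [jacobiBracket]
    rw [apply_eq, dirDeriv_eq_covector X (Λ.jacobiBracket X b c), e]
    simp only [map_add, map_sub, map_smul, LinearMap.add_apply, LinearMap.sub_apply,
      LinearMap.smul_apply, smul_eq_mul, ← apply_eq, ← dirDeriv_eq_covector]
    ring
  rw [key hf hg hh hXg hXh, key hg hh hf hXh hXf, key hh hf hg hXf hXg]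
  simp only [jacobiBracket, schoutenSelf, wedgeVector, schoutenVector]
  rw [Λ.apply_swap (dirDeriv X g) h, Λ.apply_swap (dirDeriv X h) f, Λ.apply_swap (dirDeriv X f) g,
    Λ.apply_swap f h, Λ.apply_swap g f, Λ.apply_swap h g]
  ring

theorem schoutenSelf_rotate (f g h : N → ℝ) (p : N) :
    Λ.schoutenSelf f g h p = Λ.schoutenSelf g h f p := by
  simp only [schoutenSelf]; ring

theorem wedgeVector_rotate (X : ∀ p : N, TangentSpace I p) (f g h : N → ℝ) (p : N) :
    wedgeVector X Λ f g h p = wedgeVector X Λ g h f p := by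
  simp only [wedgeVector]; ring

theorem schoutenVector_swap (X : ∀ p : N, TangentSpace I p) (f g : N → ℝ) (p : N) :
    schoutenVector X Λ f g p = - schoutenVector X Λ g f p := by
  have h : Λ.apply f g = fun q => - Λ.apply g f q := funext fun q => Λ.apply_swap f g q
  simp only [schoutenVector]
  rw [Λ.apply_swap (dirDeriv X f) g, Λ.apply_swap f (dirDeriv X g), h,
    dirDeriv_eq_covector, covector_neg, LinearMap.neg_apply, ← dirDeriv_eq_covector]
  ring

section Tensorial

variable [I.Boundaryless] [IsManifold I ∞ N]
  {ι : Type*} [Fintype ι] {b : Module.Basis ι ℝ G} {u : ι → N → ℝ} {p₀ : N}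

theorem sum_symm_mul_sub_eq_zero (S : ι → ι → ℝ) (hS : ∀ i j, S i j = S j i) (x y : ι → ℝ) :
    ∑ i, (x i * ∑ j, S i j * y j - y i * ∑ j, S i j * x j) = 0 := by
  rw [Finset.sum_sub_distrib, sub_eq_zero]
  simp only [Finset.mul_sum]
  rw [Finset.sum_comm]
  refine Finset.sum_congr rfl fun i _ => Finset.sum_congr rfl fun j _ => ?_
  rw [hS]; ring

theorem _root_.covector_sum_mul {c w : ι → N → ℝ} {f : N → ℝ} {p : N}
    (h : f =ᶠ[𝓝 p] fun q => ∑ i, c i q * w i q)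
    (hc : ∀ i, MDifferentiableAt I 𝓘(ℝ, ℝ) (c i) p)
    (hw : ∀ i, MDifferentiableAt I 𝓘(ℝ, ℝ) (w i) p) :
    covector I f p = ∑ i, (c i p • covector I (w i) p + w i p • covector I (c i) p) := by
  rw [h.covector_eq, covector_sum (f := fun i q => c i q * w i q) _ fun i => (hc i).mul (hw i)]
  exact Finset.sum_congr rfl fun i _ => covector_mul (hc i) (hw i)

theorem _root_.IsCoordFrame.exists_covector_coeff (hu : IsCoordFrame I b u p₀) {f : N → ℝ}
    (hf : ContMDiff I 𝓘(ℝ, ℝ) ∞ f) :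
    ∃ c : ι → N → ℝ, (∀ i, ContMDiffAt I 𝓘(ℝ, ℝ) ∞ (c i) p₀) ∧
      (∀ᶠ p in 𝓝 p₀, covector I f p = ∑ i, c i p • covector I (u i) p) ∧
      ∃ S : ι → ι → ℝ, (∀ i j, S i j = S j i) ∧
        ∀ i, covector I (c i) p₀ = ∑ j, S i j • covector I (u j) p₀ := by
  obtain ⟨c, hc, hd, S, hS, hcS⟩ := hu.exists_coeff hf
  refine ⟨c, hc, hd.mono fun p hp => ?_, S, hS, fun i => ?_⟩
  · ext v
    have := congrArg (fun L => L v) hp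
    simp only [sum_apply] at this
    rw [LinearMap.sum_apply]
    exact this
  · ext v
    have := congrArg (fun L => L v) (hcS i)
    simp only [sum_apply] at this
    rw [LinearMap.sum_apply]
    exact this

theorem schoutenSelf_eq_zero_of_frame (hu : IsCoordFrame I b u p₀)
    (X : ∀ p : N, TangentSpace I p) {f g h : N → ℝ} (hf : ContMDiff I 𝓘(ℝ, ℝ) ∞ f)
    (hg : ContMDiff I 𝓘(ℝ, ℝ) ∞ g) (hh : ContMDiff I 𝓘(ℝ, ℝ) ∞ h)
    (hT : ∀ i, Λ.schoutenSelf (u i) g h p₀ + 2 * wedgeVector X Λ (u i) g h p₀ = 0) :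
    Λ.schoutenSelf f g h p₀ + 2 * wedgeVector X Λ f g h p₀ = 0 := by
  obtain ⟨c, hc, hd, S, hS, hcS⟩ := hu.exists_covector_coeff hf
  have e1 : Λ.apply f g =ᶠ[𝓝 p₀] fun q => ∑ i, c i q * Λ.apply (u i) g q := by
    filter_upwards [hd] with q hq
    rw [apply_eq, hq, map_sum, LinearMap.sum_apply]
    simp only [map_smul, LinearMap.smul_apply, smul_eq_mul, ← apply_eq]
  have e2 : Λ.apply h f =ᶠ[𝓝 p₀] fun q => ∑ i, c i q * Λ.apply h (u i) q := by
    filter_upwards [hd] with q hq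
    rw [apply_eq, hq, map_sum]
    simp only [map_smul, smul_eq_mul, ← apply_eq]
  have d1 := covector_sum_mul (I := I) e1 (fun i => (hc i).mdifferentiableAt')
    (fun i => (Λ.smooth (u i) g (hu.contMDiff i) hg).mdifferentiableAt' p₀)
  have d2 := covector_sum_mul (I := I) e2 (fun i => (hc i).mdifferentiableAt')
    (fun i => (Λ.smooth h (u i) hh (hu.contMDiff i)).mdifferentiableAt' p₀)
  have hsum : ∑ i, c i p₀ * (Λ.schoutenSelf (u i) g h p₀ + 2 * wedgeVector X Λ (u i) g h p₀) = 0 :=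
    Finset.sum_eq_zero fun i _ => by rw [hT, mul_zero]
  have hsym := sum_symm_mul_sub_eq_zero S hS (fun i => Λ.apply (u i) g p₀)
    (fun i => Λ.apply (u i) h p₀)
  have f1 : Λ.apply (Λ.apply f g) h p₀ = ∑ i, (c i p₀ * Λ.apply (Λ.apply (u i) g) h p₀
      + Λ.apply (u i) g p₀ * ∑ j, S i j * Λ.apply (u j) h p₀) := by
    rw [apply_eq, d1]
    simp only [map_sum, map_add, map_smul, LinearMap.sum_apply, LinearMap.add_apply,
      LinearMap.smul_apply, smul_eq_mul, hcS, ← apply_eq]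
  have f2 : Λ.apply (Λ.apply h f) g p₀ = ∑ i, (c i p₀ * Λ.apply (Λ.apply h (u i)) g p₀
      + Λ.apply h (u i) p₀ * ∑ j, S i j * Λ.apply (u j) g p₀) := by
    rw [apply_eq, d2]
    simp only [map_sum, map_add, map_smul, LinearMap.sum_apply, LinearMap.add_apply,
      LinearMap.smul_apply, smul_eq_mul, hcS, ← apply_eq]
  have f3 : Λ.apply (Λ.apply g h) f p₀ = ∑ i, c i p₀ * Λ.apply (Λ.apply g h) (u i) p₀ := by
    rw [apply_eq, hd.self_of_nhds]
    simp only [map_sum, map_smul, smul_eq_mul, ← apply_eq]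
  have f4 : dirDeriv X f p₀ = ∑ i, c i p₀ * dirDeriv X (u i) p₀ := by
    rw [dirDeriv_eq_covector, hd.self_of_nhds]
    simp only [LinearMap.sum_apply, LinearMap.smul_apply, smul_eq_mul, ← dirDeriv_eq_covector]
  have f5 : Λ.apply h f p₀ = ∑ i, c i p₀ * Λ.apply h (u i) p₀ := e2.self_of_nhds
  have f6 : Λ.apply f g p₀ = ∑ i, c i p₀ * Λ.apply (u i) g p₀ := e1.self_of_nhds
  simp only [schoutenSelf, wedgeVector] at hsum ⊢
  rw [f1, f2, f3, f4, f5, f6]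
  generalize hP : (fun i => ∑ j, S i j * Λ.apply (u j) h p₀) = P at *
  generalize hQ : (fun i => ∑ j, S i j * Λ.apply (u j) g p₀) = Q at *
  have hP' : ∀ i, ∑ j, S i j * Λ.apply (u j) h p₀ = P i := fun i => congrFun hP i
  have hQ' : ∀ i, ∑ j, S i j * Λ.apply (u j) g p₀ = Q i := fun i => congrFun hQ i
  simp only [hP', hQ'] at hsym ⊢
  have hfin := congrArg₂ (fun s t => s + (-2) * t) hsum hsym
  simp only [mul_zero, add_zero] at hfin
  rw [← hfin]
  simp only [Finset.mul_sum, Finset.sum_mul, ← Finset.sum_add_distrib]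
  refine Finset.sum_congr rfl fun i _ => ?_
  rw [Λ.apply_swap h (u i)]
  ring

/-- The trivector `[Λ, Λ] + 2 X ∧ Λ` vanishes as soon as it vanishes on a coordinate frame. -/
theorem schoutenSelf_add_wedge_eq_zero (hu : IsCoordFrame I b u p₀)
    (X : ∀ p : N, TangentSpace I p) {f g h : N → ℝ} (hf : ContMDiff I 𝓘(ℝ, ℝ) ∞ f)
    (hg : ContMDiff I 𝓘(ℝ, ℝ) ∞ g) (hh : ContMDiff I 𝓘(ℝ, ℝ) ∞ h)
    (hT : ∀ i j k, Λ.schoutenSelf (u i) (u j) (u k) p₀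
      + 2 * wedgeVector X Λ (u i) (u j) (u k) p₀ = 0) :
    Λ.schoutenSelf f g h p₀ + 2 * wedgeVector X Λ f g h p₀ = 0 := by
  have rot : ∀ a b c : N → ℝ, Λ.schoutenSelf a b c p₀ + 2 * wedgeVector X Λ a b c p₀ = 0 →
      Λ.schoutenSelf b c a p₀ + 2 * wedgeVector X Λ b c a p₀ = 0 := fun a b c h => by
    rwa [← schoutenSelf_rotate, ← wedgeVector_rotate]
  refine Λ.schoutenSelf_eq_zero_of_frame hu X hf hg hh fun i => ?_
  refine rot _ _ _ (Λ.schoutenSelf_eq_zero_of_frame hu X hh (hu.contMDiff i) hg fun j => ?_)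
  refine rot _ _ _ (Λ.schoutenSelf_eq_zero_of_frame hu X hg (hu.contMDiff j) (hu.contMDiff i)
    fun k => ?_)
  exact hT k j i

theorem _root_.dirDeriv_eventuallyEq_sum {X : ∀ p : N, TangentSpace I p} {f : N → ℝ}
    {c : ι → N → ℝ}
    (hd : ∀ᶠ p in 𝓝 p₀, covector I f p = ∑ i, c i p • covector I (u i) p) :
    dirDeriv X f =ᶠ[𝓝 p₀] fun q => ∑ i, c i q * dirDeriv X (u i) q := by
  filter_upwards [hd] with q hq
  rw [dirDeriv_eq_covector, hq]
  simp only [LinearMap.sum_apply, LinearMap.smul_apply, smul_eq_mul, ← dirDeriv_eq_covector]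

theorem schoutenVector_eq_zero_of_frame (hu : IsCoordFrame I b u p₀)
    {X : ∀ p : N, TangentSpace I p}
    (hX : ∀ i, MDifferentiableAt I 𝓘(ℝ, ℝ) (dirDeriv X (u i)) p₀)
    {f g : N → ℝ} (hf : ContMDiff I 𝓘(ℝ, ℝ) ∞ f) (hg : ContMDiff I 𝓘(ℝ, ℝ) ∞ g)
    (hT : ∀ i, schoutenVector X Λ (u i) g p₀ = 0) : schoutenVector X Λ f g p₀ = 0 := by
  obtain ⟨c, hc, hd, S, hS, hcS⟩ := hu.exists_covector_coeff hf
  have e1 : Λ.apply f g =ᶠ[𝓝 p₀] fun q => ∑ i, c i q * Λ.apply (u i) g q := by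
    filter_upwards [hd] with q hq
    rw [apply_eq, hq, map_sum, LinearMap.sum_apply]
    simp only [map_smul, LinearMap.smul_apply, smul_eq_mul, ← apply_eq]
  have e2 := dirDeriv_eventuallyEq_sum (X := X) hd
  have d1 := covector_sum_mul (I := I) e1 (fun i => (hc i).mdifferentiableAt')
    (fun i => (Λ.smooth (u i) g (hu.contMDiff i) hg).mdifferentiableAt' p₀)
  have d2 := covector_sum_mul (I := I) e2 (fun i => (hc i).mdifferentiableAt') hX
  have hsum : ∑ i, c i p₀ * schoutenVector X Λ (u i) g p₀ = 0 :=
    Finset.sum_eq_zero fun i _ => by rw [hT, mul_zero]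
  have hsym := sum_symm_mul_sub_eq_zero S hS (fun i => Λ.apply (u i) g p₀)
    (fun i => dirDeriv X (u i) p₀)
  have f1 : dirDeriv X (Λ.apply f g) p₀ = ∑ i, (c i p₀ * dirDeriv X (Λ.apply (u i) g) p₀
      + Λ.apply (u i) g p₀ * ∑ j, S i j * dirDeriv X (u j) p₀) := by
    rw [dirDeriv_eq_covector, d1]
    simp only [LinearMap.sum_apply, LinearMap.add_apply,
      LinearMap.smul_apply, smul_eq_mul, hcS, ← dirDeriv_eq_covector]
  have f2 : Λ.apply (dirDeriv X f) g p₀ = ∑ i, (c i p₀ * Λ.apply (dirDeriv X (u i)) g p₀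
      + dirDeriv X (u i) p₀ * ∑ j, S i j * Λ.apply (u j) g p₀) := by
    rw [apply_eq, d2]
    simp only [map_sum, map_add, map_smul, LinearMap.sum_apply, LinearMap.add_apply,
      LinearMap.smul_apply, smul_eq_mul, hcS, ← apply_eq]
  have f3 : Λ.apply f (dirDeriv X g) p₀
      = ∑ i, c i p₀ * Λ.apply (u i) (dirDeriv X g) p₀ := by
    rw [apply_eq, hd.self_of_nhds]
    simp only [map_sum, map_smul, LinearMap.sum_apply, LinearMap.smul_apply, smul_eq_mul,
      ← apply_eq]
  simp only [schoutenVector] at hsum ⊢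
  rw [f1, f2, f3]
  have hfin := congrArg₂ (fun s t => s + t) hsum hsym
  simp only [add_zero] at hfin
  rw [← hfin]
  simp only [← Finset.sum_add_distrib, ← Finset.sum_sub_distrib]
  refine Finset.sum_congr rfl fun i _ => ?_
  ring

/-- The bivector `[X, Λ]` vanishes as soon as it vanishes on a coordinate frame. -/
theorem schoutenVector_eq_zero (hu : IsCoordFrame I b u p₀)
    {X : ∀ p : N, TangentSpace I p}
    (hX : ∀ i, MDifferentiableAt I 𝓘(ℝ, ℝ) (dirDeriv X (u i)) p₀)
    {f g : N → ℝ} (hf : ContMDiff I 𝓘(ℝ, ℝ) ∞ f) (hg : ContMDiff I 𝓘(ℝ, ℝ) ∞ g)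
    (hT : ∀ i j, schoutenVector X Λ (u i) (u j) p₀ = 0) : schoutenVector X Λ f g p₀ = 0 := by
  refine Λ.schoutenVector_eq_zero_of_frame hu hX hf hg fun i => ?_
  rw [schoutenVector_swap, neg_eq_zero]
  exact Λ.schoutenVector_eq_zero_of_frame hu hX hg (hu.contMDiff i) fun j => hT j i

end Tensorial

end BivectorField

end Bivector

/-! ## Affine functions on an affine bundle -/

theorem contMDiff_mul_of_tsupport_subset {G : Type*} [NormedAddCommGroup G] [NormedSpace ℝ G]
    {H : Type*} [TopologicalSpace H] {I : ModelWithCorners ℝ G H}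
    {N : Type*} [TopologicalSpace N] [ChartedSpace H N] {ψ u : N → ℝ} {U : Set N}
    (hψ : ContMDiff I 𝓘(ℝ, ℝ) ∞ ψ) (hU : tsupport ψ ⊆ U)
    (hu : ∀ p ∈ U, ContMDiffAt I 𝓘(ℝ, ℝ) ∞ u p) :
    ContMDiff I 𝓘(ℝ, ℝ) ∞ (fun p => ψ p * u p) :=
  contMDiff_of_tsupport fun p hp =>
    (hψ p).mul (hu p (hU (closure_mono (Function.support_mul_subset_left ψ u) hp)))

section AffineFunctions

variable {E : Type*} [NormedAddCommGroup E] [NormedSpace ℝ E] [FiniteDimensional ℝ E]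
  {M : Type*} [TopologicalSpace M] [ChartedSpace E M]
  {F : Type*} [NormedAddCommGroup F] [NormedSpace ℝ F] [FiniteDimensional ℝ F]
  {V : M → Type*} [∀ x, AddCommGroup (V x)] [∀ x, Module ℝ (V x)]
  {A : M → Type*} [∀ x, AddTorsor (V x) (A x)] [∀ x, TopologicalSpace (A x)]
  [TopologicalSpace (TotalSpace F A)] [FiberBundle F A]

section Smooth

variable [SmoothFiberBundle 𝓘(ℝ, E) F A]

theorem contMDiffAt_trivialization_snd (e : Trivialization F (π F A)) [MemTrivializationAtlas e]
    {p : TotalSpace F A} (hp : p.proj ∈ e.baseSet) :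
    ContMDiffAt (𝓘(ℝ, E).prod 𝓘(ℝ, F)) 𝓘(ℝ, F) ∞ (fun q : TotalSpace F A => (e q).2) p := by
  let e₁ := trivializationAt F A p.proj
  have hp₁ : p.proj ∈ e₁.baseSet := mem_baseSet_trivializationAt F A p.proj
  have h1 : ContMDiffAt (𝓘(ℝ, E).prod 𝓘(ℝ, F)) 𝓘(ℝ, F) ∞
      (fun q : TotalSpace F A => (e₁ q).2) p :=
    (contMDiffAt_totalSpace.1 (contMDiffAt_id (I := 𝓘(ℝ, E).prod 𝓘(ℝ, F)) (x := p))).2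
  have h2 : ContMDiffAt (𝓘(ℝ, E).prod 𝓘(ℝ, F)) (𝓘(ℝ, E).prod 𝓘(ℝ, F)) ∞
      (fun q : TotalSpace F A => ((q.proj, (e₁ q).2) : M × F)) p :=
    (contMDiffAt_proj A).prodMk h1
  have h3 := SmoothFiberBundle.contMDiffOn_symm_trans (I := 𝓘(ℝ, E)) e₁ e
  have hopen : IsOpen (e₁.target ∩ e.target) := e₁.open_target.inter e.open_target
  have h4 := (h3.contMDiffAt (hopen.mem_nhds
    (x := (p.proj, (e₁ p).2)) ⟨e₁.mem_target.2 hp₁, e.mem_target.2 hp⟩)).comp p h2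
  refine (contMDiffAt_snd.comp p h4).congr_of_eventuallyEq ?_
  have hs : e₁.source ∈ 𝓝 p := e₁.open_source.mem_nhds (e₁.mem_source.2 hp₁)
  filter_upwards [hs] with q hq
  have : ((q.proj, (e₁ q).2) : M × F) = e₁ q := Prod.ext (e₁.coe_fst hq).symm rfl
  change (e q).2 = (e (e₁.toOpenPartialHomeomorph.symm (q.proj, (e₁ q).2))).2
  rw [this]
  exact congrArg (fun r => (e r).2) (e₁.toOpenPartialHomeomorph.left_inv hq).symm

theorem contMDiffAt_trivialization_symm (e : Trivialization F (π F A)) [MemTrivializationAtlas e]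
    {z : M × F} (hz : z.1 ∈ e.baseSet) :
    ContMDiffAt (𝓘(ℝ, E).prod 𝓘(ℝ, F)) (𝓘(ℝ, E).prod 𝓘(ℝ, F)) ∞
      e.toOpenPartialHomeomorph.symm z := by
  have hzt : z ∈ e.target := e.mem_target.2 hz
  have hproj : ∀ᶠ w in 𝓝 z, (e.toOpenPartialHomeomorph.symm w).proj = w.1 := by
    filter_upwards [e.open_target.mem_nhds hzt] with w hw using e.proj_symm_apply hw
  rw [contMDiffAt_totalSpace]
  refine ⟨contMDiffAt_fst.congr_of_eventuallyEq hproj, ?_⟩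
  have h3 := SmoothFiberBundle.contMDiffOn_symm_trans (I := 𝓘(ℝ, E)) e
    (trivializationAt F A (e.toOpenPartialHomeomorph.symm z).proj)
  refine contMDiffAt_snd.comp z (h3.contMDiffAt ?_)
  refine (e.open_target.inter (trivializationAt F A
    (e.toOpenPartialHomeomorph.symm z).proj).open_target).mem_nhds ⟨hzt, ?_⟩
  rw [Trivialization.mem_target, ← e.proj_symm_apply hzt]
  exact mem_baseSet_trivializationAt F A _

theorem contMDiffAt_comp_trivialization_symm (e : Trivialization F (π F A))
    [MemTrivializationAtlas e] {a : TotalSpace F A → ℝ}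
    (ha : ContMDiff (𝓘(ℝ, E).prod 𝓘(ℝ, F)) 𝓘(ℝ, ℝ) ∞ a) (v : F) {x : M} (hx : x ∈ e.baseSet) :
    ContMDiffAt 𝓘(ℝ, E) 𝓘(ℝ, ℝ) ∞ (fun y => a (e.toOpenPartialHomeomorph.symm (y, v))) x :=
  (ha _).comp x (f := fun y => e.toOpenPartialHomeomorph.symm (y, v))
    ((contMDiffAt_trivialization_symm e (z := (x, v)) hx).comp x (f := fun y => (y, v))
      (contMDiffAt_id.prodMk contMDiffAt_const))

end Smooth

namespace IsAffineFunction

theorem contMDiff {a : TotalSpace F A → ℝ} (ha : IsAffineFunction 𝓘(ℝ, E) F A a) :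
    ContMDiff (𝓘(ℝ, E).prod 𝓘(ℝ, F)) 𝓘(ℝ, ℝ) ∞ a := ha.1

theorem add {a b : TotalSpace F A → ℝ} (ha : IsAffineFunction 𝓘(ℝ, E) F A a)
    (hb : IsAffineFunction 𝓘(ℝ, E) F A b) :
    IsAffineFunction 𝓘(ℝ, E) F A (fun p => a p + b p) := by
  refine ⟨ha.1.add hb.1, fun x => ?_⟩
  obtain ⟨φ, hφ⟩ := ha.2 x
  obtain ⟨ψ, hψ⟩ := hb.2 x
  exact ⟨φ + ψ, fun y => by simp [hφ, hψ]⟩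

theorem basic_mul {f : M → ℝ} (hf : ContMDiff 𝓘(ℝ, E) 𝓘(ℝ, ℝ) ∞ f) {a : TotalSpace F A → ℝ}
    (ha : IsAffineFunction 𝓘(ℝ, E) F A a) :
    IsAffineFunction 𝓘(ℝ, E) F A (fun p => f p.proj * a p) := by
  refine ⟨(hf.comp (contMDiff_proj A)).mul ha.1, fun x => ?_⟩
  obtain ⟨φ, hφ⟩ := ha.2 x
  exact ⟨f x • φ, fun y => by simp [hφ]⟩

theorem const_mul (c : ℝ) {a : TotalSpace F A → ℝ} (ha : IsAffineFunction 𝓘(ℝ, E) F A a) :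
    IsAffineFunction 𝓘(ℝ, E) F A (fun p => c * a p) :=
  ha.basic_mul (f := fun _ => c) contMDiff_const

theorem sub {a b : TotalSpace F A → ℝ} (ha : IsAffineFunction 𝓘(ℝ, E) F A a)
    (hb : IsAffineFunction 𝓘(ℝ, E) F A b) :
    IsAffineFunction 𝓘(ℝ, E) F A (fun p => a p - b p) := by
  have := ha.add (hb.const_mul (-1))
  simpa only [neg_mul, one_mul, ← sub_eq_add_neg] using this

theorem basic {f : M → ℝ} (hf : ContMDiff 𝓘(ℝ, E) 𝓘(ℝ, ℝ) ∞ f) :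
    IsAffineFunction 𝓘(ℝ, E) F A (fun p => f p.proj) :=
  ⟨hf.comp (contMDiff_proj A), fun x => ⟨AffineMap.const ℝ (A x) (f x), fun _ => rfl⟩⟩

theorem const (c : ℝ) : IsAffineFunction 𝓘(ℝ, E) F A (fun _ => c) :=
  basic (f := fun _ => c) contMDiff_const

theorem sum {ι : Type*} (s : Finset ι) {a : ι → TotalSpace F A → ℝ}
    (ha : ∀ i, IsAffineFunction 𝓘(ℝ, E) F A (a i)) :
    IsAffineFunction 𝓘(ℝ, E) F A (fun p => ∑ i ∈ s, a i p) := by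
  classical
  induction s using Finset.induction_on with
  | empty => simpa using const 0
  | insert i s hi ih =>
    simp only [Finset.sum_insert hi]
    exact (ha i).add ih

/-- If the product of an affine function with each affine function is affine, then it is constant
on the fibres. -/
theorem eq_of_mul {c : TotalSpace F A → ℝ} (hc : IsAffineFunction 𝓘(ℝ, E) F A c)
    (h : ∀ b, IsAffineFunction 𝓘(ℝ, E) F A b → IsAffineFunction 𝓘(ℝ, E) F A (fun p => b p * c p))
    {x : M} (y y' : A x) : c ⟨x, y⟩ = c ⟨x, y'⟩ := by
  obtain ⟨φ, hφ⟩ := hc.2 x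
  obtain ⟨ψ, hψ⟩ := (h c hc).2 x
  have hsq : ∀ z, ψ z = φ z * φ z := fun z => by rw [← hψ, ← hφ]
  have h1 := hsq y
  have h2 := hsq y'
  have h3 := hsq (AffineMap.lineMap y y' (2 : ℝ))
  simp only [AffineMap.apply_lineMap, AffineMap.lineMap_apply_ring, h1, h2] at h3
  rw [hφ, hφ]
  have : (φ y - φ y') ^ 2 = 0 := by linarith
  exact sub_eq_zero.1 (pow_eq_zero_iff (two_ne_zero) |>.1 this)

variable [SmoothFiberBundle 𝓘(ℝ, E) F A]

/-- A smooth function on `A` which is constant on the fibres is the pullback of a smooth function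
on `M`. -/
theorem exists_basic {c : TotalSpace F A → ℝ}
    (hc : ContMDiff (𝓘(ℝ, E).prod 𝓘(ℝ, F)) 𝓘(ℝ, ℝ) ∞ c)
    (h : ∀ (x : M) (y y' : A x), c ⟨x, y⟩ = c ⟨x, y'⟩) :
    ∃ f : M → ℝ, ContMDiff 𝓘(ℝ, E) 𝓘(ℝ, ℝ) ∞ f ∧ ∀ p, c p = f p.proj := by
  have h' : ∀ p q : TotalSpace F A, p.proj = q.proj → c p = c q := by
    rintro ⟨x, y⟩ ⟨x', y'⟩ (rfl : x = x')
    exact h x y y'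
  have hproj : ∀ x x' : M, x' ∈ (trivializationAt F A x).baseSet →
      ((trivializationAt F A x).toOpenPartialHomeomorph.symm (x', 0)).proj = x' :=
    fun x x' hx => (trivializationAt F A x).proj_symm_apply
      ((trivializationAt F A x).mem_target.2 hx)
  refine ⟨fun x => c ((trivializationAt F A x).toOpenPartialHomeomorph.symm (x, 0)), ?_, ?_⟩
  · intro x₀
    have hx₀ := mem_baseSet_trivializationAt F A x₀
    refine (contMDiffAt_comp_trivialization_symm (trivializationAt F A x₀) hc 0
      hx₀).congr_of_eventuallyEq ?_
    filter_upwards [(trivializationAt F A x₀).open_baseSet.mem_nhds hx₀] with x hx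
    refine h' _ _ ?_
    rw [hproj x x (mem_baseSet_trivializationAt F A x), hproj x₀ x hx]
  · intro p
    refine h' _ _ ?_
    rw [hproj _ _ (mem_baseSet_trivializationAt F A p.proj)]

end IsAffineFunction

end AffineFunctions

/-! ## Local affine frames -/

theorem affineMap_eq_sum {F : Type*} [NormedAddCommGroup F] [NormedSpace ℝ F]
    [FiniteDimensional ℝ F] (g : F →ᵃ[ℝ] ℝ) (v : F) :
    g v = g 0 + ∑ j, (g (Module.finBasis ℝ F j) - g 0) * (Module.finBasis ℝ F).coord j v := by
  have hlin : ∀ v, g v - g 0 = g.linear v := fun v => by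
    have := g.linearMap_vsub v 0
    simpa using this.symm
  have h1 : g.linear v = ∑ j, (g (Module.finBasis ℝ F j) - g 0)
      * (Module.finBasis ℝ F).coord j v := by
    conv_lhs => rw [← (Module.finBasis ℝ F).sum_repr v]
    simp only [map_sum, map_smul, smul_eq_mul, hlin, Module.Basis.coord_apply]
    exact Finset.sum_congr rfl fun _ _ => mul_comm _ _
  rw [← h1, ← hlin]
  ring

section AffineFrames

variable {E : Type*} [NormedAddCommGroup E] [NormedSpace ℝ E] [FiniteDimensional ℝ E]
  {M : Type*} [TopologicalSpace M] [T2Space M] [ChartedSpace E M] [IsManifold 𝓘(ℝ, E) ∞ M]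
  (F : Type*) [NormedAddCommGroup F] [NormedSpace ℝ F] [FiniteDimensional ℝ F]
  {V : M → Type*} [∀ x, AddCommGroup (V x)] [∀ x, Module ℝ (V x)]
  (A : M → Type*) [∀ x, AddTorsor (V x) (A x)] [∀ x, TopologicalSpace (A x)]
  [TopologicalSpace (TotalSpace F A)] [FiberBundle F A]

theorem exists_bump (x₀ : M) : ∃ χ : M → ℝ, ContMDiff 𝓘(ℝ, E) 𝓘(ℝ, ℝ) ∞ χ ∧
    tsupport χ ⊆ (chartAt E x₀).source ∩ (trivializationAt F A x₀).baseSet ∧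
    χ =ᶠ[𝓝 x₀] fun _ => 1 := by
  have hU : (trivializationAt F A x₀).baseSet ∈ 𝓝 x₀ :=
    (trivializationAt F A x₀).open_baseSet.mem_nhds (mem_baseSet_trivializationAt F A x₀)
  obtain ⟨χ, -, hχ⟩ := (SmoothBumpFunction.nhds_basis_tsupport (I := 𝓘(ℝ, E)) x₀).mem_iff.1 hU
  exact ⟨χ, χ.contMDiff, subset_inter χ.tsupport_subset_chartAt_source hχ, χ.eventuallyEq_one⟩

variable (E) in
/-- A smooth bump function on `M` around `x₀`, supported in the domains of the preferred chart and
of the preferred trivialization of `A` at `x₀`. -/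
def bump (x₀ : M) : M → ℝ := (exists_bump (E := E) F A x₀).choose

theorem contMDiff_bump (x₀ : M) : ContMDiff 𝓘(ℝ, E) 𝓘(ℝ, ℝ) ∞ (bump E F A x₀) :=
  (exists_bump F A x₀).choose_spec.1

theorem tsupport_bump_subset_source (x₀ : M) :
    tsupport (bump E F A x₀) ⊆ (chartAt E x₀).source :=
  ((exists_bump F A x₀).choose_spec.2.1).trans inter_subset_left

theorem tsupport_bump_subset_baseSet (x₀ : M) :
    tsupport (bump E F A x₀) ⊆ (trivializationAt F A x₀).baseSet :=
  ((exists_bump F A x₀).choose_spec.2.1).trans inter_subset_right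

theorem bump_eventuallyEq_one (x₀ : M) : bump E F A x₀ =ᶠ[𝓝 x₀] fun _ => 1 :=
  (exists_bump F A x₀).choose_spec.2.2

theorem bump_self (x₀ : M) : bump E F A x₀ x₀ = 1 := (bump_eventuallyEq_one F A x₀).self_of_nhds

theorem bump_eq_zero {x₀ x : M} (hx : x ∉ (trivializationAt F A x₀).baseSet) :
    bump E F A x₀ x = 0 :=
  image_eq_zero_of_notMem_tsupport fun h => hx (tsupport_bump_subset_baseSet F A x₀ h)

variable (E) in
/-- Functions on `M` which coincide near `x₀` with the coordinates of the preferred chart. -/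
def baseCoord (x₀ : M) (i : Fin (Module.finrank ℝ E)) (x : M) : ℝ :=
  bump E F A x₀ x * (Module.finBasis ℝ E).coord i (extChartAt 𝓘(ℝ, E) x₀ x)

theorem contMDiff_baseCoord (x₀ : M) (i : Fin (Module.finrank ℝ E)) :
    ContMDiff 𝓘(ℝ, E) 𝓘(ℝ, ℝ) ∞ (baseCoord E F A x₀ i) := by
  refine contMDiff_mul_of_tsupport_subset (contMDiff_bump F A x₀)
    (tsupport_bump_subset_source F A x₀) fun x hx => ?_
  exact (((Module.finBasis ℝ E).coord i).toContinuousLinearMap.contDiff.contMDiff _).comp x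
    (contMDiffAt_extChartAt' hx)

theorem isCoordFrame_baseCoord (x₀ : M) :
    IsCoordFrame 𝓘(ℝ, E) (Module.finBasis ℝ E) (baseCoord E F A x₀) x₀ :=
  ⟨contMDiff_baseCoord F A x₀, fun i => by
    filter_upwards [bump_eventuallyEq_one (E := E) F A x₀] with x hx
    rw [baseCoord, hx, one_mul]⟩

variable (E) in
/-- The affine function on `A` given near the fibre at `x₀` by an affine function on the model
fibre. -/
def localAffine (x₀ : M) (g : F →ᴬ[ℝ] ℝ) (p : TotalSpace F A) : ℝ :=
  bump E F A x₀ p.proj * g (trivializationAt F A x₀ p).2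

theorem localAffine_of_eq_one {x₀ : M} {p : TotalSpace F A} (hp : bump E F A x₀ p.proj = 1)
    (g : F →ᴬ[ℝ] ℝ) : localAffine E F A x₀ g p = g (trivializationAt F A x₀ p).2 := by
  rw [localAffine, hp, one_mul]

/-- The `j`-th coordinate on the model fibre. -/
def fiberLinear (j : Fin (Module.finrank ℝ F)) : F →ᴬ[ℝ] ℝ :=
  ((Module.finBasis ℝ F).coord j).toContinuousLinearMap.toContinuousAffineMap

theorem fiberLinear_apply (j : Fin (Module.finrank ℝ F)) (v : F) :
    fiberLinear F j v = (Module.finBasis ℝ F).coord j v := rfl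

variable (E) in
/-- Affine functions on `A` which coincide near the fibre at `x₀` with the fibre coordinates. -/
def fiberCoord (x₀ : M) (j : Fin (Module.finrank ℝ F)) : TotalSpace F A → ℝ :=
  localAffine E F A x₀ (fiberLinear F j)

variable (E) in
/-- Affine functions on `A` which coincide near the fibre at `x₀` with the coordinates of the
preferred chart. -/
def affineCoord (x₀ : M) :
    Fin (Module.finrank ℝ E) ⊕ Fin (Module.finrank ℝ F) → TotalSpace F A → ℝ :=
  Sum.elim (fun i p => baseCoord E F A x₀ i p.proj) (fiberCoord E F A x₀)

variable [AffineBundle F A] [SmoothFiberBundle 𝓘(ℝ, E) F A]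

theorem isAffineFunction_localAffine (x₀ : M) (g : F →ᴬ[ℝ] ℝ) :
    IsAffineFunction 𝓘(ℝ, E) F A (localAffine E F A x₀ g) := by
  constructor
  · refine contMDiff_mul_of_tsupport_subset (I := 𝓘(ℝ, E).prod 𝓘(ℝ, F))
      (ψ := fun p : TotalSpace F A => bump E F A x₀ p.proj)
      (u := fun p => g (trivializationAt F A x₀ p).2)
      (U := TotalSpace.proj ⁻¹' (trivializationAt F A x₀).baseSet)
      ((contMDiff_bump F A x₀).comp (contMDiff_proj A)) ?_ ?_
    · refine (closure_minimal (fun p hp => ?_)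
        ((isClosed_tsupport (bump E F A x₀)).preimage
          (FiberBundle.continuous_proj F A))).trans
        (preimage_mono (tsupport_bump_subset_baseSet F A x₀))
      exact subset_tsupport _ hp
    · intro p hp
      exact (g.contDiff.contMDiff _).comp p (contMDiffAt_trivialization_snd _ hp)
  · intro x
    by_cases hx : x ∈ (trivializationAt F A x₀).baseSet
    · let φ := AffDual.trivEquiv (trivializationAt F A x₀) x hx
      refine ⟨bump E F A x₀ x • (g : F →ᵃ[ℝ] ℝ).comp (φ : A x →ᵃ[ℝ] F), fun y => ?_⟩
      rw [localAffine, ← AffDual.trivEquiv_apply _ x hx y]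
      rfl
    · refine ⟨0, fun y => ?_⟩
      rw [localAffine, bump_eq_zero F A hx, zero_mul]
      rfl

theorem isAffineFunction_fiberCoord (x₀ : M) (j : Fin (Module.finrank ℝ F)) :
    IsAffineFunction 𝓘(ℝ, E) F A (fiberCoord E F A x₀ j) :=
  isAffineFunction_localAffine F A x₀ _

theorem isAffineFunction_affineCoord (x₀ : M)
    (k : Fin (Module.finrank ℝ E) ⊕ Fin (Module.finrank ℝ F)) :
    IsAffineFunction 𝓘(ℝ, E) F A (affineCoord E F A x₀ k) := by
  rcases k with i | j
  · exact IsAffineFunction.basic (contMDiff_baseCoord F A x₀ i)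
  · exact isAffineFunction_fiberCoord F A x₀ j

variable (E) in
/-- The basis of the model space of the total space of `A`. -/
def totalBasis : Module.Basis (Fin (Module.finrank ℝ E) ⊕ Fin (Module.finrank ℝ F)) ℝ (E × F) :=
  (Module.finBasis ℝ E).prod (Module.finBasis ℝ F)

theorem isCoordFrame_affineCoord {W : M → Type*} [∀ x, AddCommGroup (W x)] [∀ x, Module ℝ (W x)]
    [∀ x, AddTorsor (W x) (A x)] [AffineBundle F A] (p₀ : TotalSpace F A) :
    IsCoordFrame (𝓘(ℝ, E).prod 𝓘(ℝ, F)) (totalBasis E F) (affineCoord E F A p₀.proj) p₀ := by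
  refine ⟨fun k => (isAffineFunction_affineCoord F A p₀.proj k).1, fun k => ?_⟩
  have hχ : ∀ᶠ p : TotalSpace F A in 𝓝 p₀, bump E F A p₀.proj p.proj = 1 :=
    (FiberBundle.continuous_proj F A).continuousAt.eventually
      (bump_eventuallyEq_one F A p₀.proj)
  have hs : ∀ᶠ p : TotalSpace F A in 𝓝 p₀, p.proj ∈ (trivializationAt F A p₀.proj).baseSet :=
    (FiberBundle.continuous_proj F A).continuousAt.eventually
      ((trivializationAt F A p₀.proj).open_baseSet.mem_nhds
        (mem_baseSet_trivializationAt F A p₀.proj))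
  filter_upwards [hχ, hs] with p hp hps
  have hchart : extChartAt (𝓘(ℝ, E).prod 𝓘(ℝ, F)) p₀ p
      = (extChartAt 𝓘(ℝ, E) p₀.proj p.proj, (trivializationAt F A p₀.proj p).2) := by
    rw [FiberBundle.extChartAt]
    change (extChartAt 𝓘(ℝ, E) p₀.proj (trivializationAt F A p₀.proj p).1, _) = _
    rw [Trivialization.coe_fst' _ hps]
    rfl
  rw [hchart]
  rcases k with i | j
  · simp [affineCoord, baseCoord, hp, totalBasis]
  · simp [affineCoord, fiberCoord, localAffine_of_eq_one F A hp, fiberLinear_apply, totalBasis]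

variable (E) in
/-- The constant term of an affine function, cut off near `x₀`. -/
def affineCoeffZero (x₀ : M) (a : TotalSpace F A → ℝ) (x : M) : ℝ :=
  bump E F A x₀ x * a ((trivializationAt F A x₀).toOpenPartialHomeomorph.symm (x, 0))

variable (E) in
/-- The linear coefficients of an affine function, cut off near `x₀`. -/
def affineCoeff (x₀ : M) (a : TotalSpace F A → ℝ) (j : Fin (Module.finrank ℝ F)) (x : M) : ℝ :=
  bump E F A x₀ x *
    (a ((trivializationAt F A x₀).toOpenPartialHomeomorph.symm (x, Module.finBasis ℝ F j))
      - a ((trivializationAt F A x₀).toOpenPartialHomeomorph.symm (x, 0)))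

theorem contMDiff_affineCoeffZero (x₀ : M) {a : TotalSpace F A → ℝ}
    (ha : IsAffineFunction 𝓘(ℝ, E) F A a) :
    ContMDiff 𝓘(ℝ, E) 𝓘(ℝ, ℝ) ∞ (affineCoeffZero E F A x₀ a) :=
  contMDiff_mul_of_tsupport_subset (contMDiff_bump F A x₀)
    (tsupport_bump_subset_baseSet F A x₀) fun _ hx =>
      contMDiffAt_comp_trivialization_symm _ ha.1 0 hx

theorem contMDiff_affineCoeff (x₀ : M) {a : TotalSpace F A → ℝ}
    (ha : IsAffineFunction 𝓘(ℝ, E) F A a) (j : Fin (Module.finrank ℝ F)) :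
    ContMDiff 𝓘(ℝ, E) 𝓘(ℝ, ℝ) ∞ (affineCoeff E F A x₀ a j) :=
  contMDiff_mul_of_tsupport_subset (contMDiff_bump F A x₀)
    (tsupport_bump_subset_baseSet F A x₀) fun _ hx =>
      (contMDiffAt_comp_trivialization_symm _ ha.1 _ hx).sub
        (contMDiffAt_comp_trivialization_symm _ ha.1 0 hx)

/-- Decomposition of an affine function with respect to the local affine frame at `x₀`. -/
theorem affine_decomposition (x₀ : M) {a : TotalSpace F A → ℝ}
    (ha : IsAffineFunction 𝓘(ℝ, E) F A a) (p : TotalSpace F A) :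
    (bump E F A x₀ p.proj * bump E F A x₀ p.proj) * a p
      = affineCoeffZero E F A x₀ a p.proj * bump E F A x₀ p.proj
        + ∑ j, affineCoeff E F A x₀ a j p.proj * fiberCoord E F A x₀ j p := by
  obtain ⟨x, y⟩ := p
  by_cases hx : x ∈ (trivializationAt F A x₀).baseSet
  swap
  · simp [fiberCoord, localAffine, bump_eq_zero F A hx]
  obtain ⟨φ, hφ⟩ := ha.2 x
  let ψ := AffDual.trivEquiv (trivializationAt F A x₀) x hx
  let g : F →ᵃ[ℝ] ℝ := φ.comp (ψ.symm : F →ᵃ[ℝ] A x)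
  have hg : ∀ v, a ((trivializationAt F A x₀).toOpenPartialHomeomorph.symm (x, v)) = g v := by
    intro v
    rw [← AffDual.mk_trivEquiv_symm _ x hx, hφ]
    rfl
  have hay : a ⟨x, y⟩ = g (ψ y) := by
    rw [hφ]
    change φ y = φ (ψ.symm (ψ y))
    rw [ψ.symm_apply_apply]
  have hdec := affineMap_eq_sum g (ψ y)
  simp only [affineCoeffZero, affineCoeff, fiberCoord, localAffine, hg, fiberLinear_apply,
    ← AffDual.trivEquiv_apply _ x hx y]
  rw [hay, hdec, mul_add, Finset.mul_sum]
  congr 1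
  · ring
  · refine Finset.sum_congr rfl fun j _ => ?_
    ring

end AffineFrames

/-! ## Sections of the vector dual and affine functions -/

section Sections

variable {E : Type*} [NormedAddCommGroup E] [NormedSpace ℝ E] [FiniteDimensional ℝ E]
  {M : Type*} [TopologicalSpace M] [ChartedSpace E M] [IsManifold 𝓘(ℝ, E) ∞ M]
  {F : Type*} [NormedAddCommGroup F] [NormedSpace ℝ F] [FiniteDimensional ℝ F]
  {V : M → Type*} [∀ x, AddCommGroup (V x)] [∀ x, Module ℝ (V x)]
  {A : M → Type*} [∀ x, AddTorsor (V x) (A x)] [∀ x, TopologicalSpace (A x)]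
  [TopologicalSpace (TotalSpace F A)] [FiberBundle F A] [AffineBundle F A]
  [SmoothFiberBundle 𝓘(ℝ, E) F A]

namespace AffDual

theorem contDiff_evalLinear (v : F) : ContDiff ℝ ∞ fun g : F →ᴬ[ℝ] ℝ => g v :=
  (evalLinear (F := F) v).toContinuousLinearMap.contDiff

theorem isAffineFunction_toFunction (s : Cₛ^∞⟮𝓘(ℝ, E); F →ᴬ[ℝ] ℝ, AffDual A⟯) :
    IsAffineFunction 𝓘(ℝ, E) F A (toFunction s) := by
  refine ⟨fun p₀ => ?_, fun x => ⟨(s x).toAffineMap, fun _ => rfl⟩⟩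
  set x₀ := p₀.proj with hx₀
  let u : M → F →ᴬ[ℝ] ℝ := fun x => (trivializationAt (F →ᴬ[ℝ] ℝ) (AffDual A) x₀ ⟨x, s x⟩).2
  have hu : ContMDiffAt 𝓘(ℝ, E) 𝓘(ℝ, F →ᴬ[ℝ] ℝ) ∞ u x₀ :=
    (contMDiffAt_section x₀).1 (s.contMDiff x₀)
  have hev : ∀ v : F, ContMDiffAt (𝓘(ℝ, E).prod 𝓘(ℝ, F)) 𝓘(ℝ, ℝ) ∞
      (fun p : TotalSpace F A => u p.proj v) p₀ := fun v =>
    ((contDiff_evalLinear v).contMDiff _).comp p₀ (f := fun p : TotalSpace F A => u p.proj)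
      (hu.comp p₀ (f := fun p : TotalSpace F A => p.proj) (contMDiffAt_proj A))
  have hsnd : ContMDiffAt (𝓘(ℝ, E).prod 𝓘(ℝ, F)) 𝓘(ℝ, F) ∞
      (fun q : TotalSpace F A => (trivializationAt F A x₀ q).2) p₀ :=
    contMDiffAt_trivialization_snd _ (mem_baseSet_trivializationAt F A x₀)
  have key : ContMDiffAt (𝓘(ℝ, E).prod 𝓘(ℝ, F)) 𝓘(ℝ, ℝ) ∞
      (fun p : TotalSpace F A => u p.proj 0
        + ∑ j, (u p.proj (Module.finBasis ℝ F j) - u p.proj 0)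
          * (Module.finBasis ℝ F).coord j (trivializationAt F A x₀ p).2) p₀ := by
    refine (hev 0).add (ContMDiffAt.sum fun j _ => ((hev _).sub (hev 0)).mul ?_)
    exact (((Module.finBasis ℝ F).coord j).toContinuousLinearMap.contDiff.contMDiff _).comp p₀ hsnd
  refine key.congr_of_eventuallyEq ?_
  have hs : ∀ᶠ p : TotalSpace F A in 𝓝 p₀, p.proj ∈ (trivializationAt F A x₀).baseSet :=
    (FiberBundle.continuous_proj F A).continuousAt.eventually
      ((trivializationAt F A x₀).open_baseSet.mem_nhds (mem_baseSet_trivializationAt F A x₀))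
  filter_upwards [hs] with p hp
  refine Eq.trans ?_ (affineMap_eq_sum (u p.proj : F →ᵃ[ℝ] ℝ) (trivializationAt F A x₀ p).2)
  change _ = u p.proj (trivializationAt F A x₀ p).2
  simp only [u, trivializationAt_apply F x₀ hp, fiberEquiv_apply]
  rw [← trivEquiv_apply _ p.proj hp p.snd, AffineEquiv.symm_apply_apply]
  rfl

/-- The restriction of an affine function to a fibre, as an element of the vector dual. -/
def fiberMap {a : TotalSpace F A → ℝ} (ha : IsAffineFunction 𝓘(ℝ, E) F A a) (x : M) :
    AffDual A x :=
  (ha.2 x).choose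

theorem fiberMap_apply {a : TotalSpace F A → ℝ} (ha : IsAffineFunction 𝓘(ℝ, E) F A a) (x : M)
    (y : A x) : (fiberMap ha x).toAffineMap y = a ⟨x, y⟩ :=
  ((ha.2 x).choose_spec y).symm

/-- The section of `A⁺` corresponding to an affine function on `A`. -/
def ofFunction (a : TotalSpace F A → ℝ) (ha : IsAffineFunction 𝓘(ℝ, E) F A a) :
    Cₛ^∞⟮𝓘(ℝ, E); F →ᴬ[ℝ] ℝ, AffDual A⟯ where
  toFun x := fiberMap ha x
  contMDiff_toFun := by
    intro x₀
    rw [contMDiffAt_section]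
    refine ContMDiffOn.contMDiffAt (s := (trivializationAt F A x₀).baseSet)
      (contMDiffOn_of_separating 𝓘(ℝ, E) (fun v : F => evalLinear v)
        (fun g hg => ContinuousAffineMap.ext fun v => hg v) fun v x hx => ?_)
      ((trivializationAt F A x₀).open_baseSet.mem_nhds (mem_baseSet_trivializationAt F A x₀))
    refine ((contMDiffAt_comp_trivialization_symm (trivializationAt F A x₀) ha.1 v
      hx).congr_of_eventuallyEq ?_).contMDiffWithinAt
    filter_upwards [(trivializationAt F A x₀).open_baseSet.mem_nhds hx] with y hy
    rw [trivializationAt_apply F x₀ hy, ← mk_trivEquiv_symm _ y hy]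
    exact fiberMap_apply ha y _

theorem toFunction_ofFunction {a : TotalSpace F A → ℝ} (ha : IsAffineFunction 𝓘(ℝ, E) F A a) :
    toFunction (ofFunction a ha) = a :=
  funext fun p => fiberMap_apply ha p.proj p.snd

theorem toFunction_injective :
    Function.Injective (toFunction : Cₛ^∞⟮𝓘(ℝ, E); F →ᴬ[ℝ] ℝ, AffDual A⟯ → _) := by
  intro s t h
  refine ContMDiffSection.ext fun x => AffineMap.ext fun y => ?_
  exact congrFun h ⟨x, y⟩

theorem toFunction_add (s t : Cₛ^∞⟮𝓘(ℝ, E); F →ᴬ[ℝ] ℝ, AffDual A⟯) :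
    toFunction (s + t) = fun p => toFunction s p + toFunction t p := rfl

theorem toFunction_zero :
    toFunction (0 : Cₛ^∞⟮𝓘(ℝ, E); F →ᴬ[ℝ] ℝ, AffDual A⟯) = fun _ => 0 := rfl

theorem toFunction_neg (s : Cₛ^∞⟮𝓘(ℝ, E); F →ᴬ[ℝ] ℝ, AffDual A⟯) :
    toFunction (-s) = fun p => -toFunction s p := rfl

theorem toFunction_const_smul (c : ℝ) (s : Cₛ^∞⟮𝓘(ℝ, E); F →ᴬ[ℝ] ℝ, AffDual A⟯) :
    toFunction (c • s) = fun p => c * toFunction s p := rfl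

theorem toFunction_smul (f : C^∞⟮𝓘(ℝ, E), M; 𝓘(ℝ, ℝ), ℝ⟯)
    (s : Cₛ^∞⟮𝓘(ℝ, E); F →ᴬ[ℝ] ℝ, AffDual A⟯) :
    toFunction (f • s) = fun p => f p.proj * toFunction s p := rfl

theorem toFunction_oneSection : toFunction (oneSection 𝓘(ℝ, E) F A) = fun _ => 1 := rfl

theorem exists_section_eq [T2Space M] (x : M) (α : AffDual A x) :
    ∃ s : Cₛ^∞⟮𝓘(ℝ, E); F →ᴬ[ℝ] ℝ, AffDual A⟯, s x = α := by
  have hx := mem_baseSet_trivializationAt F A x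
  let φ := trivEquiv (trivializationAt F A x) x hx
  refine ⟨ofFunction _ (isAffineFunction_localAffine F A x (fiberEquiv φ α)),
    AffineMap.ext fun y => ?_⟩
  have h := congrFun (toFunction_ofFunction (isAffineFunction_localAffine (E := E) F A x
    (fiberEquiv φ α))) ⟨x, y⟩
  refine h.trans ?_
  rw [localAffine_of_eq_one F A (bump_self F A x), fiberEquiv_apply, ← trivEquiv_apply _ x hx y,
    AffineEquiv.symm_apply_apply]
  rfl

end AffDual

/-- On an affine bundle of positive rank there are affine functions which are not constant on a
given fibre. -/
theorem eq_zero_of_mul_affine_const [T2Space M] (hrank : 0 < Module.finrank ℝ F) (x : M) (c : ℝ)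
    (h : ∀ a : TotalSpace F A → ℝ, IsAffineFunction 𝓘(ℝ, E) F A a → ∀ y y' : A x,
      c * a ⟨x, y⟩ = c * a ⟨x, y'⟩) : c = 0 := by
  have hx := mem_baseSet_trivializationAt F A x
  let φ := AffDual.trivEquiv (trivializationAt F A x) x hx
  let j : Fin (Module.finrank ℝ F) := ⟨0, hrank⟩
  have h1 := h _ (isAffineFunction_fiberCoord F A x j) (φ.symm (Module.finBasis ℝ F j))
    (φ.symm 0)
  have h2 : ∀ v, fiberCoord E F A x j ⟨x, φ.symm v⟩ = (Module.finBasis ℝ F).coord j v := fun v => by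
    rw [fiberCoord, localAffine_of_eq_one F A (bump_self F A x), fiberLinear_apply,
      ← AffDual.trivEquiv_apply _ x hx, AffineEquiv.apply_symm_apply]
  rw [h2, h2] at h1
  simpa using h1

end Sections

/-! ## From strongly-affine Jacobi structures to Lie algebroids -/

section JacobiToAlgebroid

variable {E : Type*} [NormedAddCommGroup E] [NormedSpace ℝ E] [FiniteDimensional ℝ E]
  {M : Type*} [TopologicalSpace M] [T2Space M] [ChartedSpace E M] [IsManifold 𝓘(ℝ, E) ∞ M]
  {F : Type*} [NormedAddCommGroup F] [NormedSpace ℝ F] [FiniteDimensional ℝ F]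
  {V : M → Type*} [∀ x, AddCommGroup (V x)] [∀ x, Module ℝ (V x)]
  {A : M → Type*} [∀ x, AddTorsor (V x) (A x)] [∀ x, TopologicalSpace (A x)]
  [TopologicalSpace (TotalSpace F A)] [FiberBundle F A] [AffineBundle F A]
  [SmoothFiberBundle 𝓘(ℝ, E) F A]

namespace JacobiStructure

section General

variable {G : Type*} [NormedAddCommGroup G] [NormedSpace ℝ G] [FiniteDimensional ℝ G]
  {H : Type*} [TopologicalSpace H] {I : ModelWithCorners ℝ G H}
  {N : Type*} [TopologicalSpace N] [ChartedSpace H N] [IsManifold I ∞ N]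

theorem bracket_one (J : JacobiStructure I N) (f : N → ℝ) :
    J.bracket f (fun _ => 1) = fun p => -1 * dirDeriv J.reeb f p := by
  funext p
  simp only [bracket, BivectorField.apply_const_right, dirDeriv_const]
  ring

theorem dirDeriv_hamiltonian (J : JacobiStructure I N) (f g : N → ℝ) (p : N) :
    dirDeriv (J.hamiltonian f) g p = J.bivector.apply f g p + f p * dirDeriv J.reeb g p := by
  have : FiniteDimensional ℝ (TangentSpace I p) := inferInstanceAs (FiniteDimensional ℝ G)
  have h : covector I g p (J.bivector.sharp p (mvfderiv I f p)) = J.bivector.apply f g p :=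
    Module.apply_evalEquiv_symm_apply ℝ (TangentSpace I p) (covector I g p)
      (J.bivector.toFun p (covector I f p))
  rw [dirDeriv_eq_covector, hamiltonian, map_add, map_smul, h]
  rfl

theorem dirDeriv_hamiltonian_eq_bracket (J : JacobiStructure I N) (f g : N → ℝ) (p : N) :
    dirDeriv (J.hamiltonian f) g p = J.bracket f g p + g p * dirDeriv J.reeb f p := by
  rw [dirDeriv_hamiltonian, bracket]
  ring

theorem hamiltonian_add (J : JacobiStructure I N) {f g : N → ℝ} {p : N}
    (hf : MDifferentiableAt I 𝓘(ℝ, ℝ) f p) (hg : MDifferentiableAt I 𝓘(ℝ, ℝ) g p) (h : N → ℝ) :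
    dirDeriv (J.hamiltonian fun q => f q + g q) h p
      = dirDeriv (J.hamiltonian f) h p + dirDeriv (J.hamiltonian g) h p := by
  simp only [dirDeriv_hamiltonian, BivectorField.apply_eq, covector_add hf hg, map_add,
    LinearMap.add_apply]
  ring

theorem hamiltonian_mul (J : JacobiStructure I N) {f g : N → ℝ} {p : N}
    (hf : MDifferentiableAt I 𝓘(ℝ, ℝ) f p) (hg : MDifferentiableAt I 𝓘(ℝ, ℝ) g p) (h : N → ℝ) :
    dirDeriv (J.hamiltonian fun q => f q * g q) h p
      = f p * dirDeriv (J.hamiltonian g) h p + g p * J.bivector.apply f h p := by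
  simp only [dirDeriv_hamiltonian, BivectorField.apply_eq, covector_mul hf hg, map_add, map_smul,
    LinearMap.add_apply, LinearMap.smul_apply, smul_eq_mul]
  ring

theorem bracket_add_right (J : JacobiStructure I N) (f : N → ℝ) {g h : N → ℝ} {p : N}
    (hg : MDifferentiableAt I 𝓘(ℝ, ℝ) g p) (hh : MDifferentiableAt I 𝓘(ℝ, ℝ) h p) :
    J.bracket f (fun q => g q + h q) p = J.bracket f g p + J.bracket f h p := by
  simp only [bracket, BivectorField.apply_eq, dirDeriv_eq_covector, covector_add hg hh, map_add,
    LinearMap.add_apply]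
  ring

theorem bracket_mul_right (J : JacobiStructure I N) (f : N → ℝ) {g h : N → ℝ} {p : N}
    (hg : MDifferentiableAt I 𝓘(ℝ, ℝ) g p) (hh : MDifferentiableAt I 𝓘(ℝ, ℝ) h p) :
    J.bracket f (fun q => g q * h q) p
      = g p * J.bracket f h p + dirDeriv (J.hamiltonian f) g p * h p := by
  rw [dirDeriv_hamiltonian]
  simp only [bracket, BivectorField.apply_eq, dirDeriv_eq_covector, covector_mul hg hh, map_add,
    map_smul, LinearMap.add_apply, LinearMap.smul_apply, smul_eq_mul]
  ring

theorem bracket_const_mul_right (J : JacobiStructure I N) (f : N → ℝ) (c : ℝ) {g : N → ℝ} {p : N}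
    (hg : MDifferentiableAt I 𝓘(ℝ, ℝ) g p) :
    J.bracket f (fun q => c * g q) p = c * J.bracket f g p := by
  rw [J.bracket_mul_right f mdifferentiableAt_const hg, dirDeriv_const]
  ring

theorem bracket_swap (J : JacobiStructure I N) (f g : N → ℝ) (p : N) :
    J.bracket f g p = - J.bracket g f p := by
  simp only [bracket, J.bivector.apply_swap f g]
  ring

theorem bracket_self (J : JacobiStructure I N) (f : N → ℝ) (p : N) : J.bracket f f p = 0 := by
  have := J.bracket_swap f f p
  linarith

theorem bracket_jacobi (J : JacobiStructure I N) {f g h : N → ℝ} {p : N}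
    (hf : ContMDiff I 𝓘(ℝ, ℝ) ∞ f) (hg : ContMDiff I 𝓘(ℝ, ℝ) ∞ g)
    (hh : ContMDiff I 𝓘(ℝ, ℝ) ∞ h)
    (hXf : MDifferentiableAt I 𝓘(ℝ, ℝ) (dirDeriv J.reeb f) p)
    (hXg : MDifferentiableAt I 𝓘(ℝ, ℝ) (dirDeriv J.reeb g) p)
    (hXh : MDifferentiableAt I 𝓘(ℝ, ℝ) (dirDeriv J.reeb h) p) :
    J.bracket f (J.bracket g h) p + J.bracket g (J.bracket h f) p
      + J.bracket h (J.bracket f g) p = 0 := by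
  refine (J.bivector.jacobiator_eq hf hg hh hXf hXg hXh).trans ?_
  rw [J.schouten_self f g h hf hg hh, J.schouten_reeb g h hg hh, J.schouten_reeb h f hh hf,
    J.schouten_reeb f g hf hg]
  ring

end General

variable {J : JacobiStructure (𝓘(ℝ, E).prod 𝓘(ℝ, F)) (TotalSpace F A)}
  {a b : TotalSpace F A → ℝ} {f g : M → ℝ}

namespace IsStronglyAffine

theorem isAffineFunction_reeb (hJ : J.IsStronglyAffine) (ha : IsAffineFunction 𝓘(ℝ, E) F A a) :
    IsAffineFunction 𝓘(ℝ, E) F A (dirDeriv J.reeb a) := by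
  have h := (hJ.1 a _ ha (IsAffineFunction.const 1)).const_mul (-1)
  rw [J.bracket_one] at h
  simpa using h

theorem reeb_const (hJ : J.IsStronglyAffine) (ha : IsAffineFunction 𝓘(ℝ, E) F A a) {x : M}
    (y y' : A x) : dirDeriv J.reeb a ⟨x, y⟩ = dirDeriv J.reeb a ⟨x, y'⟩ := by
  refine (hJ.isAffineFunction_reeb ha).eq_of_mul (fun b hb => ?_) y y'
  have h := (hJ.2 a ha b hb).sub (hJ.1 a b ha hb)
  simpa only [J.dirDeriv_hamiltonian_eq_bracket, add_sub_cancel_left] using h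

theorem hamiltonian_basic_const (hJ : J.IsStronglyAffine) (ha : IsAffineFunction 𝓘(ℝ, E) F A a)
    (hf : ContMDiff 𝓘(ℝ, E) 𝓘(ℝ, ℝ) ∞ f) {x : M} (y y' : A x) :
    dirDeriv (J.hamiltonian a) (fun p => f p.proj) ⟨x, y⟩
      = dirDeriv (J.hamiltonian a) (fun p => f p.proj) ⟨x, y'⟩ := by
  have hfA : IsAffineFunction 𝓘(ℝ, E) F A (fun p => f p.proj) := IsAffineFunction.basic hf
  refine (hJ.2 a ha _ hfA).eq_of_mul (fun b hb => ?_) y y'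
  have h := (hJ.2 a ha _ (hb.basic_mul hf)).sub ((hJ.2 a ha b hb).basic_mul hf)
  have e : ∀ p, dirDeriv (J.hamiltonian a) (fun p => f p.proj * b p) p
      = f p.proj * dirDeriv (J.hamiltonian a) b p
        + b p * dirDeriv (J.hamiltonian a) (fun p => f p.proj) p := fun p =>
    dirDeriv_mul _ (hfA.1.mdifferentiableAt' p) (hb.1.mdifferentiableAt' p)
  simpa only [e, add_sub_cancel_left] using h

theorem bivector_basic_eq_zero (hrank : 0 < Module.finrank ℝ F) (hJ : J.IsStronglyAffine)
    (hf : ContMDiff 𝓘(ℝ, E) 𝓘(ℝ, ℝ) ∞ f) (hg : ContMDiff 𝓘(ℝ, E) 𝓘(ℝ, ℝ) ∞ g)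
    (p : TotalSpace F A) :
    J.bivector.apply (fun p => f p.proj) (fun p => g p.proj) p = 0 := by
  have hfA : IsAffineFunction 𝓘(ℝ, E) F A (fun p => f p.proj) := IsAffineFunction.basic hf
  have hgA : IsAffineFunction 𝓘(ℝ, E) F A (fun p => g p.proj) := IsAffineFunction.basic hg
  obtain ⟨x, y₀⟩ := p
  have hconst : ∀ y, J.bivector.apply (fun p => f p.proj) (fun p => g p.proj) ⟨x, y⟩
      = J.bivector.apply (fun p => f p.proj) (fun p => g p.proj) ⟨x, y₀⟩ := fun y => by
    have h1 := hJ.hamiltonian_basic_const hfA hg y y₀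
    rw [dirDeriv_hamiltonian, dirDeriv_hamiltonian, hJ.reeb_const hgA y y₀] at h1
    exact add_right_cancel h1
  refine eq_zero_of_mul_affine_const (E := E) (F := F) (A := A) hrank x _ fun a ha y y' => ?_
  have h2 := hJ.hamiltonian_basic_const (ha.basic_mul hf) hg y y'
  rw [J.hamiltonian_mul (hfA.1.mdifferentiableAt' _) (ha.1.mdifferentiableAt' _),
    J.hamiltonian_mul (hfA.1.mdifferentiableAt' _) (ha.1.mdifferentiableAt' _),
    hJ.hamiltonian_basic_const ha hg y y', hconst y, hconst y'] at h2
  linarith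

end IsStronglyAffine

variable (J) in
/-- The projection to `M` of the hamiltonian vector field of a function on `A`, evaluated at a
chosen point of each fibre. -/
def baseField (a : TotalSpace F A → ℝ) (x : M) : TangentSpace 𝓘(ℝ, E) x :=
  mfderiv (𝓘(ℝ, E).prod 𝓘(ℝ, F)) 𝓘(ℝ, E) (π F A) ⟨x, Classical.arbitrary (A x)⟩
    (J.hamiltonian a ⟨x, Classical.arbitrary (A x)⟩)

theorem mvfderiv_comp_proj (hf : ContMDiff 𝓘(ℝ, E) 𝓘(ℝ, ℝ) ∞ f) (p : TotalSpace F A)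
    (v : TangentSpace (𝓘(ℝ, E).prod 𝓘(ℝ, F)) p) :
    mvfderiv (𝓘(ℝ, E).prod 𝓘(ℝ, F)) (fun q : TotalSpace F A => f q.proj) p v
      = mvfderiv 𝓘(ℝ, E) f p.proj (mfderiv (𝓘(ℝ, E).prod 𝓘(ℝ, F)) 𝓘(ℝ, E) (π F A) p v) :=
  mvfderiv_comp_apply p (hf.mdifferentiableAt' p.proj)
    ((contMDiffAt_proj A (n := ∞)).mdifferentiableAt (by simp)) v

theorem mvfderiv_baseField (hJ : J.IsStronglyAffine) (ha : IsAffineFunction 𝓘(ℝ, E) F A a)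
    (hf : ContMDiff 𝓘(ℝ, E) 𝓘(ℝ, ℝ) ∞ f) (p : TotalSpace F A) :
    mvfderiv 𝓘(ℝ, E) f p.proj (J.baseField a p.proj)
      = dirDeriv (J.hamiltonian a) (fun q => f q.proj) p := by
  refine Eq.trans ?_ (hJ.hamiltonian_basic_const ha hf (Classical.arbitrary (A p.proj)) p.snd)
  exact (mvfderiv_comp_proj (F := F) (A := A) hf ⟨p.proj, Classical.arbitrary (A p.proj)⟩ _).symm

theorem mvfderiv_baseField_eq (hJ : J.IsStronglyAffine) (ha : IsAffineFunction 𝓘(ℝ, E) F A a)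
    (hf : ContMDiff 𝓘(ℝ, E) 𝓘(ℝ, ℝ) ∞ f) (x : M) (y : A x) :
    mvfderiv 𝓘(ℝ, E) f x (J.baseField a x)
      = dirDeriv (J.hamiltonian a) (fun q => f q.proj) ⟨x, y⟩ :=
  mvfderiv_baseField hJ ha hf ⟨x, y⟩

theorem tangent_ext (F : Type*) [NormedAddCommGroup F] [NormedSpace ℝ F]
    [FiniteDimensional ℝ F] (A : M → Type*)
    [∀ x, TopologicalSpace (A x)] [TopologicalSpace (TotalSpace F A)] [FiberBundle F A]
    {x : M} {v w : TangentSpace 𝓘(ℝ, E) x}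
    (h : ∀ f : M → ℝ, ContMDiff 𝓘(ℝ, E) 𝓘(ℝ, ℝ) ∞ f →
      mvfderiv 𝓘(ℝ, E) f x v = mvfderiv 𝓘(ℝ, E) f x w) : v = w :=
  (isCoordFrame_baseCoord F A x).eq_of_mvfderiv_eq fun i => h _ (contMDiff_baseCoord F A x i)

theorem baseField_add (hJ : J.IsStronglyAffine) (ha : IsAffineFunction 𝓘(ℝ, E) F A a)
    (hb : IsAffineFunction 𝓘(ℝ, E) F A b) (x : M) :
    J.baseField (fun p => a p + b p) x = J.baseField a x + J.baseField b x := by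
  refine tangent_ext F A fun f hf => ?_
  let y := Classical.arbitrary (A x)
  rw [map_add, mvfderiv_baseField_eq hJ (ha.add hb) hf x y, mvfderiv_baseField_eq hJ ha hf x y,
    mvfderiv_baseField_eq hJ hb hf x y,
    J.hamiltonian_add (ha.1.mdifferentiableAt' _) (hb.1.mdifferentiableAt' _)]

theorem baseField_basic_mul (hrank : 0 < Module.finrank ℝ F) (hJ : J.IsStronglyAffine)
    (hf : ContMDiff 𝓘(ℝ, E) 𝓘(ℝ, ℝ) ∞ f) (ha : IsAffineFunction 𝓘(ℝ, E) F A a) (x : M) :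
    J.baseField (fun p => f p.proj * a p) x = f x • J.baseField a x := by
  refine tangent_ext F A fun g hg => ?_
  let y := Classical.arbitrary (A x)
  have hfA : IsAffineFunction 𝓘(ℝ, E) F A (fun p => f p.proj) := IsAffineFunction.basic hf
  rw [map_smul, mvfderiv_baseField_eq hJ (ha.basic_mul hf) hg x y,
    mvfderiv_baseField_eq hJ ha hg x y,
    J.hamiltonian_mul (hfA.1.mdifferentiableAt' _) (ha.1.mdifferentiableAt' _),
    hJ.bivector_basic_eq_zero hrank hf hg, mul_zero, add_zero]
  rfl

theorem baseField_zero (hJ : J.IsStronglyAffine) (x : M) : J.baseField (fun _ => 0) x = 0 := by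
  have h := baseField_add hJ (IsAffineFunction.const 0) (IsAffineFunction.const 0) x
  simpa using h

theorem baseField_sum (hJ : J.IsStronglyAffine) {ι : Type*} (s : Finset ι)
    {a : ι → TotalSpace F A → ℝ} (ha : ∀ i, IsAffineFunction 𝓘(ℝ, E) F A (a i)) (x : M) :
    J.baseField (fun p => ∑ i ∈ s, a i p) x = ∑ i ∈ s, J.baseField (a i) x := by
  classical
  induction s using Finset.induction_on with
  | empty => simpa using baseField_zero hJ x
  | insert i s hi ih =>
    simp only [Finset.sum_insert hi]
    rw [baseField_add hJ (ha i) (IsAffineFunction.sum s ha), ih]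

theorem baseField_eq_sum (hrank : 0 < Module.finrank ℝ F) (hJ : J.IsStronglyAffine)
    (ha : IsAffineFunction 𝓘(ℝ, E) F A a) {x₀ x : M} (hx : bump E F A x₀ x = 1) :
    J.baseField a x
      = affineCoeffZero E F A x₀ a x • J.baseField (fun p => bump E F A x₀ p.proj) x
        + ∑ j, affineCoeff E F A x₀ a j x • J.baseField (fiberCoord E F A x₀ j) x := by
  have hχ := contMDiff_bump (E := E) F A x₀
  have hχA : IsAffineFunction 𝓘(ℝ, E) F A (fun p => bump E F A x₀ p.proj) :=
    IsAffineFunction.basic hχ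
  have h0 := contMDiff_affineCoeffZero F A x₀ ha
  have hj := contMDiff_affineCoeff F A x₀ ha
  have h1 := congrArg (fun u => J.baseField u x) (funext (affine_decomposition F A x₀ ha))
  rw [baseField_basic_mul hrank hJ
      (f := fun x => bump E F A x₀ x * bump E F A x₀ x) (hχ.mul hχ) ha,
    baseField_add hJ (hχA.basic_mul h0) (IsAffineFunction.sum _ fun j =>
      (isAffineFunction_fiberCoord F A x₀ j).basic_mul (hj j)),
    baseField_basic_mul hrank hJ h0 hχA,
    baseField_sum hJ _ fun j => (isAffineFunction_fiberCoord F A x₀ j).basic_mul (hj j)] at h1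
  simp only [baseField_basic_mul hrank hJ (hj _) (isAffineFunction_fiberCoord F A x₀ _)] at h1
  simpa [hx] using h1

theorem contMDiff_baseField (hJ : J.IsStronglyAffine) (ha : IsAffineFunction 𝓘(ℝ, E) F A a) :
    ContMDiff 𝓘(ℝ, E) (𝓘(ℝ, E).prod 𝓘(ℝ, E)) ∞
      (fun x => TotalSpace.mk' E x (J.baseField a x)) := fun x₀ => by
  refine (isCoordFrame_baseCoord F A x₀).contMDiffAt_section fun i => ?_
  have hi := contMDiff_baseCoord F A x₀ i
  obtain ⟨g, hg, hg'⟩ := IsAffineFunction.exists_basic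
    (hJ.2 a ha _ (IsAffineFunction.basic hi)).1
    (fun x y y' => hJ.hamiltonian_basic_const ha hi y y')
  refine (hg x₀).congr_of_eventuallyEq (Filter.Eventually.of_forall fun x => ?_)
  exact (mvfderiv_baseField_eq hJ ha hi x (Classical.arbitrary (A x))).trans (hg' _)

end JacobiStructure

end JacobiToAlgebroid

section JacobiToAlgebroid

variable {E : Type*} [NormedAddCommGroup E] [NormedSpace ℝ E] [FiniteDimensional ℝ E]
  {M : Type*} [TopologicalSpace M] [T2Space M] [ChartedSpace E M] [IsManifold 𝓘(ℝ, E) ∞ M]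
  {F : Type*} [NormedAddCommGroup F] [NormedSpace ℝ F] [FiniteDimensional ℝ F]
  {V : M → Type*} [∀ x, AddCommGroup (V x)] [∀ x, Module ℝ (V x)]
  {A : M → Type*} [∀ x, AddTorsor (V x) (A x)] [∀ x, TopologicalSpace (A x)]
  [TopologicalSpace (TotalSpace F A)] [FiberBundle F A] [AffineBundle F A]
  [SmoothFiberBundle 𝓘(ℝ, E) F A]

namespace JacobiStructure

variable {J : JacobiStructure (𝓘(ℝ, E).prod 𝓘(ℝ, F)) (TotalSpace F A)}
  {a b : TotalSpace F A → ℝ} {f g : M → ℝ}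

theorem baseField_congr (hrank : 0 < Module.finrank ℝ F) (hJ : J.IsStronglyAffine)
    (ha : IsAffineFunction 𝓘(ℝ, E) F A a) (hb : IsAffineFunction 𝓘(ℝ, E) F A b) {x : M}
    (h : ∀ y : A x, a ⟨x, y⟩ = b ⟨x, y⟩) : J.baseField a x = J.baseField b x := by
  have e : ∀ v, a ((trivializationAt F A x).toOpenPartialHomeomorph.symm (x, v))
      = b ((trivializationAt F A x).toOpenPartialHomeomorph.symm (x, v)) := fun v => by
    rw [← AffDual.mk_trivEquiv_symm _ x (mem_baseSet_trivializationAt F A x), h]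
  rw [baseField_eq_sum hrank hJ ha (bump_self F A x),
    baseField_eq_sum hrank hJ hb (bump_self F A x)]
  simp only [affineCoeffZero, affineCoeff, e]

/-- The trivialization of the fibre of `A⁺` at `x` induced by the preferred trivialization
of `A` at `x`. -/
def _root_.AffDual.fiberEquivAt (x : M) : AffDual A x ≃ₗ[ℝ] (F →ᴬ[ℝ] ℝ) :=
  AffDual.fiberEquiv (AffDual.trivEquiv (trivializationAt F A x) x
    (mem_baseSet_trivializationAt F A x))

theorem _root_.AffDual.localAffine_fiberEquivAt (x : M) (α : AffDual A x) (y : A x) :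
    localAffine E F A x (AffDual.fiberEquivAt x α) ⟨x, y⟩ = α.toAffineMap y := by
  rw [localAffine_of_eq_one F A (bump_self F A x), AffDual.fiberEquivAt, AffDual.fiberEquiv_apply,
    ← AffDual.trivEquiv_apply _ x (mem_baseSet_trivializationAt F A x) y,
    AffineEquiv.symm_apply_apply]

/-- The anchor of the Lie algebroid of a strongly-affine Jacobi structure. -/
def anchor (hrank : 0 < Module.finrank ℝ F) (hJ : J.IsStronglyAffine) (x : M) :
    AffDual A x →ₗ[ℝ] TangentSpace 𝓘(ℝ, E) x where
  toFun α := J.baseField (localAffine E F A x (AffDual.fiberEquivAt x α)) x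
  map_add' α β := by
    rw [map_add, ← baseField_add hJ (isAffineFunction_localAffine F A x _)
      (isAffineFunction_localAffine F A x _)]
    congr 1
    funext p
    exact mul_add _ _ _
  map_smul' c α := by
    have := baseField_basic_mul hrank hJ (f := fun _ => c) contMDiff_const
      (isAffineFunction_localAffine F A x (AffDual.fiberEquivAt x α)) x
    rw [map_smul, RingHom.id_apply, ← this]
    congr 1
    funext p
    exact mul_left_comm _ _ _

theorem anchor_section (hrank : 0 < Module.finrank ℝ F) (hJ : J.IsStronglyAffine)
    (s : Cₛ^∞⟮𝓘(ℝ, E); F →ᴬ[ℝ] ℝ, AffDual A⟯) (x : M) :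
    anchor hrank hJ x (s x) = J.baseField (AffDual.toFunction s) x :=
  baseField_congr hrank hJ (isAffineFunction_localAffine F A x _)
    (AffDual.isAffineFunction_toFunction s) fun y => AffDual.localAffine_fiberEquivAt x (s x) y

theorem contMDiff_anchor (hrank : 0 < Module.finrank ℝ F) (hJ : J.IsStronglyAffine) :
    ContMDiff (𝓘(ℝ, E).prod 𝓘(ℝ, F →ᴬ[ℝ] ℝ)) 𝓘(ℝ, E).tangent ∞
      (fun w : TotalSpace (F →ᴬ[ℝ] ℝ) (AffDual A) =>
        (⟨w.proj, anchor hrank hJ w.proj w.snd⟩ : TangentBundle 𝓘(ℝ, E) M)) := by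
  intro w₀
  set x₀ := w₀.proj with hx₀
  let u : TotalSpace (F →ᴬ[ℝ] ℝ) (AffDual A) → F →ᴬ[ℝ] ℝ := fun w =>
    (trivializationAt (F →ᴬ[ℝ] ℝ) (AffDual A) x₀ w).2
  let T : ∀ x : M, TangentSpace 𝓘(ℝ, E) x → E := fun x v =>
    (trivializationAt E (TangentSpace 𝓘(ℝ, E)) x₀ ⟨x, v⟩).2
  have hproj : ContMDiffAt (𝓘(ℝ, E).prod 𝓘(ℝ, F →ᴬ[ℝ] ℝ)) 𝓘(ℝ, E) ∞
      (fun w : TotalSpace (F →ᴬ[ℝ] ℝ) (AffDual A) => w.proj) w₀ := contMDiffAt_proj _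
  have hu : ContMDiffAt (𝓘(ℝ, E).prod 𝓘(ℝ, F →ᴬ[ℝ] ℝ)) 𝓘(ℝ, F →ᴬ[ℝ] ℝ) ∞ u w₀ :=
    (contMDiffAt_totalSpace.1
      (contMDiffAt_id (I := 𝓘(ℝ, E).prod 𝓘(ℝ, F →ᴬ[ℝ] ℝ)) (x := w₀))).2
  have huv : ∀ v : F, ContMDiffAt (𝓘(ℝ, E).prod 𝓘(ℝ, F →ᴬ[ℝ] ℝ)) 𝓘(ℝ, ℝ) ∞
      (fun w => u w v) w₀ := fun v =>
    ((AffDual.contDiff_evalLinear v).contMDiff _).comp w₀ hu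
  have hT : ∀ c : TotalSpace F A → ℝ, IsAffineFunction 𝓘(ℝ, E) F A c →
      ContMDiffAt (𝓘(ℝ, E).prod 𝓘(ℝ, F →ᴬ[ℝ] ℝ)) 𝓘(ℝ, E) ∞
        (fun w : TotalSpace (F →ᴬ[ℝ] ℝ) (AffDual A) => T w.proj (J.baseField c w.proj)) w₀ :=
    fun c hc => ContMDiffAt.comp w₀ (g := fun x => T x (J.baseField c x))
      ((contMDiffAt_section x₀).1 (contMDiff_baseField hJ hc x₀)) hproj
  refine contMDiffAt_totalSpace.2 ⟨hproj, ?_⟩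
  have hχA : IsAffineFunction 𝓘(ℝ, E) F A (fun p => bump E F A x₀ p.proj) :=
    IsAffineFunction.basic (contMDiff_bump F A x₀)
  have key : ContMDiffAt (𝓘(ℝ, E).prod 𝓘(ℝ, F →ᴬ[ℝ] ℝ)) 𝓘(ℝ, E) ∞
      (fun w : TotalSpace (F →ᴬ[ℝ] ℝ) (AffDual A) =>
        u w 0 • T w.proj (J.baseField (fun p => bump E F A x₀ p.proj) w.proj)
        + ∑ j, (u w (Module.finBasis ℝ F j) - u w 0)
          • T w.proj (J.baseField (fiberCoord E F A x₀ j) w.proj)) w₀ :=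
    ((huv 0).smul (hT _ hχA)).add (ContMDiffAt.sum fun j _ =>
      ((huv _).sub (huv 0)).smul (hT _ (isAffineFunction_fiberCoord F A x₀ j)))
  refine key.congr_of_eventuallyEq ?_
  have h1 : ∀ᶠ w : TotalSpace (F →ᴬ[ℝ] ℝ) (AffDual A) in 𝓝 w₀, bump E F A x₀ w.proj = 1 :=
    (FiberBundle.continuous_proj _ _).continuousAt.eventually (bump_eventuallyEq_one F A x₀)
  have h2 : ∀ᶠ w : TotalSpace (F →ᴬ[ℝ] ℝ) (AffDual A) in 𝓝 w₀,
      w.proj ∈ (trivializationAt F A x₀).baseSet :=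
    (FiberBundle.continuous_proj _ _).continuousAt.eventually
      ((trivializationAt F A x₀).open_baseSet.mem_nhds (mem_baseSet_trivializationAt F A x₀))
  have h3 : ∀ᶠ w : TotalSpace (F →ᴬ[ℝ] ℝ) (AffDual A) in 𝓝 w₀,
      w.proj ∈ (trivializationAt E (TangentSpace 𝓘(ℝ, E) : M → Type _) x₀).baseSet :=
    (FiberBundle.continuous_proj _ _).continuousAt.eventually
      ((trivializationAt E (TangentSpace 𝓘(ℝ, E)) x₀).open_baseSet.mem_nhds
        (mem_baseSet_trivializationAt E (TangentSpace 𝓘(ℝ, E)) x₀))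
  filter_upwards [h1, h2, h3] with w hw1 hw2 hw3
  obtain ⟨x, α⟩ := w
  obtain ⟨s, hs⟩ := AffDual.exists_section_eq (E := E) (F := F) x α
  have hTlin : IsLinearMap ℝ (T x) :=
    (trivializationAt E (TangentSpace 𝓘(ℝ, E)) x₀).linear ℝ hw3
  have hval : ∀ v, AffDual.toFunction s
      ((trivializationAt F A x₀).toOpenPartialHomeomorph.symm (x, v)) = u ⟨x, α⟩ v := fun v => by
    rw [← AffDual.mk_trivEquiv_symm _ x hw2]
    simp only [u]
    rw [AffDual.trivializationAt_apply F x₀ hw2, AffDual.fiberEquiv_apply, ← hs]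
    rfl
  have hanchor : anchor hrank hJ x α
      = u ⟨x, α⟩ 0 • J.baseField (fun p => bump E F A x₀ p.proj) x
        + ∑ j, (u ⟨x, α⟩ (Module.finBasis ℝ F j) - u ⟨x, α⟩ 0)
          • J.baseField (fiberCoord E F A x₀ j) x := by
    have hw1' : bump E F A x₀ x = 1 := hw1
    rw [← hs, anchor_section, baseField_eq_sum hrank hJ
      (AffDual.isAffineFunction_toFunction s) hw1']
    simp only [affineCoeffZero, affineCoeff, hval, hw1', one_mul, hs]
  change T x (anchor hrank hJ x α) = _
  rw [hanchor]
  change hTlin.mk' _ _ = _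
  rw [map_add, map_smul, map_sum]
  simp only [map_smul]
  rfl

variable (J) in
/-- The bracket on sections of `A⁺` given by an affine Jacobi structure. -/
def sectionBracket (hJ : J.IsAffine) (s t : Cₛ^∞⟮𝓘(ℝ, E); F →ᴬ[ℝ] ℝ, AffDual A⟯) :
    Cₛ^∞⟮𝓘(ℝ, E); F →ᴬ[ℝ] ℝ, AffDual A⟯ :=
  AffDual.ofFunction (J.bracket (AffDual.toFunction s) (AffDual.toFunction t))
    (hJ _ _ (AffDual.isAffineFunction_toFunction s) (AffDual.isAffineFunction_toFunction t))

theorem toFunction_sectionBracket (hJ : J.IsAffine)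
    (s t : Cₛ^∞⟮𝓘(ℝ, E); F →ᴬ[ℝ] ℝ, AffDual A⟯) :
    AffDual.toFunction (J.sectionBracket hJ s t)
      = J.bracket (AffDual.toFunction s) (AffDual.toFunction t) :=
  AffDual.toFunction_ofFunction _

theorem sectionBracket_swap (hJ : J.IsAffine) (s t : Cₛ^∞⟮𝓘(ℝ, E); F →ᴬ[ℝ] ℝ, AffDual A⟯) :
    J.sectionBracket hJ s t = - J.sectionBracket hJ t s := by
  refine AffDual.toFunction_injective ?_
  rw [AffDual.toFunction_neg, toFunction_sectionBracket, toFunction_sectionBracket]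
  exact funext fun p => J.bracket_swap _ _ p

theorem sectionBracket_add (hJ : J.IsAffine) (s t t' : Cₛ^∞⟮𝓘(ℝ, E); F →ᴬ[ℝ] ℝ, AffDual A⟯) :
    J.sectionBracket hJ s (t + t') = J.sectionBracket hJ s t + J.sectionBracket hJ s t' := by
  refine AffDual.toFunction_injective ?_
  rw [AffDual.toFunction_add]
  simp only [toFunction_sectionBracket, AffDual.toFunction_add]
  exact funext fun p => J.bracket_add_right _
    ((AffDual.isAffineFunction_toFunction t).1.mdifferentiableAt' p)
    ((AffDual.isAffineFunction_toFunction t').1.mdifferentiableAt' p)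

theorem sectionBracket_smul (hJ : J.IsAffine) (c : ℝ)
    (s t : Cₛ^∞⟮𝓘(ℝ, E); F →ᴬ[ℝ] ℝ, AffDual A⟯) :
    J.sectionBracket hJ s (c • t) = c • J.sectionBracket hJ s t := by
  refine AffDual.toFunction_injective ?_
  rw [AffDual.toFunction_const_smul]
  simp only [toFunction_sectionBracket, AffDual.toFunction_const_smul]
  exact funext fun p => J.bracket_const_mul_right _ c
    ((AffDual.isAffineFunction_toFunction t).1.mdifferentiableAt' p)

/-- The Lie algebroid structure on `A⁺` given by a strongly-affine Jacobi structure. -/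
def toLieAlgebroid (hrank : 0 < Module.finrank ℝ F) (hJ : J.IsStronglyAffine) :
    LieAlgebroid 𝓘(ℝ, E) (F →ᴬ[ℝ] ℝ) (AffDual A) where
  bracket := LinearMap.mk₂ ℝ (J.sectionBracket hJ.1)
    (fun s s' t => by
      rw [sectionBracket_swap, sectionBracket_add, sectionBracket_swap hJ.1 s,
        sectionBracket_swap hJ.1 s', neg_add])
    (fun c s t => by
      rw [sectionBracket_swap, sectionBracket_smul, sectionBracket_swap hJ.1 s, smul_neg])
    (sectionBracket_add hJ.1) (fun c s t => sectionBracket_smul hJ.1 c s t)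
  anchor := anchor hrank hJ
  bracket_self s := by
    refine AffDual.toFunction_injective ?_
    rw [LinearMap.mk₂_apply, toFunction_sectionBracket]
    exact funext fun p => J.bracket_self _ p
  jacobi s t r := by
    refine AffDual.toFunction_injective ?_
    simp only [LinearMap.mk₂_apply, AffDual.toFunction_add, toFunction_sectionBracket]
    have h := AffDual.isAffineFunction_toFunction (E := E) (F := F) (A := A)
    exact funext fun p => J.bracket_jacobi (h s).1 (h t).1 (h r).1
      ((hJ.isAffineFunction_reeb (h s)).1.mdifferentiableAt' p)
      ((hJ.isAffineFunction_reeb (h t)).1.mdifferentiableAt' p)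
      ((hJ.isAffineFunction_reeb (h r)).1.mdifferentiableAt' p)
  anchor_smooth := contMDiff_anchor hrank hJ
  leibniz s t f x := by
    refine AffineMap.ext fun y => ?_
    have h := AffDual.isAffineFunction_toFunction (E := E) (F := F) (A := A)
    rw [anchor_section, mvfderiv_baseField_eq hJ (h s) f.contMDiff x y]
    refine (congrFun (toFunction_sectionBracket hJ.1 s (f • t)) ⟨x, y⟩).trans ?_
    rw [AffDual.toFunction_smul, J.bracket_mul_right _
      ((IsAffineFunction.basic (A := A) (F := F) f.contMDiff).1.mdifferentiableAt' _)
      ((h t).1.mdifferentiableAt' _), ← toFunction_sectionBracket hJ.1]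
    rfl

theorem toFunction_toLieAlgebroid_bracket (hrank : 0 < Module.finrank ℝ F)
    (hJ : J.IsStronglyAffine) (s t : Cₛ^∞⟮𝓘(ℝ, E); F →ᴬ[ℝ] ℝ, AffDual A⟯) :
    AffDual.toFunction ((toLieAlgebroid hrank hJ).bracket s t)
      = J.bracket (AffDual.toFunction s) (AffDual.toFunction t) :=
  toFunction_sectionBracket hJ.1 s t

theorem isAlmostSpecial_toLieAlgebroid (hrank : 0 < Module.finrank ℝ F)
    (hJ : J.IsStronglyAffine) :
    (toLieAlgebroid hrank hJ).IsAlmostSpecial (AffDual.oneSection 𝓘(ℝ, E) F A) := by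
  intro s Z hZ
  obtain ⟨f, rfl⟩ := Submodule.mem_span_singleton.1 hZ
  have hs := AffDual.isAffineFunction_toFunction s
  have hfA : IsAffineFunction 𝓘(ℝ, E) F A (fun p => f p.proj) :=
    IsAffineFunction.basic f.contMDiff
  have e : AffDual.toFunction (f • AffDual.oneSection 𝓘(ℝ, E) F A) = fun p => f p.proj := by
    rw [AffDual.toFunction_smul, AffDual.toFunction_oneSection]
    simp only [mul_one]
  have hb := toFunction_toLieAlgebroid_bracket hrank hJ s (f • AffDual.oneSection 𝓘(ℝ, E) F A)
  rw [e] at hb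
  obtain ⟨g, hg, hg'⟩ := IsAffineFunction.exists_basic (hJ.1 _ _ hs hfA).1 fun x y y' => by
    have h1 := hJ.hamiltonian_basic_const hs f.contMDiff y y'
    rw [J.dirDeriv_hamiltonian_eq_bracket, J.dirDeriv_hamiltonian_eq_bracket,
      hJ.reeb_const hs y y'] at h1
    exact add_right_cancel h1
  let g' : C^∞⟮𝓘(ℝ, E), M; 𝓘(ℝ, ℝ), ℝ⟯ := ⟨g, hg⟩
  refine Submodule.mem_span_singleton.2 ⟨g', AffDual.toFunction_injective ?_⟩
  rw [hb]
  exact funext fun p => (mul_one _).trans (hg' p).symm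

end JacobiStructure

end JacobiToAlgebroid

/-! ## From almost-special Lie algebroids to Jacobi structures -/

section AlgebroidToJacobi

variable {E : Type*} [NormedAddCommGroup E] [NormedSpace ℝ E] [FiniteDimensional ℝ E]
  {M : Type*} [TopologicalSpace M] [T2Space M] [ChartedSpace E M] [IsManifold 𝓘(ℝ, E) ∞ M]
  {F : Type*} [NormedAddCommGroup F] [NormedSpace ℝ F] [FiniteDimensional ℝ F]
  {V : M → Type*} [∀ x, AddCommGroup (V x)] [∀ x, Module ℝ (V x)]
  {A : M → Type*} [∀ x, AddTorsor (V x) (A x)] [∀ x, TopologicalSpace (A x)]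
  [TopologicalSpace (TotalSpace F A)] [FiberBundle F A] [AffineBundle F A]
  [SmoothFiberBundle 𝓘(ℝ, E) F A]

namespace AffDual

variable (E F A) in
/-- The sections of `A⁺` corresponding to the local affine coordinates. -/
def coordSection (x₀ : M) (k : Fin (Module.finrank ℝ E) ⊕ Fin (Module.finrank ℝ F)) :
    Cₛ^∞⟮𝓘(ℝ, E); F →ᴬ[ℝ] ℝ, AffDual A⟯ :=
  ofFunction _ (isAffineFunction_affineCoord F A x₀ k)

theorem toFunction_coordSection (x₀ : M)
    (k : Fin (Module.finrank ℝ E) ⊕ Fin (Module.finrank ℝ F)) :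
    toFunction (coordSection E F A x₀ k) = affineCoord E F A x₀ k :=
  toFunction_ofFunction _

theorem mdifferentiableAt_toFunction (s : Cₛ^∞⟮𝓘(ℝ, E); F →ᴬ[ℝ] ℝ, AffDual A⟯)
    (p : TotalSpace F A) :
    MDifferentiableAt (𝓘(ℝ, E).prod 𝓘(ℝ, F)) 𝓘(ℝ, ℝ) (toFunction s) p :=
  (isAffineFunction_toFunction s).1.mdifferentiableAt' p

/-- The differential at `p` of the affine function corresponding to a section. -/
def differentialAt (p : TotalSpace F A) : Cₛ^∞⟮𝓘(ℝ, E); F →ᴬ[ℝ] ℝ, AffDual A⟯ →ₗ[ℝ]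
    Module.Dual ℝ (TangentSpace (𝓘(ℝ, E).prod 𝓘(ℝ, F)) p) where
  toFun s := covector (𝓘(ℝ, E).prod 𝓘(ℝ, F)) (toFunction s) p
  map_add' s t := by
    rw [toFunction_add,
      covector_add (mdifferentiableAt_toFunction s p) (mdifferentiableAt_toFunction t p)]
  map_smul' c s := by
    rw [toFunction_const_smul,
      covector_mul mdifferentiableAt_const (mdifferentiableAt_toFunction s p), covector_const]
    simp

theorem differentialAt_apply (p : TotalSpace F A)
    (s : Cₛ^∞⟮𝓘(ℝ, E); F →ᴬ[ℝ] ℝ, AffDual A⟯) :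
    differentialAt p s = covector (𝓘(ℝ, E).prod 𝓘(ℝ, F)) (toFunction s) p := rfl

theorem differentialAt_coordSection (p : TotalSpace F A)
    (k : Fin (Module.finrank ℝ E) ⊕ Fin (Module.finrank ℝ F))
    (v : TangentSpace (𝓘(ℝ, E).prod 𝓘(ℝ, F)) p) :
    differentialAt p (coordSection E F A p.proj k) v
      = (tangentBasis (𝓘(ℝ, E).prod 𝓘(ℝ, F)) (totalBasis E F) p).coord k v := by
  rw [differentialAt_apply, toFunction_coordSection]
  exact (isCoordFrame_affineCoord F A p).mvfderiv_self k v

theorem eq_sum_differentialAt (p : TotalSpace F A)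
    (α : Module.Dual ℝ (TangentSpace (𝓘(ℝ, E).prod 𝓘(ℝ, F)) p)) :
    α = ∑ k, α (tangentBasis (𝓘(ℝ, E).prod 𝓘(ℝ, F)) (totalBasis E F) p k)
      • differentialAt p (coordSection E F A p.proj k) := by
  simp only [differentialAt_apply, toFunction_coordSection]
  exact (isCoordFrame_affineCoord F A p).eq_sum_dual α

theorem differentialAt_surjective (p : TotalSpace F A) :
    Function.Surjective (differentialAt (E := E) p) := fun α =>
  ⟨∑ k, α (tangentBasis (𝓘(ℝ, E).prod 𝓘(ℝ, F)) (totalBasis E F) p k)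
      • coordSection E F A p.proj k, by
    rw [map_sum]
    simp only [map_smul]
    exact (eq_sum_differentialAt p α).symm⟩

theorem differentialAt_smul (p : TotalSpace F A) (f : C^∞⟮𝓘(ℝ, E), M; 𝓘(ℝ, ℝ), ℝ⟯)
    (s : Cₛ^∞⟮𝓘(ℝ, E); F →ᴬ[ℝ] ℝ, AffDual A⟯)
    (v : TangentSpace (𝓘(ℝ, E).prod 𝓘(ℝ, F)) p) :
    differentialAt p (f • s) v = f p.proj * differentialAt p s v
      + toFunction s p * mvfderiv 𝓘(ℝ, E) f p.proj
        (mfderiv (𝓘(ℝ, E).prod 𝓘(ℝ, F)) 𝓘(ℝ, E) (π F A) p v) := by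
  rw [differentialAt_apply, toFunction_smul, covector_mul
    ((IsAffineFunction.basic (A := A) (F := F) f.contMDiff).1.mdifferentiableAt' p)
    (mdifferentiableAt_toFunction s p), ← JacobiStructure.mvfderiv_comp_proj f.contMDiff]
  rfl

/-- A functional on sections of `A⁺` which is `C^∞(M)`-linear at `x` vanishes as soon as it
vanishes on an affine frame. -/
theorem eq_zero_of_frame (x : M) (D : Cₛ^∞⟮𝓘(ℝ, E); F →ᴬ[ℝ] ℝ, AffDual A⟯ →ₗ[ℝ] ℝ)
    (hD : ∀ (f : C^∞⟮𝓘(ℝ, E), M; 𝓘(ℝ, ℝ), ℝ⟯) s, D (f • s) = f x * D s)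
    (hone : D (oneSection 𝓘(ℝ, E) F A) = 0)
    (hfib : ∀ j, D (coordSection E F A x (Sum.inr j)) = 0)
    (s : Cₛ^∞⟮𝓘(ℝ, E); F →ᴬ[ℝ] ℝ, AffDual A⟯) : D s = 0 := by
  have hs := isAffineFunction_toFunction s
  let χ : C^∞⟮𝓘(ℝ, E), M; 𝓘(ℝ, ℝ), ℝ⟯ := ⟨bump E F A x, contMDiff_bump F A x⟩
  let c₀ : C^∞⟮𝓘(ℝ, E), M; 𝓘(ℝ, ℝ), ℝ⟯ :=
    ⟨affineCoeffZero E F A x (toFunction s), contMDiff_affineCoeffZero F A x hs⟩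
  let c : Fin (Module.finrank ℝ F) → C^∞⟮𝓘(ℝ, E), M; 𝓘(ℝ, ℝ), ℝ⟯ := fun j =>
    ⟨affineCoeff E F A x (toFunction s) j, contMDiff_affineCoeff F A x hs j⟩
  have hsum : ∀ (t : Finset (Fin (Module.finrank ℝ F))) (p : TotalSpace F A),
      toFunction (∑ j ∈ t, c j • coordSection E F A x (Sum.inr j)) p
        = ∑ j ∈ t, c j p.proj * fiberCoord E F A x j p := by
    classical
    intro t p
    induction t using Finset.induction_on with
    | empty => rfl
    | insert j t hj ih =>
      rw [Finset.sum_insert hj, Finset.sum_insert hj, toFunction_add]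
      beta_reduce
      rw [ih, toFunction_smul, toFunction_coordSection]
      rfl
  have hdec : χ • χ • s = c₀ • χ • oneSection 𝓘(ℝ, E) F A
      + ∑ j, c j • coordSection E F A x (Sum.inr j) := by
    refine toFunction_injective (funext fun p => ?_)
    rw [toFunction_add]
    beta_reduce
    rw [hsum]
    have := affine_decomposition F A x hs p
    rw [mul_assoc] at this
    refine this.trans ?_
    simp only [toFunction_smul, toFunction_oneSection, mul_one]
    rfl
  have hχ : χ x = 1 := bump_self F A x
  have h := congrArg D hdec
  rw [map_add, map_sum, hD, hD, hD, hD, hone, hχ] at h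
  simp only [hD, hfib] at h
  simpa using h

/-- A functional on the sections of `A⁺` which satisfies a Leibniz rule at `p` and annihilates
constants is given by a tangent vector of `A`. -/
theorem exists_tangent (p : TotalSpace F A) (w : TangentSpace 𝓘(ℝ, E) p.proj)
    (D : Cₛ^∞⟮𝓘(ℝ, E); F →ᴬ[ℝ] ℝ, AffDual A⟯ →ₗ[ℝ] ℝ)
    (hD : ∀ (f : C^∞⟮𝓘(ℝ, E), M; 𝓘(ℝ, ℝ), ℝ⟯) s,
      D (f • s) = f p.proj * D s + toFunction s p * mvfderiv 𝓘(ℝ, E) f p.proj w)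
    (hone : D (oneSection 𝓘(ℝ, E) F A) = 0) :
    ∃ v : TangentSpace (𝓘(ℝ, E).prod 𝓘(ℝ, F)) p, ∀ s, D s = differentialAt p s v := by
  let e := tangentBasis (𝓘(ℝ, E).prod 𝓘(ℝ, F)) (totalBasis E F) p
  let v : TangentSpace (𝓘(ℝ, E).prod 𝓘(ℝ, F)) p :=
    e.equivFun.symm fun k => D (coordSection E F A p.proj k)
  have hv : ∀ k, differentialAt p (coordSection E F A p.proj k) v
      = D (coordSection E F A p.proj k) := fun k => by
    rw [differentialAt_coordSection]
    change e.coord k (e.equivFun.symm _) = _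
    rw [Module.Basis.coord_equivFun_symm]
  have hone' : differentialAt p (oneSection 𝓘(ℝ, E) F A) = 0 := by
    rw [differentialAt_apply, toFunction_oneSection, covector_const]
  have hw : mfderiv (𝓘(ℝ, E).prod 𝓘(ℝ, F)) 𝓘(ℝ, E) (π F A) p v = w := by
    refine (isCoordFrame_baseCoord F A p.proj).eq_of_mvfderiv_eq fun i => ?_
    let f : C^∞⟮𝓘(ℝ, E), M; 𝓘(ℝ, ℝ), ℝ⟯ :=
      ⟨baseCoord E F A p.proj i, contMDiff_baseCoord F A p.proj i⟩
    have hf : coordSection E F A p.proj (Sum.inl i) = f • oneSection 𝓘(ℝ, E) F A := by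
      refine toFunction_injective ?_
      rw [toFunction_coordSection, toFunction_smul, toFunction_oneSection]
      exact funext fun q => (mul_one _).symm
    have h := hv (Sum.inl i)
    rw [hf, differentialAt_smul, hD, hone, hone', toFunction_oneSection] at h
    have h' : mvfderiv 𝓘(ℝ, E) f p.proj
        (mfderiv (𝓘(ℝ, E).prod 𝓘(ℝ, F)) 𝓘(ℝ, E) (π F A) p v) = mvfderiv 𝓘(ℝ, E) f p.proj w := by
      simpa using h
    exact h'
  refine ⟨v, fun s => ?_⟩
  have key := eq_zero_of_frame p.proj
    (D - ((LinearMap.applyₗ v).comp (differentialAt p) :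
      Cₛ^∞⟮𝓘(ℝ, E); F →ᴬ[ℝ] ℝ, AffDual A⟯ →ₗ[ℝ] ℝ)) (fun f s => ?_) ?_ (fun j => ?_) s
  · exact sub_eq_zero.1 key
  · change D (f • s) - differentialAt p (f • s) v = f p.proj * (D s - differentialAt p s v)
    rw [hD, differentialAt_smul, hw]
    ring
  · change D _ - differentialAt p _ v = 0
    rw [hone, hone']
    exact sub_zero _
  · change D _ - differentialAt p _ v = 0
    rw [hv, sub_self]

end AffDual

end AlgebroidToJacobi

section AlgebroidToJacobi

variable {E : Type*} [NormedAddCommGroup E] [NormedSpace ℝ E] [FiniteDimensional ℝ E]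
  {M : Type*} [TopologicalSpace M] [T2Space M] [ChartedSpace E M] [IsManifold 𝓘(ℝ, E) ∞ M]
  {F : Type*} [NormedAddCommGroup F] [NormedSpace ℝ F] [FiniteDimensional ℝ F]
  {V : M → Type*} [∀ x, AddCommGroup (V x)] [∀ x, Module ℝ (V x)]
  {A : M → Type*} [∀ x, AddTorsor (V x) (A x)] [∀ x, TopologicalSpace (A x)]
  [TopologicalSpace (TotalSpace F A)] [FiberBundle F A] [AffineBundle F A]
  [SmoothFiberBundle 𝓘(ℝ, E) F A]

namespace LieAlgebroid

open AffDual

variable (L : LieAlgebroid 𝓘(ℝ, E) (F →ᴬ[ℝ] ℝ) (AffDual A))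

theorem bracket_swap (s t : Cₛ^∞⟮𝓘(ℝ, E); F →ᴬ[ℝ] ℝ, AffDual A⟯) :
    L.bracket s t = - L.bracket t s := by
  have h := L.bracket_self (s + t)
  rw [map_add, map_add, LinearMap.add_apply, LinearMap.add_apply, L.bracket_self,
    L.bracket_self, zero_add, add_zero] at h
  exact eq_neg_of_add_eq_zero_right h

theorem toFunction_bracket_smul (s t : Cₛ^∞⟮𝓘(ℝ, E); F →ᴬ[ℝ] ℝ, AffDual A⟯)
    (f : C^∞⟮𝓘(ℝ, E), M; 𝓘(ℝ, ℝ), ℝ⟯) (p : TotalSpace F A) :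
    toFunction (L.bracket s (f • t)) p = f p.proj * toFunction (L.bracket s t) p
      + mvfderiv 𝓘(ℝ, E) f p.proj (L.anchor p.proj (s p.proj)) * toFunction t p := by
  have h := L.leibniz s t f p.proj
  exact congrArg (fun α : AffDual A p.proj => α.toAffineMap p.snd) h

/-- The section `-⟦s, 1⟧` of `A⁺`; for `s = ã` it corresponds to the function `E(a)`. -/
def reebSection (s : Cₛ^∞⟮𝓘(ℝ, E); F →ᴬ[ℝ] ℝ, AffDual A⟯) :
    Cₛ^∞⟮𝓘(ℝ, E); F →ᴬ[ℝ] ℝ, AffDual A⟯ :=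
  L.bracket (oneSection 𝓘(ℝ, E) F A) s

theorem bracket_one (s : Cₛ^∞⟮𝓘(ℝ, E); F →ᴬ[ℝ] ℝ, AffDual A⟯) :
    L.bracket s (oneSection 𝓘(ℝ, E) F A) = - L.reebSection s :=
  L.bracket_swap _ _

variable {L}

theorem IsAlmostSpecial.exists_reebSection (hL : L.IsAlmostSpecial (oneSection 𝓘(ℝ, E) F A))
    (s : Cₛ^∞⟮𝓘(ℝ, E); F →ᴬ[ℝ] ℝ, AffDual A⟯) :
    ∃ f : C^∞⟮𝓘(ℝ, E), M; 𝓘(ℝ, ℝ), ℝ⟯, ∀ p, toFunction (L.reebSection s) p = f p.proj := by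
  obtain ⟨f, hf⟩ := Submodule.mem_span_singleton.1
    (hL s _ (Submodule.mem_span_singleton_self (oneSection 𝓘(ℝ, E) F A)))
  refine ⟨-f, fun p => ?_⟩
  rw [← neg_neg (L.reebSection s), ← L.bracket_one, ← hf, toFunction_neg, toFunction_smul,
    toFunction_oneSection]
  exact congrArg Neg.neg (mul_one _)

theorem IsAlmostSpecial.anchor_one (hrank : 0 < Module.finrank ℝ F)
    (hL : L.IsAlmostSpecial (oneSection 𝓘(ℝ, E) F A)) (f : C^∞⟮𝓘(ℝ, E), M; 𝓘(ℝ, ℝ), ℝ⟯) (x : M) :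
    mvfderiv 𝓘(ℝ, E) f x (L.anchor x (oneSection 𝓘(ℝ, E) F A x)) = 0 := by
  refine eq_zero_of_mul_affine_const (E := E) (F := F) (A := A) hrank x _ fun a ha y y' => ?_
  obtain ⟨g, hg⟩ := hL.exists_reebSection (ofFunction a ha)
  obtain ⟨g', hg'⟩ := hL.exists_reebSection (f • ofFunction a ha)
  have h1 := L.toFunction_bracket_smul (oneSection 𝓘(ℝ, E) F A) (ofFunction a ha) f ⟨x, y⟩
  have h2 := L.toFunction_bracket_smul (oneSection 𝓘(ℝ, E) F A) (ofFunction a ha) f ⟨x, y'⟩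
  rw [toFunction_ofFunction] at h1 h2
  have e1 := (hg' ⟨x, y⟩).symm.trans (h1.trans (congrArg (fun r => f x * r + _) (hg ⟨x, y⟩)))
  have e2 := (hg' ⟨x, y'⟩).symm.trans (h2.trans (congrArg (fun r => f x * r + _) (hg ⟨x, y'⟩)))
  exact add_left_cancel (e1.symm.trans e2)

theorem IsAlmostSpecial.reebSection_smul (hrank : 0 < Module.finrank ℝ F)
    (hL : L.IsAlmostSpecial (oneSection 𝓘(ℝ, E) F A)) (f : C^∞⟮𝓘(ℝ, E), M; 𝓘(ℝ, ℝ), ℝ⟯)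
    (s : Cₛ^∞⟮𝓘(ℝ, E); F →ᴬ[ℝ] ℝ, AffDual A⟯) (p : TotalSpace F A) :
    toFunction (L.reebSection (f • s)) p = f p.proj * toFunction (L.reebSection s) p := by
  refine (L.toFunction_bracket_smul _ s f p).trans ?_
  rw [hL.anchor_one hrank, zero_mul, add_zero]
  rfl

/-- The value at `p` of the affine function corresponding to a section. -/
def _root_.AffDual.evalAt (p : TotalSpace F A) :
    Cₛ^∞⟮𝓘(ℝ, E); F →ᴬ[ℝ] ℝ, AffDual A⟯ →ₗ[ℝ] ℝ where
  toFun s := toFunction s p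
  map_add' _ _ := rfl
  map_smul' _ _ := rfl

theorem IsAlmostSpecial.exists_reeb (hrank : 0 < Module.finrank ℝ F)
    (hL : L.IsAlmostSpecial (oneSection 𝓘(ℝ, E) F A)) (p : TotalSpace F A) :
    ∃ v : TangentSpace (𝓘(ℝ, E).prod 𝓘(ℝ, F)) p, ∀ s,
      toFunction (L.reebSection s) p = differentialAt p s v := by
  refine exists_tangent p 0 ((evalAt p).comp (L.bracket (oneSection 𝓘(ℝ, E) F A)))
    (fun f s => ?_) ?_
  · rw [map_zero, mul_zero, add_zero]
    exact hL.reebSection_smul hrank f s p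
  · rw [LinearMap.comp_apply, L.bracket_self, map_zero]

variable (L) in
/-- The function `Λ(da, db) = ⟦a, b⟧ - a E(b) + b E(a)` on `A` associated with sections of `A⁺`. -/
def bivectorFunction (s t : Cₛ^∞⟮𝓘(ℝ, E); F →ᴬ[ℝ] ℝ, AffDual A⟯) (p : TotalSpace F A) : ℝ :=
  toFunction (L.bracket s t) p - toFunction s p * toFunction (L.reebSection t) p
    + toFunction t p * toFunction (L.reebSection s) p

theorem contMDiff_bivectorFunction (s t : Cₛ^∞⟮𝓘(ℝ, E); F →ᴬ[ℝ] ℝ, AffDual A⟯) :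
    ContMDiff (𝓘(ℝ, E).prod 𝓘(ℝ, F)) 𝓘(ℝ, ℝ) ∞ (L.bivectorFunction s t) := by
  have h := isAffineFunction_toFunction (E := E) (F := F) (A := A)
  exact ((h _).1.sub ((h _).1.mul (h _).1)).add ((h _).1.mul (h _).1)

theorem bivectorFunction_swap (s t : Cₛ^∞⟮𝓘(ℝ, E); F →ᴬ[ℝ] ℝ, AffDual A⟯) (p : TotalSpace F A) :
    L.bivectorFunction s t p = - L.bivectorFunction t s p := by
  simp only [bivectorFunction]
  rw [L.bracket_swap s t, toFunction_neg]
  ring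

theorem IsAlmostSpecial.exists_hamiltonian (hrank : 0 < Module.finrank ℝ F)
    (hL : L.IsAlmostSpecial (oneSection 𝓘(ℝ, E) F A)) (p : TotalSpace F A)
    (s : Cₛ^∞⟮𝓘(ℝ, E); F →ᴬ[ℝ] ℝ, AffDual A⟯) :
    ∃ v : TangentSpace (𝓘(ℝ, E).prod 𝓘(ℝ, F)) p, ∀ t,
      L.bivectorFunction s t p = differentialAt p t v := by
  let B : Cₛ^∞⟮𝓘(ℝ, E); F →ᴬ[ℝ] ℝ, AffDual A⟯ →ₗ[ℝ] ℝ :=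
    (evalAt p).comp (L.bracket s)
      - toFunction s p • (evalAt p).comp (L.bracket (oneSection 𝓘(ℝ, E) F A))
      + toFunction (L.reebSection s) p • evalAt p
  have hB : ∀ t, B t = L.bivectorFunction s t p := fun t => by
    change toFunction (L.bracket s t) p - toFunction s p * toFunction (L.reebSection t) p
      + toFunction (L.reebSection s) p * toFunction t p = _
    rw [bivectorFunction, mul_comm (toFunction t p)]
  simp only [← hB]
  refine exists_tangent p (L.anchor p.proj (s p.proj)) B (fun f t => ?_) ?_
  · rw [hB, hB, bivectorFunction, bivectorFunction, L.toFunction_bracket_smul,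
      hL.reebSection_smul hrank, toFunction_smul]
    ring
  · have h1 : L.reebSection (oneSection 𝓘(ℝ, E) F A) = 0 := L.bracket_self _
    rw [hB, bivectorFunction, L.bracket_one, toFunction_neg, toFunction_oneSection, h1,
      toFunction_zero]
    ring

variable (hrank : 0 < Module.finrank ℝ F) (hL : L.IsAlmostSpecial (oneSection 𝓘(ℝ, E) F A))

/-- The Reeb vector field of an almost-special Lie algebroid structure on `A⁺`. -/
def reeb (p : TotalSpace F A) : TangentSpace (𝓘(ℝ, E).prod 𝓘(ℝ, F)) p :=
  (hL.exists_reeb hrank p).choose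

theorem dirDeriv_reeb (s : Cₛ^∞⟮𝓘(ℝ, E); F →ᴬ[ℝ] ℝ, AffDual A⟯) :
    dirDeriv (reeb hrank hL) (toFunction s) = toFunction (L.reebSection s) :=
  funext fun p => ((hL.exists_reeb hrank p).choose_spec s).symm

theorem contMDiff_reeb : ContMDiff (𝓘(ℝ, E).prod 𝓘(ℝ, F))
    ((𝓘(ℝ, E).prod 𝓘(ℝ, F)).prod 𝓘(ℝ, E × F)) ∞
    (fun p => TotalSpace.mk' (E × F) p (reeb hrank hL p)) := fun p₀ => by
  refine (isCoordFrame_affineCoord F A p₀).contMDiffAt_section fun k => ?_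
  refine ((isAffineFunction_toFunction (L.reebSection
    (coordSection E F A p₀.proj k))).1 p₀).congr_of_eventuallyEq
      (Filter.Eventually.of_forall fun p => ?_)
  rw [← dirDeriv_reeb hrank hL, toFunction_coordSection]
  rfl

/-- The vector `#_Λ(da)` at `p` for an almost-special Lie algebroid structure on `A⁺`. -/
def sharpSection (s : Cₛ^∞⟮𝓘(ℝ, E); F →ᴬ[ℝ] ℝ, AffDual A⟯) (p : TotalSpace F A) :
    TangentSpace (𝓘(ℝ, E).prod 𝓘(ℝ, F)) p :=
  (hL.exists_hamiltonian hrank p s).choose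

theorem differentialAt_sharpSection (s t : Cₛ^∞⟮𝓘(ℝ, E); F →ᴬ[ℝ] ℝ, AffDual A⟯)
    (p : TotalSpace F A) :
    differentialAt p t (sharpSection hrank hL s p) = L.bivectorFunction s t p :=
  ((hL.exists_hamiltonian hrank p s).choose_spec t).symm

/-- The value at `p` of the bivector field of an almost-special Lie algebroid structure. -/
def bivectorForm (p : TotalSpace F A) :
    LinearMap.BilinForm ℝ (Module.Dual ℝ (TangentSpace (𝓘(ℝ, E).prod 𝓘(ℝ, F)) p)) :=
  LinearMap.mk₂ ℝ (fun α β => ∑ k,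
      α (tangentBasis (𝓘(ℝ, E).prod 𝓘(ℝ, F)) (totalBasis E F) p k)
        * β (sharpSection hrank hL (coordSection E F A p.proj k) p))
    (fun α α' β => by simp only [LinearMap.add_apply, add_mul, Finset.sum_add_distrib])
    (fun c α β => by
      simp only [LinearMap.smul_apply, smul_eq_mul, mul_assoc, Finset.mul_sum])
    (fun α β β' => by simp only [LinearMap.add_apply, mul_add, Finset.sum_add_distrib])
    (fun c α β => by
      simp only [LinearMap.smul_apply, smul_eq_mul, mul_left_comm _ c, Finset.mul_sum])

theorem bivectorForm_apply (p : TotalSpace F A)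
    (s t : Cₛ^∞⟮𝓘(ℝ, E); F →ᴬ[ℝ] ℝ, AffDual A⟯) :
    bivectorForm hrank hL p (differentialAt p s) (differentialAt p t)
      = L.bivectorFunction s t p := by
  rw [bivectorForm, LinearMap.mk₂_apply, bivectorFunction_swap,
    ← differentialAt_sharpSection hrank hL]
  conv_rhs => rw [eq_sum_differentialAt p (differentialAt p s)]
  rw [LinearMap.sum_apply, ← Finset.sum_neg_distrib]
  refine Finset.sum_congr rfl fun k _ => ?_
  rw [LinearMap.smul_apply, differentialAt_sharpSection, differentialAt_sharpSection,
    bivectorFunction_swap, smul_eq_mul, mul_neg]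

/-- The bivector field of an almost-special Lie algebroid structure on `A⁺`. -/
def bivector : BivectorField (𝓘(ℝ, E).prod 𝓘(ℝ, F)) (TotalSpace F A) where
  toFun := bivectorForm hrank hL
  alternating p α := by
    obtain ⟨s, rfl⟩ := differentialAt_surjective p α
    rw [bivectorForm_apply]
    have := L.bivectorFunction_swap s s p
    linarith
  smooth f g hf hg := fun p₀ => by
    obtain ⟨c, hc, hcd, -⟩ := (isCoordFrame_affineCoord F A p₀).exists_covector_coeff hf
    obtain ⟨d, hd, hdd, -⟩ := (isCoordFrame_affineCoord F A p₀).exists_covector_coeff hg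
    have key : ContMDiffAt (𝓘(ℝ, E).prod 𝓘(ℝ, F)) 𝓘(ℝ, ℝ) ∞
        (fun p => ∑ k, ∑ l, c k p * (d l p *
          L.bivectorFunction (coordSection E F A p₀.proj k) (coordSection E F A p₀.proj l) p))
        p₀ :=
      ContMDiffAt.sum fun k _ => ContMDiffAt.sum fun l _ =>
        (hc k).mul ((hd l).mul (contMDiff_bivectorFunction _ _ p₀))
    refine key.congr_of_eventuallyEq ?_
    filter_upwards [hcd, hdd] with p hp hp'
    change bivectorForm hrank hL p (covector _ f p) (covector _ g p) = _
    rw [hp, hp']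
    simp only [map_sum, map_smul, LinearMap.sum_apply, LinearMap.smul_apply, smul_eq_mul,
      ← toFunction_coordSection, ← differentialAt_apply, bivectorForm_apply, Finset.mul_sum]
    rw [Finset.sum_comm]
    exact Finset.sum_congr rfl fun k _ => Finset.sum_congr rfl fun l _ => mul_left_comm _ _ _

theorem bivector_apply (s t : Cₛ^∞⟮𝓘(ℝ, E); F →ᴬ[ℝ] ℝ, AffDual A⟯) :
    (bivector hrank hL).apply (toFunction s) (toFunction t) = L.bivectorFunction s t :=
  funext fun p => bivectorForm_apply hrank hL p s t

theorem jacobiBracket_toFunction (s t : Cₛ^∞⟮𝓘(ℝ, E); F →ᴬ[ℝ] ℝ, AffDual A⟯) :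
    (bivector hrank hL).jacobiBracket (reeb hrank hL) (toFunction s) (toFunction t)
      = toFunction (L.bracket s t) := by
  funext p
  rw [BivectorField.jacobiBracket, bivector_apply, dirDeriv_reeb, dirDeriv_reeb,
    bivectorFunction]
  ring

theorem mdifferentiableAt_dirDeriv_reeb (s : Cₛ^∞⟮𝓘(ℝ, E); F →ᴬ[ℝ] ℝ, AffDual A⟯)
    (p : TotalSpace F A) : MDifferentiableAt (𝓘(ℝ, E).prod 𝓘(ℝ, F)) 𝓘(ℝ, ℝ)
      (dirDeriv (reeb hrank hL) (toFunction s)) p := by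
  rw [dirDeriv_reeb]
  exact mdifferentiableAt_toFunction _ p

theorem jacobiator_toFunction (s t r : Cₛ^∞⟮𝓘(ℝ, E); F →ᴬ[ℝ] ℝ, AffDual A⟯)
    (p : TotalSpace F A) :
    ((bivector hrank hL).schoutenSelf (toFunction s) (toFunction t) (toFunction r) p
      + 2 * BivectorField.wedgeVector (reeb hrank hL) (bivector hrank hL)
        (toFunction s) (toFunction t) (toFunction r) p) / 2
      + toFunction s p * BivectorField.schoutenVector (reeb hrank hL) (bivector hrank hL)
        (toFunction t) (toFunction r) p
      + toFunction t p * BivectorField.schoutenVector (reeb hrank hL) (bivector hrank hL)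
        (toFunction r) (toFunction s) p
      + toFunction r p * BivectorField.schoutenVector (reeb hrank hL) (bivector hrank hL)
        (toFunction s) (toFunction t) p = 0 := by
  have h := isAffineFunction_toFunction (E := E) (F := F) (A := A)
  rw [← (bivector hrank hL).jacobiator_eq (h s).1 (h t).1 (h r).1
    (mdifferentiableAt_dirDeriv_reeb hrank hL s p) (mdifferentiableAt_dirDeriv_reeb hrank hL t p)
    (mdifferentiableAt_dirDeriv_reeb hrank hL r p)]
  simp only [jacobiBracket_toFunction]
  exact congrFun (congrArg toFunction (L.jacobi s t r)) p

theorem schoutenVector_toFunction (s t : Cₛ^∞⟮𝓘(ℝ, E); F →ᴬ[ℝ] ℝ, AffDual A⟯)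
    (p : TotalSpace F A) :
    BivectorField.schoutenVector (reeb hrank hL) (bivector hrank hL)
      (toFunction s) (toFunction t) p = 0 := by
  have h := jacobiator_toFunction hrank hL (oneSection 𝓘(ℝ, E) F A) s t p
  have h1 : ∀ f : TotalSpace F A → ℝ, (bivector hrank hL).apply f (fun _ => 1) = fun _ => 0 :=
    fun f => funext fun q => BivectorField.apply_const_right _ f 1 q
  have h2 : ∀ f : TotalSpace F A → ℝ, (bivector hrank hL).apply (fun _ => 1) f = fun _ => 0 :=
    fun f => funext fun q => by
      rw [BivectorField.apply_swap, BivectorField.apply_const_right, neg_zero]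
  have h3 : ∀ c : ℝ, dirDeriv (reeb hrank hL) (fun _ => c) = fun _ => 0 :=
    fun c => funext fun q => dirDeriv_const _ _ q
  have h4 : ∀ f : TotalSpace F A → ℝ, (bivector hrank hL).apply f (fun _ => 0) = fun _ => 0 :=
    fun f => funext fun q => BivectorField.apply_const_right _ f 0 q
  have h5 : ∀ f : TotalSpace F A → ℝ, (bivector hrank hL).apply (fun _ => 0) f = fun _ => 0 :=
    fun f => funext fun q => by
      rw [BivectorField.apply_swap, BivectorField.apply_const_right, neg_zero]
  rw [toFunction_oneSection] at h
  simp only [BivectorField.schoutenSelf, BivectorField.wedgeVector] at h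
  have h6 : ∀ f : TotalSpace F A → ℝ, BivectorField.schoutenVector (reeb hrank hL)
      (bivector hrank hL) f (fun _ => 1) p = 0 := fun f => by
    simp only [BivectorField.schoutenVector, h1, h3, h4, sub_zero]
  have h7 : ∀ f : TotalSpace F A → ℝ, BivectorField.schoutenVector (reeb hrank hL)
      (bivector hrank hL) (fun _ => 1) f p = 0 := fun f => by
    simp only [BivectorField.schoutenVector, h2, h3, h5, sub_zero]
  rw [h6, h7] at h
  simp only [h1, h2, h3, h5] at h
  linarith

theorem schoutenSelf_toFunction (s t r : Cₛ^∞⟮𝓘(ℝ, E); F →ᴬ[ℝ] ℝ, AffDual A⟯)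
    (p : TotalSpace F A) :
    (bivector hrank hL).schoutenSelf (toFunction s) (toFunction t) (toFunction r) p
      + 2 * BivectorField.wedgeVector (reeb hrank hL) (bivector hrank hL)
        (toFunction s) (toFunction t) (toFunction r) p = 0 := by
  have h := jacobiator_toFunction hrank hL s t r p
  rw [schoutenVector_toFunction, schoutenVector_toFunction, schoutenVector_toFunction] at h
  linarith

/-- The Jacobi structure on `A` given by an almost-special Lie algebroid structure on `A⁺`. -/
def toJacobiStructure : JacobiStructure (𝓘(ℝ, E).prod 𝓘(ℝ, F)) (TotalSpace F A) where
  bivector := bivector hrank hL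
  reeb := ⟨reeb hrank hL, contMDiff_reeb hrank hL⟩
  schouten_self f g h hf hg hh p := by
    have := (bivector hrank hL).schoutenSelf_add_wedge_eq_zero (isCoordFrame_affineCoord F A p)
      (reeb hrank hL) hf hg hh fun i j k => by
        simp only [← toFunction_coordSection]
        exact schoutenSelf_toFunction hrank hL _ _ _ p
    refine (eq_neg_of_add_eq_zero_left this).trans ?_
    rw [neg_mul]
    rfl
  schouten_reeb f g hf hg p := by
    refine (bivector hrank hL).schoutenVector_eq_zero (isCoordFrame_affineCoord F A p)
      (fun i => ?_) hf hg fun i j => ?_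
    · rw [← toFunction_coordSection]
      exact mdifferentiableAt_dirDeriv_reeb hrank hL _ p
    · simp only [← toFunction_coordSection]
      exact schoutenVector_toFunction hrank hL _ _ p

theorem toJacobiStructure_bracket (s t : Cₛ^∞⟮𝓘(ℝ, E); F →ᴬ[ℝ] ℝ, AffDual A⟯) :
    (toJacobiStructure hrank hL).bracket (toFunction s) (toFunction t)
      = toFunction (L.bracket s t) :=
  jacobiBracket_toFunction hrank hL s t

theorem isStronglyAffine_toJacobiStructure : (toJacobiStructure hrank hL).IsStronglyAffine := by
  have hA : (toJacobiStructure hrank hL).IsAffine := fun a b ha hb => by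
    rw [← toFunction_ofFunction ha, ← toFunction_ofFunction hb, toJacobiStructure_bracket]
    exact isAffineFunction_toFunction _
  refine ⟨hA, fun a ha b hb => ?_⟩
  obtain ⟨f, hf⟩ := hL.exists_reebSection (ofFunction a ha)
  have e : dirDeriv ((toJacobiStructure hrank hL).hamiltonian a) b
      = fun p => (toJacobiStructure hrank hL).bracket a b p + f p.proj * b p := funext fun p => by
    rw [JacobiStructure.dirDeriv_hamiltonian_eq_bracket, mul_comm]
    congr 2
    rw [← hf, ← dirDeriv_reeb hrank hL, toFunction_ofFunction]
    rfl
  rw [e]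
  exact (hA a b ha hb).add (hb.basic_mul f.contMDiff)

end LieAlgebroid

end AlgebroidToJacobi

/-! ## The correspondence -/

section Correspondence

variable {E : Type*} [NormedAddCommGroup E] [NormedSpace ℝ E] [FiniteDimensional ℝ E]
  {M : Type*} [TopologicalSpace M] [T2Space M] [ChartedSpace E M] [IsManifold 𝓘(ℝ, E) ∞ M]
  {F : Type*} [NormedAddCommGroup F] [NormedSpace ℝ F] [FiniteDimensional ℝ F]
  {V : M → Type*} [∀ x, AddCommGroup (V x)] [∀ x, Module ℝ (V x)]
  {A : M → Type*} [∀ x, AddTorsor (V x) (A x)] [∀ x, TopologicalSpace (A x)]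
  [TopologicalSpace (TotalSpace F A)] [FiberBundle F A] [AffineBundle F A]
  [SmoothFiberBundle 𝓘(ℝ, E) F A]

open AffDual

/-- A Jacobi structure on `A` is determined by the brackets of affine functions. -/
theorem JacobiStructure.eq_of_bracket_toFunction_eq
    {J J' : JacobiStructure (𝓘(ℝ, E).prod 𝓘(ℝ, F)) (TotalSpace F A)}
    (h : ∀ s t : Cₛ^∞⟮𝓘(ℝ, E); F →ᴬ[ℝ] ℝ, AffDual A⟯,
      J.bracket (toFunction s) (toFunction t) = J'.bracket (toFunction s) (toFunction t)) :
    J = J' := by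
  have hdir : ∀ (s : Cₛ^∞⟮𝓘(ℝ, E); F →ᴬ[ℝ] ℝ, AffDual A⟯) p,
      dirDeriv J.reeb (toFunction s) p = dirDeriv J'.reeb (toFunction s) p := fun s p => by
    have h1 := congrFun (h s (oneSection 𝓘(ℝ, E) F A)) p
    rw [toFunction_oneSection, J.bracket_one, J'.bracket_one] at h1
    simpa using h1
  have hreeb : J.reeb = J'.reeb := ContMDiffSection.ext fun p => by
    refine (isCoordFrame_affineCoord F A p).eq_of_mvfderiv_eq fun k => ?_
    rw [← toFunction_coordSection]
    exact hdir _ p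
  have hbiv : J.bivector.toFun = J'.bivector.toFun := funext fun p => by
    refine LinearMap.ext₂ fun α β => ?_
    obtain ⟨s, rfl⟩ := differentialAt_surjective p α
    obtain ⟨t, rfl⟩ := differentialAt_surjective p β
    have h1 := congrFun (h s t) p
    simp only [bracket, hdir] at h1
    exact add_right_cancel (sub_left_inj.1 h1)
  obtain ⟨⟨Λ, _, _⟩, R, _, _⟩ := J
  obtain ⟨⟨Λ', _, _⟩, R', _, _⟩ := J'
  obtain rfl : Λ = Λ' := hbiv
  obtain rfl : R = R' := hreeb
  rfl

/-- In a Lie algebroid structure on `A⁺`, the anchor is determined by the bracket. -/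
theorem LieAlgebroid.mvfderiv_anchor (L : LieAlgebroid 𝓘(ℝ, E) (F →ᴬ[ℝ] ℝ) (AffDual A))
    (s : Cₛ^∞⟮𝓘(ℝ, E); F →ᴬ[ℝ] ℝ, AffDual A⟯) (f : C^∞⟮𝓘(ℝ, E), M; 𝓘(ℝ, ℝ), ℝ⟯)
    (p : TotalSpace F A) :
    mvfderiv 𝓘(ℝ, E) f p.proj (L.anchor p.proj (s p.proj))
      = toFunction (L.bracket s (f • oneSection 𝓘(ℝ, E) F A)) p
        - f p.proj * toFunction (L.bracket s (oneSection 𝓘(ℝ, E) F A)) p := by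
  rw [L.toFunction_bracket_smul, toFunction_oneSection]
  ring

theorem LieAlgebroid.eq_of_toFunction_bracket_eq
    {L L' : LieAlgebroid 𝓘(ℝ, E) (F →ᴬ[ℝ] ℝ) (AffDual A)}
    (h : ∀ s t, toFunction (L.bracket s t) = toFunction (L'.bracket s t)) : L = L' := by
  have hbr : L.bracket = L'.bracket := LinearMap.ext₂ fun s t => toFunction_injective (h s t)
  have hanchor : L.anchor = L'.anchor := funext fun x => LinearMap.ext fun α => by
    obtain ⟨s, rfl⟩ := exists_section_eq (E := E) (F := F) x α
    refine JacobiStructure.tangent_ext F A fun f hf => ?_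
    let f' : C^∞⟮𝓘(ℝ, E), M; 𝓘(ℝ, ℝ), ℝ⟯ := ⟨f, hf⟩
    have h1 := L.mvfderiv_anchor s f' ⟨x, Classical.arbitrary (A x)⟩
    have h2 := L'.mvfderiv_anchor s f' ⟨x, Classical.arbitrary (A x)⟩
    rw [← hbr] at h2
    exact h1.trans h2.symm
  obtain ⟨b, ρ, _, _, _, _⟩ := L
  obtain ⟨b', ρ', _, _, _, _⟩ := L'
  obtain rfl : b = b' := hbr
  obtain rfl : ρ = ρ' := hanchor
  rfl

end Correspondence

end

theorem mainTheorem5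
    {E : Type*} [NormedAddCommGroup E] [NormedSpace ℝ E] [FiniteDimensional ℝ E]
    {M : Type*} [TopologicalSpace M] [T2Space M] [SecondCountableTopology M]
    [ChartedSpace E M] [IsManifold 𝓘(ℝ, E) ∞ M]
    {F : Type*} [NormedAddCommGroup F] [NormedSpace ℝ F] [FiniteDimensional ℝ F]
    {V : M → Type*} [∀ x, AddCommGroup (V x)] [∀ x, Module ℝ (V x)]
    {A : M → Type*} [∀ x, AddTorsor (V x) (A x)] [∀ x, TopologicalSpace (A x)]
    [TopologicalSpace (TotalSpace F A)] [FiberBundle F A] [AffineBundle F A]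
    [SmoothFiberBundle 𝓘(ℝ, E) F A]
    (hrank : 0 < Module.finrank ℝ F) :
    ∃ Φ : {J : JacobiStructure (𝓘(ℝ, E).prod 𝓘(ℝ, F)) (TotalSpace F A) // J.IsStronglyAffine} ≃
        {L : LieAlgebroid 𝓘(ℝ, E) (F →ᴬ[ℝ] ℝ) (AffDual A) //
          L.IsAlmostSpecial (AffDual.oneSection 𝓘(ℝ, E) F A)},
      (∀ J L, Φ J = L ↔ ∀ a b : Cₛ^∞⟮𝓘(ℝ, E); F →ᴬ[ℝ] ℝ, AffDual A⟯,
        AffDual.toFunction (L.1.bracket a b)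
          = J.1.bracket (AffDual.toFunction a) (AffDual.toFunction b)) ∧
      (∀ J, ∀ (a : Cₛ^∞⟮𝓘(ℝ, E); F →ᴬ[ℝ] ℝ, AffDual A⟯) (f : C^∞⟮𝓘(ℝ, E), M; 𝓘(ℝ, ℝ), ℝ⟯)
        (p : TotalSpace F A),
        mvfderiv 𝓘(ℝ, E) f p.proj ((Φ J).1.anchor p.proj (a p.proj))
          = J.1.bracket (AffDual.toFunction a) (fun q => f q.proj) p
            - f p.proj * J.1.bracket (AffDual.toFunction a) (fun _ => 1) p) := by
  let Ψ : {J : JacobiStructure (𝓘(ℝ, E).prod 𝓘(ℝ, F)) (TotalSpace F A) // J.IsStronglyAffine} →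
      {L : LieAlgebroid 𝓘(ℝ, E) (F →ᴬ[ℝ] ℝ) (AffDual A) //
        L.IsAlmostSpecial (AffDual.oneSection 𝓘(ℝ, E) F A)} := fun J =>
    ⟨JacobiStructure.toLieAlgebroid hrank J.2,
      JacobiStructure.isAlmostSpecial_toLieAlgebroid hrank J.2⟩
  have hΨ : ∀ J s t, AffDual.toFunction ((Ψ J).1.bracket s t)
      = J.1.bracket (AffDual.toFunction s) (AffDual.toFunction t) := fun J =>
    JacobiStructure.toFunction_toLieAlgebroid_bracket hrank J.2
  have huniq : ∀ J L, Ψ J = L ↔ ∀ a b : Cₛ^∞⟮𝓘(ℝ, E); F →ᴬ[ℝ] ℝ, AffDual A⟯,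
      AffDual.toFunction (L.1.bracket a b)
        = J.1.bracket (AffDual.toFunction a) (AffDual.toFunction b) := by
    refine fun J L => ⟨?_, fun h => Subtype.ext ?_⟩
    · rintro rfl
      exact hΨ J
    · exact LieAlgebroid.eq_of_toFunction_bracket_eq fun s t => (hΨ J s t).trans (h s t).symm
  have hbij : Function.Bijective Ψ := by
    refine ⟨fun J J' h => Subtype.ext ?_, fun L => ?_⟩
    · refine JacobiStructure.eq_of_bracket_toFunction_eq fun s t => ?_
      rw [← hΨ, ← hΨ, h]
    · exact ⟨⟨LieAlgebroid.toJacobiStructure hrank L.2,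
        LieAlgebroid.isStronglyAffine_toJacobiStructure hrank L.2⟩, (huniq _ L).2 fun s t =>
          (LieAlgebroid.toJacobiStructure_bracket hrank L.2 s t).symm⟩
  refine ⟨Equiv.ofBijective Ψ hbij, huniq, fun J a f p => ?_⟩
  change mvfderiv 𝓘(ℝ, E) f p.proj ((Ψ J).1.anchor p.proj (a p.proj)) = _
  have e : AffDual.toFunction (f • AffDual.oneSection 𝓘(ℝ, E) F A) = fun q => f q.proj := by
    rw [AffDual.toFunction_smul, AffDual.toFunction_oneSection]
    exact funext fun q => mul_one _
  rw [LieAlgebroid.mvfderiv_anchor, hΨ, hΨ, e, AffDual.toFunction_oneSection]
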